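/- A binary-input discrete memoryless channel (B-DMC) $W$ with discrete output alphabet $\mathcal Y$ is a pair of probability distributions $W(\cdot|0), W(\cdot|1)$ on $\mathcal Y$. Put $q_V(y)=\tfrac12\bigl(V(y|0)+V(y|1)\bigr)$ and, for two B-DMCs $W,V$ with the same output alphabet, $$I(W,V)=\sum_{y}\sum_{x\in\{0,1\}}\tfrac12\,W(y|x)\,\log_2\frac{V(y|x)}{q_V(y)}\in[-\infty,1],$$ where a summand is $0$ if $W(y|x)=0$ and is $-\infty$ if $W(y|x)>0$ and $V(y|x)=0$. The polarization transforms of $W$ are the B-DMCs $$W^-(y_1y_2|u_1)=\sum_{u_2\in\mathbb F_2}\tfrac12 W(y_1|u_1\oplus u_2)W(y_2|u_2),\qquad W^+(y_1y_2u_1|u_2)=\tfrac12 W(y_1|u_1\oplus u_2)W(y_2|u_2).$$ Let $B_0,B_1,\dots$ be i.i.d. fair bits, let $W_0=W$, $V_0=V$ and, for $n\ge 0$, let $(W_{n+1},V_{n+1})=(W_n^-,V_n^-)$ if $B_n=0$ and $(W_{n+1},V_{n+1})=(W_n^+,V_n^+)$ if $B_n=1$. Put $I_n(W,V)=I(W_n,V_n)$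 and $N=2^n$. **Theorem.** Let $W$ and $V$ be B-DMCs with the same output alphabet such that $I(W,V)>-\infty$. Then $I_n(W,V)$ converges almost surely to a random variable $I_\infty(W,V)$ which almost surely takes only the values $0$ and $1$, and $$\mathbb P\bigl[I_\infty(W,V)=1\bigr]\ \ge\ I(W,V).$$ Moreover, the convergence has speed $2^{-N^{\beta}}$ for every $\beta<\tfrac12$: for every real $\beta<\tfrac12$, almost surely $$\bigl|I_n(W,V)-I_\infty(W,V)\bigr|=O\bigl(2^{-N^{\beta}}\bigr)\qquad(n\to\infty).$$ -/

import Mathlib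

open MeasureTheory ProbabilityTheory Filter Topology
open scoped ENNReal

/-- A binary-input discrete memoryless channel with output alphabet `Y`: for each input `x ∈ 𝔽₂`,
the discrete probability distribution `W(· | x)` on `Y`, so that `W x y` is `W(y | x)`. -/
abbrev BDMC (Y : Type*) : Type _ := ZMod 2 → PMF Y

namespace BDMC

variable {Y : Type*}

theorem tsum_prod_eq_one (p q : PMF Y) : ∑' y : Y × Y, p y.1 * q y.2 = 1 := by
  rw [ENNReal.tsum_prod (f := fun a b => p a * q b)]
  simp_rw [ENNReal.tsum_mul_left, PMF.tsum_coe, mul_one, PMF.tsum_coe]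

/-- `W⁻(y₁ y₂ | u₁) = ∑_{u₂} ½ W(y₁ | u₁ ⊕ u₂) W(y₂ | u₂)`. -/
noncomputable def minus (W : BDMC Y) : BDMC (Y × Y) := fun u₁ =>
  ⟨fun y => ∑ u₂ : ZMod 2, 2⁻¹ * (W (u₁ + u₂) y.1 * W u₂ y.2), by
    refine ENNReal.summable.hasSum_iff.2 ?_
    rw [Summable.tsum_finsetSum (fun _ _ => ENNReal.summable)]
    simp_rw [ENNReal.tsum_mul_left, tsum_prod_eq_one]
    simp only [mul_one, Finset.sum_const, Finset.card_univ, ZMod.card, nsmul_eq_mul]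
    exact ENNReal.mul_inv_cancel (a := ((2 : ℕ) : ℝ≥0∞)) (by norm_num) (by norm_num)⟩

/-- `W⁺(y₁ y₂ u₁ | u₂) = ½ W(y₁ | u₁ ⊕ u₂) W(y₂ | u₂)`. -/
noncomputable def plus (W : BDMC Y) : BDMC ((Y × Y) × ZMod 2) := fun u₂ =>
  ⟨fun z => 2⁻¹ * (W (z.2 + u₂) z.1.1 * W u₂ z.1.2), by
    refine ENNReal.summable.hasSum_iff.2 ?_
    rw [ENNReal.tsum_prod
      (f := fun (y : Y × Y) (u₁ : ZMod 2) => 2⁻¹ * (W (u₁ + u₂) y.1 * W u₂ y.2)),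
      ENNReal.tsum_comm]
    simp_rw [ENNReal.tsum_mul_left, tsum_prod_eq_one]
    simp only [mul_one, tsum_fintype, Finset.sum_const, Finset.card_univ, ZMod.card,
      nsmul_eq_mul]
    exact ENNReal.inv_mul_cancel (a := ((2 : ℕ) : ℝ≥0∞)) (by norm_num) (by norm_num)⟩

/-- Output distribution under uniform inputs: `q_V(y) = (V(y|0) + V(y|1)) / 2`. -/
noncomputable def outDist (V : BDMC Y) (y : Y) : ℝ≥0∞ := (V 0 y + V 1 y) / 2

/-- The summand `½ W(y|x) log₂ (V(y|x) / q_V(y))`, with values in `[-∞, ∞)`. Here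
`0 · log₂ (·) = 0`, and the summand is `-∞` when `W(y|x) > 0` and `V(y|x) = 0`. -/
noncomputable def infoTerm (W V : BDMC Y) (y : Y) (x : ZMod 2) : EReal :=
  ((W x y / 2 : ℝ≥0∞) : EReal) * (ENNReal.log (V x y / outDist V y) / (Real.log 2 : EReal))

/-- The mismatched mutual information
`I(W, V) = ∑_y ∑_x ½ W(y|x) log₂ (V(y|x) / q_V(y))`, with values in `[-∞, 1]`. On a possibly
infinite alphabet the sum is the sum of the positive parts, which is at most `1`, minus the sum
of the negative parts, which may be infinite. -/
noncomputable def mutualInfo (W V : BDMC Y) : EReal :=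
  ((∑' y : Y, ∑ x : ZMod 2, (infoTerm W V y x).toENNReal : ℝ≥0∞) : EReal)
    - ((∑' y : Y, ∑ x : ZMod 2, (-infoTerm W V y x).toENNReal : ℝ≥0∞) : EReal)

/-- Output alphabet of the channel synthesized from a channel with output alphabet `Y` by a word
of polarization steps (`false` for minus, `true` for plus; the head is the last step applied). -/
def Alphabet.{u} (Y : Type u) : List Bool → Type u
  | [] => Y
  | false :: l => Alphabet Y l × Alphabet Y l
  | true :: l => (Alphabet Y l × Alphabet Y l) × ZMod 2

/-- The channel synthesized from `W` by a word of polarization steps. -/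
noncomputable def synth (W : BDMC Y) : (l : List Bool) → BDMC (Alphabet Y l)
  | [] => W
  | false :: l => minus (synth W l)
  | true :: l => plus (synth W l)

/-- The word of the first `n` steps of the path `b`, the last of them at the head. -/
def firstSteps (b : ℕ → Bool) : ℕ → List Bool
  | 0 => []
  | n + 1 => b n :: firstSteps b n

/-- `I_n(W, V) = I(W_n, V_n)` along the path `b`: both channels undergo the same steps,
`W_{n+1} = W_n⁻` if `b n = false` and `W_{n+1} = W_n⁺` if `b n = true`. -/
noncomputable def infoProcess (W V : BDMC Y) (b : ℕ → Bool) (n : ℕ) : EReal :=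
  mutualInfo (synth W (firstSteps b n)) (synth V (firstSteps b n))

end BDMC

/-! Let `a = V(y|x⊕1) / V(y|x)`, with `x` uniform and `y` drawn from `W(·|x)`. Then `I(W,V) = 1 - E
log₂(1+a)`, and a polarization step replaces `a` by `(a+b)/(1+ab)` (minus) or `ab` (plus), with `b`
an independent copy of `a` (`law_minus`, `law_plus`). The whole problem thus concerns one law on
`[0,∞)`. Since `(1+ab)+(a+b) = (1+a)(1+b)`, the expected loss `E log(1+a)` is a nonnegative
martingale along the random path.

Useless end. The bias `E |1-a|/(1+a)` is squared by minus steps and at most doubled by plus steps,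
and it drives down the excess loss `E (log((1+a)/2))⁺`; the expected loss lies between `log 2 -
bias` and `log 2 + excess`. So if the bias is infinitely often below some `r < 1`, then `I_n → 0`
fast.

Perfect end. Mismatch leaves no Bhattacharyya parameter: `E a^s` may be infinite for every `s > 0`.
If `P(a ≠ 0)`, which plus steps square, is infinitely often at most 3/4, the loss vanishes fast.
Otherwise there are infinitely many times with bounded loss, bias near 1 and little mass at `a = 0`,
and then most of the mass lies in `0 < a < exp(-2^j)` (`exists_spread_of_bias`). Below each
threshold `exp(-x)` the law evolves almost like an erasure channel with erasure probability `P(a >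
exp(-x))` (`prob_lawAt_le`). In a chain of thresholds these probabilities rise from at most 1/8 to
above 1/2; erasure channels polarize exponentially fast, so with probability bounded below two
neighbours are sent to opposite extremes (`le_fairPath_exists_transition`). Then `-log a` is
concentrated between the two scales. Doing this twice, first with spacing 2 and then with a finer
spacing, yields a window whose ratio is small compared with the log-mass of its outliers. From such
a window truncated moments `E[a^s; a ≤ exp R]` can be iterated, and the loss vanishes fast
(`exists_fast_of_concentrated`).

Each implication first holds with probability bounded below, and Lévy's zero-one law upgrades it to
almost sure (`ae_mem_of_frequently`). By Fatou the loss has a finite limit inferior, so one of the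
cases always occurs (`ae_fast_or_fast`). Fatou again gives `log 2 · P(I_∞ = 0) ≤ E log(1+a)`, the
bound on `P(I_∞ = 1)`. The exponent 1/2 comes from the law of large numbers: each type of step has
frequency 1/2. -/

open scoped NNReal

namespace Polar

open BDMC (firstSteps)

/-! ### Expectations under discrete laws -/

/-- Expectation of a nonnegative function under a discrete distribution. -/
noncomputable def expect {α : Type*} (p : PMF α) (φ : α → ℝ≥0∞) : ℝ≥0∞ := ∑' a, p a * φ a

section Expect

variable {α β : Type*} (p : PMF α)

theorem expect_pure (a : α) (φ : α → ℝ≥0∞) : expect (PMF.pure a) φ = φ a := by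
  classical
  unfold expect
  rw [tsum_eq_single a]
  · simp
  · intro b hb
    simp [hb]

theorem expect_bind (f : α → PMF β) (φ : β → ℝ≥0∞) :
    expect (p.bind f) φ = expect p fun a => expect (f a) φ := by
  unfold expect
  simp_rw [PMF.bind_apply, ← ENNReal.tsum_mul_right, ← ENNReal.tsum_mul_left]
  rw [ENNReal.tsum_comm]
  simp_rw [mul_assoc]

theorem expect_const (c : ℝ≥0∞) : expect p (fun _ => c) = c := by
  unfold expect
  rw [ENNReal.tsum_mul_right, PMF.tsum_coe, one_mul]

theorem expect_add (φ ψ : α → ℝ≥0∞) :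
    expect p (fun a => φ a + ψ a) = expect p φ + expect p ψ := by
  unfold expect
  simp_rw [mul_add]
  exact ENNReal.tsum_add

theorem expect_mul_left (c : ℝ≥0∞) (φ : α → ℝ≥0∞) :
    expect p (fun a => c * φ a) = c * expect p φ := by
  unfold expect
  rw [← ENNReal.tsum_mul_left]
  exact tsum_congr fun a => mul_left_comm _ _ _

theorem expect_mul_right (c : ℝ≥0∞) (φ : α → ℝ≥0∞) :
    expect p (fun a => φ a * c) = expect p φ * c := by
  unfold expect
  rw [← ENNReal.tsum_mul_right]
  exact tsum_congr fun a => (mul_assoc _ _ _).symm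

theorem expect_mono {φ ψ : α → ℝ≥0∞} (h : ∀ a, φ a ≤ ψ a) : expect p φ ≤ expect p ψ :=
  ENNReal.tsum_le_tsum fun a => mul_le_mul_right (h a) _

theorem expect_congr {φ ψ : α → ℝ≥0∞} (h : ∀ a, p a ≠ 0 → φ a = ψ a) :
    expect p φ = expect p ψ := by
  refine tsum_congr fun a => ?_
  by_cases ha : p a = 0
  · simp [ha]
  · rw [h a ha]

theorem expect_mul_mul (φ ψ : α → ℝ≥0∞) :
    expect p (fun a => expect p fun b => φ a * ψ b) = expect p φ * expect p ψ := by
  simp_rw [expect_mul_left, expect_mul_right]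

/-- Laws on different constructions are compared by testing, because `bind` becomes an iterated
expectation. -/
theorem pmf_eq_of_expect {p q : PMF α} (h : ∀ φ, expect p φ = expect q φ) : p = q := by
  classical
  ext a
  have key : ∀ r : PMF α, expect r (fun b => if b = a then 1 else 0) = r a := by
    intro r
    unfold expect
    rw [tsum_eq_single a]
    · simp
    · intro b hb
      simp [hb]
  rw [← key p, h, key]

end Expect

/-! ### Likelihood ratios and the polarization recursion on their laws -/

/-- Distributions of the likelihood ratio `V(y | x ⊕ 1) / V(y | x)`. -/
abbrev Law := PMF ℝ≥0

/-- The effect of a polarization step on a pair of likelihood ratios. -/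
noncomputable def combine : Bool → ℝ≥0 → ℝ≥0 → ℝ≥0
  | false, a, b => (a + b) / (1 + a * b)
  | true, a, b => a * b

/-- The effect of a polarization step on the law of the likelihood ratio. -/
noncomputable def step (t : Bool) (p : Law) : Law :=
  p.bind fun a => p.bind fun b => PMF.pure (combine t a b)

/-- The law obtained from `p` by a word of polarization steps. -/
noncomputable def lawAt (p : Law) : List Bool → Law
  | [] => p
  | t :: l => step t (lawAt p l)

theorem lawAt_append (p : Law) (l w : List Bool) :
    lawAt p (l ++ w) = lawAt (lawAt p w) l := by
  induction l with
  | nil => rfl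
  | cons t l ih => simp [lawAt, ih]

theorem expect_step (t : Bool) (p : Law) (φ : ℝ≥0 → ℝ≥0∞) :
    expect (step t p) φ = expect p fun a => expect p fun b => φ (combine t a b) := by
  unfold step
  simp_rw [expect_bind, expect_pure]

section Channel

variable {Y : Type*}

/-- The likelihood ratio `V(y | x ⊕ 1) / V(y | x)`. -/
noncomputable def ratio (V : BDMC Y) (x : ZMod 2) (y : Y) : ℝ≥0 :=
  (V (x + 1) y / V x y).toNNReal

/-- The law of the likelihood ratio of `V` when the data are produced by `W`. -/
noncomputable def law (W V : BDMC Y) : Law :=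
  (PMF.uniformOfFintype (ZMod 2)).bind fun x => (W x).bind fun y => PMF.pure (ratio V x y)

/-- `W` gives no mass where `V` gives none. -/
def Dominated (W V : BDMC Y) : Prop := ∀ x y, V x y = 0 → W x y = 0

theorem expect_law (W V : BDMC Y) (φ : ℝ≥0 → ℝ≥0∞) :
    expect (law W V) φ = ∑ x : ZMod 2, 2⁻¹ * ∑' y, W x y * φ (ratio V x y) := by
  unfold law
  simp_rw [expect_bind, expect_pure]
  unfold expect
  rw [tsum_fintype]
  simp

theorem minus_apply (W : BDMC Y) (u : ZMod 2) (y : Y × Y) :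
    BDMC.minus W u y = ∑ v : ZMod 2, 2⁻¹ * (W (u + v) y.1 * W v y.2) := rfl

theorem plus_apply (W : BDMC Y) (v : ZMod 2) (z : (Y × Y) × ZMod 2) :
    BDMC.plus W v z = 2⁻¹ * (W (z.2 + v) z.1.1 * W v z.1.2) := rfl

theorem sum_zmod_two {M : Type*} [AddCommMonoid M] (f : ZMod 2 → M) :
    ∑ x : ZMod 2, f x = f 0 + f 1 := Fin.sum_univ_two f

theorem Dominated.minus {W V : BDMC Y} (h : Dominated W V) :
    Dominated (BDMC.minus W) (BDMC.minus V) := by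
  intro u y hy
  rw [minus_apply] at hy ⊢
  rw [Finset.sum_eq_zero_iff] at hy ⊢
  intro v hv
  have := hy v hv
  simp only [mul_eq_zero, ENNReal.inv_eq_zero, ENNReal.ofNat_ne_top, false_or] at this ⊢
  exact this.imp (h _ _) (h _ _)

theorem Dominated.plus {W V : BDMC Y} (h : Dominated W V) :
    Dominated (BDMC.plus W) (BDMC.plus V) := by
  intro v z hz
  rw [plus_apply] at hz ⊢
  simp only [mul_eq_zero, ENNReal.inv_eq_zero, ENNReal.ofNat_ne_top, false_or] at hz ⊢
  exact hz.imp (h _ _) (h _ _)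

/-- No positivity is needed: where `V` vanishes at the true input, the ratio takes the default value
0 on both sides. -/
theorem ratio_plus (V : BDMC Y) (u v : ZMod 2) (y₁ y₂ : Y) :
    ratio (BDMC.plus V) v ((y₁, y₂), u) = ratio V (u + v) y₁ * ratio V v y₂ := by
  unfold ratio
  rw [plus_apply, plus_apply, ← ENNReal.toNNReal_mul]
  congr 1
  simp only
  rw [ENNReal.mul_div_mul_left _ _ (by simp) (by simp), ← add_assoc]
  exact ENNReal.mul_div_mul_comm (Or.inr (PMF.apply_ne_top _ _)) (Or.inl (PMF.apply_ne_top _ _))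

/-- Divide numerator and denominator of `(a'b + ab')/(ab + a'b')` by `ab`. The hypotheses exclude
the default value 0 of a ratio with vanishing denominator, for which the formula fails. -/
theorem ratio_minus (V : BDMC Y) (u v : ZMod 2) (y₁ y₂ : Y) (h₁ : V (u + v) y₁ ≠ 0)
    (h₂ : V v y₂ ≠ 0) :
    ratio (BDMC.minus V) u (y₁, y₂) = combine false (ratio V (u + v) y₁) (ratio V v y₂) := by
  have hs : ∀ f : ZMod 2 → ℝ≥0∞, ∑ x, f x = f v + f (v + 1) := by
    intro f
    rw [sum_zmod_two]
    fin_cases v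
    · rfl
    · rw [add_comm]
      rfl
  have e2 : v + 1 + 1 = v := by
    rw [add_assoc]
    exact add_zero v
  have e1 : u + (v + 1) = u + v + 1 := by ring
  have e3 : u + 1 + (v + 1) = u + v := by
    have : (1 : ZMod 2) + 1 = 0 := rfl
    linear_combination this
  have e4 : u + 1 + v = u + v + 1 := by ring
  unfold ratio combine
  rw [minus_apply, minus_apply, hs, hs]
  simp only [e1, e3, e4]
  lift V (u + v) y₁ to ℝ≥0 using PMF.apply_ne_top _ _ with a
  lift V (u + v + 1) y₁ to ℝ≥0 using PMF.apply_ne_top _ _ with a'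
  lift V v y₂ to ℝ≥0 using PMF.apply_ne_top _ _ with b
  lift V (v + 1) y₂ to ℝ≥0 using PMF.apply_ne_top _ _ with b'
  have ha : a ≠ 0 := by exact_mod_cast h₁
  have hb : b ≠ 0 := by exact_mod_cast h₂
  have h2 : ((2 : ℝ≥0∞))⁻¹ = ((2⁻¹ : ℝ≥0) : ℝ≥0∞) := by
    rw [ENNReal.coe_inv (by norm_num)]; rfl
  rw [h2]
  norm_cast
  rw [← ENNReal.coe_div (by positivity), ENNReal.toNNReal_coe]
  field_simp

/-- The map `(u₁,u₂) ↦ (u₁+u₂,u₂)` preserves uniformity, so the two uses of the channel have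
independent uniform inputs and their ratios are independent with the original law. -/
theorem law_plus (W V : BDMC Y) :
    law (BDMC.plus W) (BDMC.plus V) = step true (law W V) := by
  refine pmf_eq_of_expect fun φ => ?_
  rw [expect_step, expect_law]
  simp_rw [expect_law, combine]
  have h : ∀ v : ZMod 2, ∑' z, BDMC.plus W v z * φ (ratio (BDMC.plus V) v z) =
      ∑ u : ZMod 2, 2⁻¹ * ∑' y₁, W (u + v) y₁ * ∑' y₂, W v y₂ *
        φ (ratio V (u + v) y₁ * ratio V v y₂) := by
    intro v
    rw [ENNReal.tsum_prod', ENNReal.tsum_prod']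
    simp_rw [plus_apply, ratio_plus, tsum_fintype]
    rw [← ENNReal.tsum_prod (f := fun y₁ y₂ => ∑ u : ZMod 2, 2⁻¹ * (W (u + v) y₁ * W v y₂) *
      φ (ratio V (u + v) y₁ * ratio V v y₂)), Summable.tsum_finsetSum
        (fun _ _ => ENNReal.summable)]
    refine Finset.sum_congr rfl fun u _ => ?_
    rw [ENNReal.tsum_prod (f := fun y₁ y₂ => 2⁻¹ * (W (u + v) y₁ * W v y₂) *
      φ (ratio V (u + v) y₁ * ratio V v y₂))]
    simp_rw [← ENNReal.tsum_mul_left]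
    refine tsum_congr fun y₁ => tsum_congr fun y₂ => ?_
    ring
  simp_rw [h, sum_zmod_two]
  have e : (1 : ZMod 2) + 1 = 0 := rfl
  simp only [e, zero_add, add_zero, mul_add, ENNReal.tsum_add, ← ENNReal.tsum_mul_left]
  have c : ∀ x y : ZMod 2, (∑' (i : Y) (j : Y), (2⁻¹ : ℝ≥0∞) * (2⁻¹ * (W x i * (W y j *
      φ (ratio V x i * ratio V y j))))) = ∑' (i : Y) (j : Y), (2⁻¹ : ℝ≥0∞) * (W x i * (2⁻¹ *
        (W y j * φ (ratio V x i * ratio V y j)))) := by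
    intro x y
    refine tsum_congr fun i => tsum_congr fun j => ?_
    ring
  simp only [c]
  abel

/-- The same change of variables as for plus; domination ensures that the outputs where
`ratio_minus` fails carry no mass. -/
theorem law_minus {W V : BDMC Y} (hd : Dominated W V) :
    law (BDMC.minus W) (BDMC.minus V) = step false (law W V) := by
  refine pmf_eq_of_expect fun φ => ?_
  rw [expect_step, expect_law]
  simp_rw [expect_law]
  have h : ∀ u : ZMod 2, ∑' z, BDMC.minus W u z * φ (ratio (BDMC.minus V) u z) =
      ∑ v : ZMod 2, 2⁻¹ * ∑' y₁, W (u + v) y₁ * ∑' y₂, W v y₂ *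
        φ (combine false (ratio V (u + v) y₁) (ratio V v y₂)) := by
    intro u
    simp_rw [minus_apply, Finset.sum_mul]
    rw [Summable.tsum_finsetSum (fun _ _ => ENNReal.summable)]
    refine Finset.sum_congr rfl fun v _ => ?_
    rw [ENNReal.tsum_prod']
    simp_rw [← ENNReal.tsum_mul_left]
    refine tsum_congr fun y₁ => tsum_congr fun y₂ => ?_
    by_cases h₁ : V (u + v) y₁ = 0
    · simp [hd _ _ h₁]
    by_cases h₂ : V v y₂ = 0
    · simp [hd _ _ h₂]
    rw [ratio_minus V u v y₁ y₂ h₁ h₂]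
    ring
  -- Both sides become sums over the four input pairs, equal up to order.
  simp_rw [h, sum_zmod_two]
  have e : (1 : ZMod 2) + 1 = 0 := rfl
  simp only [e, zero_add, add_zero, mul_add, ENNReal.tsum_add, ← ENNReal.tsum_mul_left]
  have c : ∀ x y : ZMod 2, (∑' (i : Y) (j : Y), (2⁻¹ : ℝ≥0∞) * (2⁻¹ * (W x i * (W y j *
      φ (combine false (ratio V x i) (ratio V y j)))))) = ∑' (i : Y) (j : Y), (2⁻¹ : ℝ≥0∞) *
        (W x i * (2⁻¹ * (W y j * φ (combine false (ratio V x i) (ratio V y j))))) := by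
    intro x y
    refine tsum_congr fun i => tsum_congr fun j => ?_
    ring
  simp only [c]
  abel

theorem dominated_synth {W V : BDMC Y} (hd : Dominated W V) (l : List Bool) :
    Dominated (BDMC.synth W l) (BDMC.synth V l) := by
  induction l with
  | nil => exact hd
  | cons t l ih =>
    cases t
    · exact ih.minus
    · exact ih.plus

theorem law_synth {W V : BDMC Y} (hd : Dominated W V) (l : List Bool) :
    law (BDMC.synth W l) (BDMC.synth V l) = lawAt (law W V) l := by
  induction l with
  | nil => rfl
  | cons t l ih =>
    cases t
    · exact (law_minus (dominated_synth hd l)).trans (congrArg _ ih)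
    · exact (law_plus _ _).trans (congrArg _ ih)

end Channel

/-! ### Mutual information as an expected loss -/

/-- The logarithmic loss, in nats, of a decision made with likelihood ratio `a`. -/
noncomputable def cost (a : ℝ≥0) : ℝ≥0∞ := ENNReal.ofReal (Real.log (1 + a))

theorem log_one_add_nonneg (a : ℝ≥0) : 0 ≤ Real.log (1 + a) :=
  Real.log_nonneg (by simp)

section Channel

variable {Y : Type*} {W V : BDMC Y}

/-- One summand equal to `⊥` makes the sum of negative parts infinite, and subtracting `⊤` in
`EReal` gives `⊥`. -/
theorem dominated_of_bot_lt (h : ⊥ < BDMC.mutualInfo W V) : Dominated W V := by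
  intro x y hV
  by_contra hW
  refine h.ne' ?_
  have hlog : (0 : EReal) < (Real.log 2 : EReal) := by
    exact_mod_cast Real.log_pos (by norm_num)
  have ht : BDMC.infoTerm W V y x = ⊥ := by
    unfold BDMC.infoTerm
    rw [hV, ENNReal.zero_div, ENNReal.log_zero,
      EReal.bot_div_of_pos_ne_top hlog (EReal.coe_ne_top _)]
    exact EReal.mul_bot_of_pos (EReal.coe_ennreal_pos.2 (by simp [pos_iff_ne_zero, hW]))
  have hN : ∑' y : Y, ∑ x : ZMod 2, (-BDMC.infoTerm W V y x).toENNReal = ⊤ := by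
    refine ENNReal.tsum_eq_top_of_eq_top ⟨y, ?_⟩
    rw [ENNReal.sum_eq_top]
    exact ⟨x, Finset.mem_univ _, by simp [ht]⟩
  unfold BDMC.mutualInfo
  rw [hN]
  simp

theorem outDist_eq (V : BDMC Y) (x : ZMod 2) (y : Y) :
    BDMC.outDist V y = (V x y + V (x + 1) y) / 2 := by
  unfold BDMC.outDist
  fin_cases x
  · rfl
  · rw [add_comm]
    rfl

/-- The quotient `V / q_V` equals `2 / (1 + ratio)` where `V > 0`; elsewhere domination kills both
sides. -/
theorem infoTerm_eq (hd : Dominated W V) (y : Y) (x : ZMod 2) :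
    BDMC.infoTerm W V y x =
      (((W x y).toReal / 2 * (1 - Real.log (1 + ratio V x y) / Real.log 2) : ℝ) : EReal) := by
  by_cases hV : V x y = 0
  · simp [BDMC.infoTerm, hd x y hV]
  have hl : Real.log 2 ≠ 0 := (Real.log_pos (by norm_num)).ne'
  have hW := PMF.apply_ne_top (W x) y
  have hq : V x y / BDMC.outDist V y = ENNReal.ofReal (2 / (1 + ratio V x y)) := by
    rw [outDist_eq V x y]
    unfold ratio
    lift V x y to ℝ≥0 using PMF.apply_ne_top _ _ with a
    lift V (x + 1) y to ℝ≥0 using PMF.apply_ne_top _ _ with a'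
    have ha : a ≠ 0 := by exact_mod_cast hV
    have e2 : ((2 : ℝ≥0∞)) = ((2 : ℝ≥0) : ℝ≥0∞) := rfl
    rw [e2, ← ENNReal.coe_div ha, ← ENNReal.coe_add, ← ENNReal.coe_div (by norm_num),
      ← ENNReal.coe_div (by positivity), ENNReal.toNNReal_coe]
    rw [← ENNReal.ofReal_coe_nnreal]
    congr 1
    push_cast
    have : (a : ℝ) ≠ 0 := by exact_mod_cast ha
    field_simp
  have hpos : (0 : ℝ) < 2 / (1 + ratio V x y) := by positivity
  unfold BDMC.infoTerm
  rw [hq, ENNReal.log_ofReal_of_pos hpos, Real.log_div (by norm_num) (by positivity)]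
  lift W x y to ℝ≥0 using hW with w
  have : (((w : ℝ≥0∞) / 2 : ℝ≥0∞) : EReal) = ((w / 2 : ℝ) : EReal) := by
    have e2 : ((2 : ℝ≥0∞)) = ((2 : ℝ≥0) : ℝ≥0∞) := rfl
    rw [e2, ← ENNReal.coe_div (by norm_num)]
    rfl
  rw [this, ← EReal.coe_div, ← EReal.coe_mul]
  congr 1
  simp only [ENNReal.coe_toReal]
  field_simp

/-- Treats positive and negative parts at once, with `f` the identity or the negation; homogeneity
extracts the weight of the output. -/
theorem tsum_infoTerm (hd : Dominated W V) (f : ℝ → ℝ) (g : EReal → EReal)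
    (hg : ∀ r : ℝ, g r = (f r : EReal)) (hf : ∀ c r : ℝ, 0 ≤ c → f (c * r) = c * f r) :
    ∑' y : Y, ∑ x : ZMod 2, (g (BDMC.infoTerm W V y x)).toENNReal =
      expect (law W V) fun a => ENNReal.ofReal (f (1 - Real.log (1 + a) / Real.log 2)) := by
  rw [expect_law, Summable.tsum_finsetSum (fun _ _ => ENNReal.summable)]
  refine Finset.sum_congr rfl fun x _ => ?_
  rw [← ENNReal.tsum_mul_left]
  refine tsum_congr fun y => ?_
  rw [infoTerm_eq hd, hg, hf _ _ (by positivity), EReal.toENNReal_of_ne_top (EReal.coe_ne_top _),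
    EReal.toReal_coe, ENNReal.ofReal_mul (by positivity), ← mul_assoc]
  congr 1
  rw [ENNReal.ofReal_div_of_pos (by norm_num), ENNReal.ofReal_toReal (PMF.apply_ne_top _ _),
    div_eq_mul_inv, mul_comm]
  simp

/-- The mismatched mutual information as one minus the expected loss. -/
theorem mutualInfo_eq (hd : Dominated W V) :
    BDMC.mutualInfo W V =
      1 - ((expect (law W V) cost / ENNReal.ofReal (Real.log 2) : ℝ≥0∞) : EReal) := by
  have hl : 0 < Real.log 2 := Real.log_pos (by norm_num)
  unfold BDMC.mutualInfo
  have hP := tsum_infoTerm hd id id (fun _ => rfl) (fun _ _ _ => rfl)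
  have hN := tsum_infoTerm hd (fun r => -r) (fun r => -r) (fun r => by simp)
    (fun c r _ => by ring)
  simp only [id] at hP
  rw [hP, hN]
  set P := expect (law W V) fun a => ENNReal.ofReal (1 - Real.log (1 + a) / Real.log 2)
  set N := expect (law W V) fun a => ENNReal.ofReal (-(1 - Real.log (1 + a) / Real.log 2))
  have hG : expect (law W V) cost / ENNReal.ofReal (Real.log 2) =
      expect (law W V) fun a => ENNReal.ofReal (Real.log (1 + a) / Real.log 2) := by
    rw [div_eq_mul_inv, ← expect_mul_right]
    refine expect_congr _ fun a _ => ?_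
    rw [cost, ← div_eq_mul_inv, ENNReal.ofReal_div_of_pos hl]
  rw [hG]
  set G := expect (law W V) fun a => ENNReal.ofReal (Real.log (1 + a) / Real.log 2)
  -- Pointwise `(1-g)⁺ + g = 1 + (g-1)⁺` for `g ≥ 0`. Stated without subtraction, it survives
  -- infinite expectations; as `P ≤ 1`, only `G` and `N` can be infinite, and only together.
  have hsum : P + G = 1 + N := by
    rw [← expect_const (law W V) 1, ← expect_add, ← expect_add]
    refine expect_congr _ fun a _ => ?_
    have h0 : 0 ≤ Real.log (1 + a) / Real.log 2 := div_nonneg (log_one_add_nonneg a) hl.le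
    rcases le_total (Real.log (1 + a) / Real.log 2) 1 with h | h
    · rw [← ENNReal.ofReal_add (by linarith) h0, ENNReal.ofReal_of_nonpos (p := -_) (by linarith)]
      simp
    · rw [ENNReal.ofReal_of_nonpos (by linarith), ← ENNReal.ofReal_one,
        ← ENNReal.ofReal_add (by norm_num) (by linarith)]
      simp
  have hP1 : P ≤ 1 := by
    rw [← expect_const (law W V) 1]
    refine expect_mono _ fun a => ?_
    rw [← ENNReal.ofReal_one]
    refine ENNReal.ofReal_le_ofReal ?_
    have h0 : 0 ≤ Real.log (1 + a) / Real.log 2 := div_nonneg (log_one_add_nonneg a) hl.le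
    linarith
  lift P to ℝ≥0 using (hP1.trans_lt ENNReal.one_lt_top).ne with p
  by_cases hGt : G = ⊤
  · have hNt : N = ⊤ := by
      rw [hGt] at hsum
      simpa using hsum.symm
    rw [hGt, hNt]
    simp
  · have hNt : N ≠ ⊤ := by
      intro h
      rw [h] at hsum
      simp [hGt] at hsum
    lift G to ℝ≥0 using hGt with γ
    lift N to ℝ≥0 using hNt with ν
    have h' : (p : ℝ) + γ = 1 + ν := by exact_mod_cast hsum
    have : ((p - ν : ℝ) : EReal) = ((1 - γ : ℝ) : EReal) := by
      congr 1; linarith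
    rw [EReal.coe_nnreal_eq_coe_real, EReal.coe_nnreal_eq_coe_real, EReal.coe_nnreal_eq_coe_real]
    exact_mod_cast this

end Channel

/-! ### Pointwise inequalities for bias, excess and loss -/

theorem coe_combine_false (a b : ℝ≥0) :
    ((combine false a b : ℝ≥0) : ℝ) = (a + b) / (1 + a * b) := by
  simp [combine]

theorem coe_combine_true (a b : ℝ≥0) : ((combine true a b : ℝ≥0) : ℝ) = a * b := by
  simp [combine]

/-- The absolute value of the posterior bias at likelihood ratio `a`. -/
noncomputable def bias (a : ℝ≥0) : ℝ≥0∞ := ENNReal.ofReal (|1 - (a : ℝ)| / (1 + a))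

/-- The loss in excess of that of an uninformed decision. -/
noncomputable def excess (a : ℝ≥0) : ℝ≥0∞ := ENNReal.ofReal (Real.log ((1 + a) / 2))

/-- The indicator of a nonzero likelihood ratio. -/
noncomputable def nonzero (a : ℝ≥0) : ℝ≥0∞ := if a = 0 then 0 else 1

theorem bias_le_one (a : ℝ≥0) : bias a ≤ 1 := by
  unfold bias
  rw [← ENNReal.ofReal_one]
  refine ENNReal.ofReal_le_ofReal ?_
  rw [div_le_one (by positivity), abs_le]
  have := a.coe_nonneg
  constructor <;> linarith

/-- The signed bias `(1-a)/(1+a)` is a hyperbolic tangent of half the log-likelihood ratio, and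
minus multiplies these tangents. -/
theorem bias_combine_false (a b : ℝ≥0) : bias (combine false a b) = bias a * bias b := by
  unfold bias
  rw [← ENNReal.ofReal_mul (by positivity), coe_combine_false]
  congr 1
  have h1 : (1 - ((a : ℝ) + b) / (1 + a * b)) = (1 - a) * (1 - b) / (1 + a * b) := by
    field_simp
    ring
  have h2 : (1 + ((a : ℝ) + b) / (1 + a * b)) = (1 + a) * (1 + b) / (1 + a * b) := by
    field_simp
    ring
  rw [h1, h2, abs_div, abs_mul, abs_of_pos (by positivity : (0 : ℝ) < 1 + a * b)]
  field_simp

/-- Plus adds log-likelihood ratios, and `|tanh|` is subadditive. After cross-multiplication it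
remains to split on the signs. -/
theorem bias_combine_true (a b : ℝ≥0) : bias (combine true a b) ≤ bias a + bias b := by
  unfold bias
  rw [← ENNReal.ofReal_add (by positivity) (by positivity), coe_combine_true]
  refine ENNReal.ofReal_le_ofReal ?_
  have ha := a.coe_nonneg
  have hb := b.coe_nonneg
  rw [div_add_div _ _ (by positivity) (by positivity), div_le_div_iff₀ (by positivity)
    (by positivity)]
  generalize (a : ℝ) = x at *
  generalize (b : ℝ) = y at *
  have hxy := mul_nonneg ha hb
  rcases abs_cases (1 - x * y) with ⟨h, h'⟩ | ⟨h, h'⟩ <;>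
  rcases abs_cases (1 - x) with ⟨h1, h1'⟩ | ⟨h1, h1'⟩ <;>
  rcases abs_cases (1 - y) with ⟨h2, h2'⟩ | ⟨h2, h2'⟩ <;>
  rw [h, h1, h2]
  · nlinarith [mul_nonneg h1' h2', mul_nonneg hxy (mul_nonneg h1' h2')]
  · nlinarith [mul_nonneg ha hxy, mul_nonneg hb hxy, mul_nonneg hxy hxy,
      mul_nonneg h1' (sub_nonneg.2 (sub_neg.1 h2').le),
      mul_nonneg hxy (mul_nonneg h1' (sub_nonneg.2 (sub_neg.1 h2').le))]
  · nlinarith [mul_nonneg ha hxy, mul_nonneg hb hxy, mul_nonneg hxy hxy,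
      mul_nonneg h2' (sub_nonneg.2 (sub_neg.1 h1').le),
      mul_nonneg hxy (mul_nonneg h2' (sub_nonneg.2 (sub_neg.1 h1').le))]
  · nlinarith [mul_pos_of_neg_of_neg h1' h2']
  · nlinarith [mul_nonneg h1' h2']
  · nlinarith [mul_nonneg ha hxy, mul_nonneg hb hxy, mul_nonneg hxy hxy,
      mul_nonneg h1' (sub_nonneg.2 (sub_neg.1 h2').le),
      mul_nonneg hxy (mul_nonneg h1' (sub_nonneg.2 (sub_neg.1 h2').le))]
  · nlinarith [mul_nonneg ha hxy, mul_nonneg hb hxy, mul_nonneg hxy hxy,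
      mul_nonneg h2' (sub_nonneg.2 (sub_neg.1 h1').le),
      mul_nonneg hxy (mul_nonneg h2' (sub_nonneg.2 (sub_neg.1 h1').le))]
  · nlinarith [mul_pos_of_neg_of_neg h1' h2', mul_nonneg hxy (mul_pos_of_neg_of_neg h1' h2').le]

theorem excess_of_le_one {a : ℝ≥0} (h : a ≤ 1) : excess a = 0 := by
  refine ENNReal.ofReal_of_nonpos (Real.log_nonpos (by positivity) ?_)
  have : (a : ℝ) ≤ 1 := by exact_mod_cast h
  linarith

theorem combine_comm (t : Bool) (a b : ℝ≥0) : combine t a b = combine t b a := by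
  cases t <;> simp [combine, add_comm, mul_comm]

theorem combine_false_le_one_of_le_one {a b : ℝ≥0} (ha : a ≤ 1) (hb : b ≤ 1) :
    combine false a b ≤ 1 := by
  rw [← NNReal.coe_le_coe, coe_combine_false, NNReal.coe_one, div_le_one (by positivity)]
  have ha : (a : ℝ) ≤ 1 := by exact_mod_cast ha
  have hb : (b : ℝ) ≤ 1 := by exact_mod_cast hb
  nlinarith

theorem combine_false_le_one_of_one_le {a b : ℝ≥0} (ha : 1 ≤ a) (hb : 1 ≤ b) :
    combine false a b ≤ 1 := by
  rw [← NNReal.coe_le_coe, coe_combine_false, NNReal.coe_one, div_le_one (by positivity)]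
  have ha : 1 ≤ (a : ℝ) := by exact_mod_cast ha
  have hb : 1 ≤ (b : ℝ) := by exact_mod_cast hb
  nlinarith

theorem combine_false_le_left {a b : ℝ≥0} (ha : 1 ≤ a) : combine false a b ≤ a := by
  rw [← NNReal.coe_le_coe, coe_combine_false, div_le_iff₀ (by positivity)]
  have ha : 1 ≤ (a : ℝ) := by exact_mod_cast ha
  have hb := b.coe_nonneg
  nlinarith [mul_nonneg hb (mul_nonneg (sub_nonneg.2 ha) (by linarith : (0 : ℝ) ≤ a + 1))]

theorem neg_log_one_sub_mul_le {x p : ℝ} (hx1 : x < 1) (hp : 0 ≤ p) (hp1 : p ≤ 1) :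
    -Real.log (1 - x * p) ≤ p * -Real.log (1 - x) := by
  have h := strictConcaveOn_log_Ioi.concaveOn.2 (x := 1 - x) (y := 1)
    (Set.mem_Ioi.2 (by linarith)) (Set.mem_Ioi.2 one_pos) hp (sub_nonneg.2 hp1) (by ring)
  simp only [smul_eq_mul, Real.log_one, mul_zero, add_zero] at h
  have e : p * (1 - x) + (1 - p) * 1 = 1 - x * p := by ring
  rw [e] at h
  linarith

/-- With `x = (a-1)/(1+a)` the excess of `a` is `-log(1-x)`, and combining with `b ≤ 1` multiplies
`x` by the bias `p` of `b`; concavity of the logarithm then gives the factor `p`. -/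
theorem excess_combine_false_aux {a b : ℝ≥0} (ha : 1 ≤ a) (hb : b ≤ 1) :
    excess (combine false a b) ≤ bias b * excess a := by
  unfold bias excess
  rw [← ENNReal.ofReal_mul (by positivity), coe_combine_false]
  refine ENNReal.ofReal_le_ofReal ?_
  have ha : 1 ≤ (a : ℝ) := by exact_mod_cast ha
  have hb : (b : ℝ) ≤ 1 := by exact_mod_cast hb
  have hb0 := b.coe_nonneg
  rw [abs_of_nonneg (by linarith)]
  have key := neg_log_one_sub_mul_le (x := ((a : ℝ) - 1) / (1 + a)) (p := (1 - (b : ℝ)) / (1 + b))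
    ((div_lt_one (by linarith)).2 (by linarith))
    (div_nonneg (by linarith) (by linarith)) ((div_le_one (by linarith)).2 (by linarith))
  rw [← Real.log_inv, ← Real.log_inv] at key
  have e1 : 1 - ((a : ℝ) - 1) / (1 + a) * ((1 - (b : ℝ)) / (1 + b)) =
      2 * (1 + a * b) / ((1 + a) * (1 + b)) := by
    field_simp
    ring
  have e2 : 1 - ((a : ℝ) - 1) / (1 + a) = 2 / (1 + a) := by
    field_simp
    ring
  have e3 : (1 + ((a : ℝ) + b) / (1 + a * b)) / 2 =
      (1 + a) * (1 + b) / (2 * (1 + a * b)) := by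
    field_simp
    ring
  rwa [e1, e2, inv_div, inv_div, ← e3] at key

/-- Two ratios on the same side of 1 combine to one at most 1, which has no excess; otherwise the
auxiliary bound applies to the large one. -/
theorem excess_combine_false (a b : ℝ≥0) :
    excess (combine false a b) ≤ bias a * excess b + excess a * bias b := by
  rcases le_total a 1 with ha | ha <;> rcases le_total b 1 with hb | hb
  · rw [excess_of_le_one (combine_false_le_one_of_le_one ha hb)]
    exact zero_le
  · rw [combine_comm]
    exact (excess_combine_false_aux hb ha).trans le_self_add
  · rw [mul_comm (excess a)]
    exact (excess_combine_false_aux ha hb).trans le_add_self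
  · rw [excess_of_le_one (combine_false_le_one_of_one_le ha hb)]
    exact zero_le

theorem excess_mono {a b : ℝ≥0} (h : a ≤ b) : excess a ≤ excess b := by
  refine ENNReal.ofReal_le_ofReal (Real.log_le_log (by positivity) ?_)
  have : (a : ℝ) ≤ b := by exact_mod_cast h
  linarith

theorem excess_combine_true (a b : ℝ≥0) :
    excess (combine true a b) ≤ 2 * excess a + 2 * excess b := by
  have hself : ∀ c : ℝ≥0∞, c ≤ 2 * c := fun c => by
    rw [two_mul]
    exact le_self_add
  rcases le_total a 1 with ha | ha
  · refine (excess_mono (b := b) ?_).trans ((hself _).trans le_add_self)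
    simpa [combine] using mul_le_mul_left ha b
  rcases le_total b 1 with hb | hb
  · refine (excess_mono (b := a) ?_).trans ((hself _).trans le_self_add)
    simpa [combine] using mul_le_mul_right hb a
  have ha : 1 ≤ (a : ℝ) := by exact_mod_cast ha
  have hb : 1 ≤ (b : ℝ) := by exact_mod_cast hb
  unfold excess
  have hla := Real.log_nonneg (by linarith : 1 ≤ (1 + (a : ℝ)) / 2)
  have hlb := Real.log_nonneg (by linarith : 1 ≤ (1 + (b : ℝ)) / 2)
  rw [show (2 : ℝ≥0∞) = ENNReal.ofReal 2 by simp, ← ENNReal.ofReal_mul (by norm_num),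
    ← ENNReal.ofReal_mul (by norm_num), ← ENNReal.ofReal_add (by positivity) (by positivity)]
  refine ENNReal.ofReal_le_ofReal ?_
  rw [coe_combine_true]
  have h2 : 2 * Real.log ((1 + a) / 2) + 2 * Real.log ((1 + b) / 2) =
      Real.log (((1 + a) / 2) ^ 2 * ((1 + b) / 2) ^ 2) := by
    rw [Real.log_mul (by positivity) (by positivity), Real.log_pow, Real.log_pow]
    norm_num
  rw [h2]
  refine Real.log_le_log (by positivity) ?_
  -- AM-GM; these squares are the source of the factors 2 in the statement.
  have hA : (a : ℝ) ≤ ((1 + a) / 2) ^ 2 := by nlinarith [sq_nonneg ((a : ℝ) - 1)]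
  have hB : (b : ℝ) ≤ ((1 + b) / 2) ^ 2 := by nlinarith [sq_nonneg ((b : ℝ) - 1)]
  have hAB : (a : ℝ) * b ≤ ((1 + a) / 2) ^ 2 * ((1 + b) / 2) ^ 2 :=
    mul_le_mul hA hB (by positivity) (by positivity)
  nlinarith

theorem nonzero_combine_true (a b : ℝ≥0) :
    nonzero (combine true a b) = nonzero a * nonzero b := by
  unfold nonzero combine
  by_cases ha : a = 0 <;> by_cases hb : b = 0 <;> simp [ha, hb]

theorem nonzero_combine_false (a b : ℝ≥0) :
    nonzero (combine false a b) ≤ nonzero a + nonzero b := by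
  unfold nonzero combine
  by_cases ha : a = 0 <;> by_cases hb : b = 0 <;> simp [ha, hb]

theorem cost_mono {a b : ℝ≥0} (h : a ≤ b) : cost a ≤ cost b := by
  refine ENNReal.ofReal_le_ofReal (Real.log_le_log (by positivity) ?_)
  have : (a : ℝ) ≤ b := by exact_mod_cast h
  linarith

/-- The identity `(1+ab)+(a+b) = (1+a)(1+b)`: conservation of mutual information before any
averaging. -/
theorem cost_combine (a b : ℝ≥0) :
    cost (combine false a b) + cost (combine true a b) = cost a + cost b := by
  unfold cost
  rw [← ENNReal.ofReal_add (log_one_add_nonneg _) (log_one_add_nonneg _),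
    ← ENNReal.ofReal_add (log_one_add_nonneg _) (log_one_add_nonneg _),
    ← Real.log_mul (by positivity) (by positivity), ← Real.log_mul (by positivity) (by positivity),
    coe_combine_false, coe_combine_true]
  congr 2
  field_simp
  ring

theorem cost_combine_le (t : Bool) (a b : ℝ≥0) : cost (combine t a b) ≤ cost a + cost b := by
  rw [← cost_combine]
  cases t
  · exact le_self_add
  · exact le_add_self

/-- A zero ratio annihilates a product, so the loss survives a plus step only if both ratios are
nonzero. -/
theorem cost_combine_true (a b : ℝ≥0) :
    cost (combine true a b) ≤ nonzero a * cost b + cost a * nonzero b := by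
  by_cases ha : a = 0
  · simp [ha, combine, cost]
  by_cases hb : b = 0
  · simp [hb, combine, cost]
  simpa [nonzero, ha, hb, add_comm] using cost_combine_le true a b

theorem cost_le_log_two_add (a : ℝ≥0) : cost a ≤ ENNReal.ofReal (Real.log 2) + excess a := by
  have h : Real.log (1 + a) = Real.log 2 + Real.log ((1 + a) / 2) := by
    rw [Real.log_div (by positivity) (by norm_num)]
    ring
  unfold cost excess
  rw [h]
  exact ENNReal.ofReal_add_le

/-- The inequality `log z ≤ z - 1` at `z = 2/(1+a)`. -/
theorem log_two_le_cost_add (a : ℝ≥0) : ENNReal.ofReal (Real.log 2) ≤ cost a + bias a := by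
  unfold cost bias
  rw [← ENNReal.ofReal_add (log_one_add_nonneg _) (by positivity)]
  refine ENNReal.ofReal_le_ofReal ?_
  have h := Real.log_le_sub_one_of_pos (by positivity : (0 : ℝ) < 2 / (1 + a))
  rw [Real.log_div (by norm_num) (by positivity)] at h
  have h2 : 2 / (1 + (a : ℝ)) - 1 = (1 - a) / (1 + a) := by
    field_simp
    ring
  have h3 : (1 - (a : ℝ)) / (1 + a) ≤ |1 - (a : ℝ)| / (1 + a) :=
    div_le_div_of_nonneg_right (le_abs_self _) (by positivity)
  linarith

/-! ### Truncation of the likelihood ratio at a level -/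

/-- The indicator that the log-likelihood ratio exceeds `R`. -/
noncomputable def above (R : ℝ) (a : ℝ≥0) : ℝ≥0∞ := if Real.exp R < a then 1 else 0

/-- The indicator that the log-likelihood ratio lies outside `[-R, R]`. -/
noncomputable def outside (R : ℝ) (a : ℝ≥0) : ℝ≥0∞ :=
  if Real.exp R < a ∨ (a : ℝ) < Real.exp (-R) then 1 else 0

/-- The loss where the log-likelihood ratio exceeds `R`. -/
noncomputable def costAbove (R : ℝ) (a : ℝ≥0) : ℝ≥0∞ := if Real.exp R < a then cost a else 0

/-- The power `a ^ s` where the log-likelihood ratio is at most `R`. -/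
noncomputable def powBelow (s R : ℝ) (a : ℝ≥0) : ℝ≥0∞ :=
  if Real.exp R < a then 0 else ENNReal.ofReal ((a : ℝ) ^ s)

/-- In a minus step one moderate ratio confines the output, whatever the other is. Hence the mass
outside a window is squared. -/
theorem combine_false_le_exp {R : ℝ} {a b : ℝ≥0} (h1 : (a : ℝ) ≤ Real.exp R)
    (h2 : Real.exp (-R) ≤ a) : ((combine false a b : ℝ≥0) : ℝ) ≤ Real.exp R := by
  rw [coe_combine_false, div_le_iff₀ (by positivity)]
  have hb := b.coe_nonneg
  have h3 : 1 ≤ Real.exp R * a := by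
    have := mul_le_mul_of_nonneg_left h2 (Real.exp_pos R).le
    rwa [← Real.exp_add, add_neg_cancel, Real.exp_zero] at this
  nlinarith

theorem exp_neg_le_combine_false {R : ℝ} {a b : ℝ≥0} (h1 : (a : ℝ) ≤ Real.exp R)
    (h2 : Real.exp (-R) ≤ a) : Real.exp (-R) ≤ (combine false a b : ℝ≥0) := by
  rw [coe_combine_false, le_div_iff₀ (by positivity)]
  have hb := b.coe_nonneg
  have h3 : Real.exp (-R) * a ≤ 1 := by
    have := mul_le_mul_of_nonneg_left h1 (Real.exp_pos (-R)).le
    rwa [← Real.exp_add, neg_add_cancel, Real.exp_zero] at this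
  nlinarith

theorem outside_eq_zero {R : ℝ} {a : ℝ≥0} (h1 : (a : ℝ) ≤ Real.exp R)
    (h2 : Real.exp (-R) ≤ a) : outside R a = 0 := by
  simp [outside, h1, h2]

theorem of_outside_ne_one {R : ℝ} {a : ℝ≥0} (h : outside R a ≠ 1) :
    (a : ℝ) ≤ Real.exp R ∧ Real.exp (-R) ≤ a := by
  unfold outside at h
  by_contra h'
  refine h (if_pos ?_)
  by_contra h''
  exact h' ⟨not_lt.1 fun h => h'' (Or.inl h), not_lt.1 fun h => h'' (Or.inr h)⟩

theorem outside_le_one (R : ℝ) (a : ℝ≥0) : outside R a ≤ 1 := by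
  unfold outside
  split_ifs <;> simp

theorem outside_combine_false (R : ℝ) (a b : ℝ≥0) :
    outside R (combine false a b) ≤ outside R a * outside R b := by
  by_cases ha : outside R a = 1
  · by_cases hb : outside R b = 1
    · rw [ha, hb, one_mul]
      exact outside_le_one _ _
    · obtain ⟨h1, h2⟩ := of_outside_ne_one hb
      rw [combine_comm, outside_eq_zero (combine_false_le_exp h1 h2)
        (exp_neg_le_combine_false h1 h2)]
      exact zero_le
  · obtain ⟨h1, h2⟩ := of_outside_ne_one ha
    rw [outside_eq_zero (combine_false_le_exp h1 h2) (exp_neg_le_combine_false h1 h2)]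
    exact zero_le

theorem exp_two_mul (R : ℝ) : Real.exp (2 * R) = Real.exp R * Real.exp R := by
  rw [two_mul, Real.exp_add]

theorem lt_or_lt_of_exp_lt_mul {R : ℝ} {a b : ℝ≥0}
    (h : Real.exp (2 * R) < (combine true a b : ℝ≥0)) : Real.exp R < a ∨ Real.exp R < b := by
  by_contra! h'
  refine h.not_ge ?_
  rw [coe_combine_true, exp_two_mul]
  exact mul_le_mul h'.1 h'.2 b.coe_nonneg (Real.exp_pos _).le

theorem outside_combine_true (R : ℝ) (a b : ℝ≥0) :
    outside (2 * R) (combine true a b) ≤ outside R a + outside R b := by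
  by_cases ha : outside R a = 1
  · rw [ha]
    exact (outside_le_one _ _).trans le_self_add
  by_cases hb : outside R b = 1
  · rw [hb]
    exact (outside_le_one _ _).trans le_add_self
  obtain ⟨h1, h2⟩ := of_outside_ne_one ha
  obtain ⟨h3, h4⟩ := of_outside_ne_one hb
  rw [outside_eq_zero]
  · exact zero_le
  · rw [coe_combine_true, exp_two_mul]
    exact mul_le_mul h1 h3 b.coe_nonneg (Real.exp_pos _).le
  · rw [coe_combine_true, show -(2 * R) = 2 * -R by ring, exp_two_mul]
    exact mul_le_mul h2 h4 (Real.exp_pos _).le a.coe_nonneg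

theorem above_le_one (R : ℝ) (a : ℝ≥0) : above R a ≤ 1 := by
  unfold above
  split_ifs <;> simp

theorem above_combine_true (R : ℝ) (a b : ℝ≥0) :
    above (2 * R) (combine true a b) ≤ above R a + above R b := by
  by_cases h : Real.exp (2 * R) < (combine true a b : ℝ≥0)
  · rcases lt_or_lt_of_exp_lt_mul h with h' | h'
    · refine (above_le_one _ _).trans ?_
      rw [above, if_pos h']
      exact le_self_add
    · refine (above_le_one _ _).trans ?_
      rw [above, above, if_pos h']
      exact le_add_self
  · rw [above, if_neg h]
    exact zero_le

/-- A large output of a minus step comes from one large and one small ratio. -/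
theorem of_exp_lt_combine_false {R : ℝ} (hR : 0 ≤ R) {a b : ℝ≥0}
    (h : Real.exp R < (combine false a b : ℝ≥0)) :
    (outside R a = 1 ∧ 1 ≤ b ∧ Real.exp R < b) ∨ (outside R b = 1 ∧ 1 ≤ a ∧ Real.exp R < a) := by
  have hR1 : 1 ≤ Real.exp R := Real.one_le_exp hR
  have ha : outside R a = 1 := by
    by_contra ha
    obtain ⟨h1, h2⟩ := of_outside_ne_one ha
    exact h.not_ge (combine_false_le_exp h1 h2)
  have hb : outside R b = 1 := by
    by_contra hb
    obtain ⟨h1, h2⟩ := of_outside_ne_one hb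
    rw [combine_comm] at h
    exact h.not_ge (combine_false_le_exp h1 h2)
  by_cases ha' : Real.exp R < a
  · exact Or.inr ⟨hb, by exact_mod_cast hR1.trans ha'.le, ha'⟩
  by_cases hb' : Real.exp R < b
  · exact Or.inl ⟨ha, by exact_mod_cast hR1.trans hb'.le, hb'⟩
  exfalso
  -- If neither ratio exceeds `exp R`, both lie below `exp (-R)`, and two ratios at most 1 cannot
  -- give an output above 1.
  have small : ∀ c : ℝ≥0, outside R c = 1 → ¬ Real.exp R < c → c ≤ 1 := by
    intro c hc hc'
    unfold outside at hc
    have : (c : ℝ) < Real.exp (-R) := by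
      by_contra h
      simp [hc', h] at hc
    have h1 : Real.exp (-R) ≤ 1 := Real.exp_le_one_iff.2 (by linarith)
    exact_mod_cast this.le.trans h1
  have := combine_false_le_one_of_le_one (small a ha ha') (small b hb hb')
  have : ((combine false a b : ℝ≥0) : ℝ) ≤ 1 := by exact_mod_cast this
  linarith

theorem above_combine_false {R : ℝ} (hR : 0 ≤ R) (a b : ℝ≥0) :
    above R (combine false a b) ≤ outside R a * above R b + above R a * outside R b := by
  by_cases h : Real.exp R < (combine false a b : ℝ≥0)
  · rcases of_exp_lt_combine_false hR h with ⟨h1, -, h2⟩ | ⟨h1, -, h2⟩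
    · refine le_trans ?_ le_self_add
      rw [h1, one_mul, above, above, if_pos h, if_pos h2]
    · refine le_trans ?_ le_add_self
      rw [h1, mul_one, above, above, if_pos h, if_pos h2]
  · rw [above, if_neg h]
    exact zero_le

theorem costAbove_combine_false {R : ℝ} (hR : 0 ≤ R) (a b : ℝ≥0) :
    costAbove R (combine false a b) ≤
      outside R a * costAbove R b + costAbove R a * outside R b := by
  by_cases h : Real.exp R < (combine false a b : ℝ≥0)
  · rcases of_exp_lt_combine_false hR h with ⟨h1, h0, h2⟩ | ⟨h1, h0, h2⟩
    · refine le_trans ?_ le_self_add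
      rw [h1, one_mul, costAbove, costAbove, if_pos h, if_pos h2, combine_comm]
      exact cost_mono (combine_false_le_left h0)
    · refine le_trans ?_ le_add_self
      rw [h1, mul_one, costAbove, costAbove, if_pos h, if_pos h2]
      exact cost_mono (combine_false_le_left h0)
  · rw [costAbove, if_neg h]
    exact zero_le

/-- The larger of the two ratios exceeds `exp R` and its loss dominates the other one. -/
theorem costAbove_combine_true (R : ℝ) (a b : ℝ≥0) :
    costAbove (2 * R) (combine true a b) ≤ 2 * costAbove R a + 2 * costAbove R b := by
  by_cases h : Real.exp (2 * R) < (combine true a b : ℝ≥0)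
  · rw [costAbove, if_pos h]
    refine (cost_combine_le true a b).trans ?_
    have h' := lt_or_lt_of_exp_lt_mul h
    rcases le_total a b with hab | hab
    · have hb : Real.exp R < b := h'.elim (fun h => h.trans_le (by exact_mod_cast hab)) id
      refine le_trans ?_ le_add_self
      rw [costAbove, if_pos hb, two_mul]
      exact add_le_add_left (cost_mono hab) _
    · have ha : Real.exp R < a := h'.elim id fun h => h.trans_le (by exact_mod_cast hab)
      refine le_trans ?_ le_self_add
      rw [costAbove, if_pos ha, two_mul]
      exact add_le_add_right (cost_mono hab) _
  · rw [costAbove, if_neg h]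
    exact zero_le

theorem rpow_le_exp {s R x : ℝ} (hs : 0 ≤ s) (hx : 0 ≤ x) (h : x ≤ Real.exp R) :
    x ^ s ≤ Real.exp (s * R) := by
  refine (Real.rpow_le_rpow hx h hs).trans ?_
  rw [← Real.exp_mul, mul_comm]

/-- Uses that the output is at most `a + b` and that `x ^ s` is subadditive for `s ≤ 1`. If an input
exceeds the level, the truncated power of the output is still at most `exp (s R)`. -/
theorem powBelow_combine_false {s R : ℝ} (hs : 0 < s) (hs1 : s ≤ 1) (a b : ℝ≥0) :
    powBelow s R (combine false a b) ≤ powBelow s R a + powBelow s R b +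
      ENNReal.ofReal (Real.exp (s * R)) * (above R a + above R b) := by
  by_cases h : Real.exp R < (combine false a b : ℝ≥0)
  · rw [powBelow, if_pos h]
    exact zero_le
  have hle : powBelow s R (combine false a b) ≤ ENNReal.ofReal (Real.exp (s * R)) := by
    rw [powBelow, if_neg h]
    exact ENNReal.ofReal_le_ofReal
      (rpow_le_exp hs.le (NNReal.coe_nonneg _) (not_lt.1 h))
  by_cases ha : Real.exp R < a
  · refine hle.trans (le_trans ?_ le_add_self)
    nth_rw 1 [← mul_one (ENNReal.ofReal _)]
    gcongr
    rw [above, if_pos ha]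
    exact le_self_add
  by_cases hb : Real.exp R < b
  · refine hle.trans (le_trans ?_ le_add_self)
    nth_rw 1 [← mul_one (ENNReal.ofReal _)]
    gcongr
    rw [above, above, if_pos hb]
    exact le_add_self
  refine le_trans ?_ le_self_add
  rw [powBelow, powBelow, powBelow, if_neg h, if_neg ha, if_neg hb,
    ← ENNReal.ofReal_add (by positivity) (by positivity)]
  refine ENNReal.ofReal_le_ofReal ?_
  have h1 : ((combine false a b : ℝ≥0) : ℝ) ≤ a + b := by
    rw [coe_combine_false]
    exact div_le_self (by positivity) (le_add_of_nonneg_right (by positivity))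
  refine (Real.rpow_le_rpow (NNReal.coe_nonneg _) h1 hs.le).trans ?_
  exact_mod_cast NNReal.rpow_add_le_add_rpow a b hs.le hs1

theorem powBelow_combine_true {s R : ℝ} (hs : 0 < s) (a b : ℝ≥0) :
    powBelow s (2 * R) (combine true a b) ≤ powBelow s R a * powBelow s R b +
      ENNReal.ofReal (Real.exp (s * (2 * R))) * (above R a + above R b) := by
  by_cases h : Real.exp (2 * R) < (combine true a b : ℝ≥0)
  · rw [powBelow, if_pos h]
    exact zero_le
  have hle : powBelow s (2 * R) (combine true a b) ≤
      ENNReal.ofReal (Real.exp (s * (2 * R))) := by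
    rw [powBelow, if_neg h]
    exact ENNReal.ofReal_le_ofReal
      (rpow_le_exp hs.le (NNReal.coe_nonneg _) (not_lt.1 h))
  by_cases ha : Real.exp R < a
  · refine hle.trans (le_trans ?_ le_add_self)
    nth_rw 1 [← mul_one (ENNReal.ofReal _)]
    gcongr
    rw [above, if_pos ha]
    exact le_self_add
  by_cases hb : Real.exp R < b
  · refine hle.trans (le_trans ?_ le_add_self)
    nth_rw 1 [← mul_one (ENNReal.ofReal _)]
    gcongr
    rw [above, above, if_pos hb]
    exact le_add_self
  refine le_trans ?_ le_self_add
  rw [powBelow, powBelow, powBelow, if_neg h, if_neg ha, if_neg hb,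
    ← ENNReal.ofReal_mul (by positivity), coe_combine_true,
    Real.mul_rpow a.coe_nonneg b.coe_nonneg]

/-- Below the level, `s log(1+a) ≤ log(1+a^s) ≤ a^s`. -/
theorem cost_le_powBelow_add {s : ℝ} (R : ℝ) (hs : 0 < s) (hs1 : s ≤ 1) (a : ℝ≥0) :
    cost a ≤ ENNReal.ofReal s⁻¹ * powBelow s R a + costAbove R a := by
  by_cases ha : Real.exp R < a
  · rw [costAbove, if_pos ha]
    exact le_add_self
  · rw [costAbove, powBelow, if_neg ha, if_neg ha, add_zero, ← ENNReal.ofReal_mul (by positivity)]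
    refine ENNReal.ofReal_le_ofReal ?_
    rw [inv_mul_eq_div, le_div_iff₀ hs, mul_comm, ← Real.log_rpow (by positivity)]
    have h1 : (1 + (a : ℝ)) ^ s ≤ 1 + (a : ℝ) ^ s := by
      have := NNReal.rpow_add_le_add_rpow 1 a hs.le hs1
      rw [NNReal.one_rpow] at this
      exact_mod_cast this
    refine (Real.log_le_log (by positivity) h1).trans ?_
    have := Real.log_le_sub_one_of_pos (by positivity : (0 : ℝ) < 1 + (a : ℝ) ^ s)
    linarith

/-- Jensen's inequality, from the weighted power mean inequality on finite subsets, whose total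
weight is at most 1. -/
theorem expect_rpow_le {α : Type*} (p : PMF α) (φ : α → ℝ≥0∞) {t : ℝ} (ht : 0 < t)
    (ht1 : t ≤ 1) : expect p (fun a => φ a ^ t) ≤ expect p φ ^ t := by
  have h1 : 1 ≤ t⁻¹ := (one_le_inv₀ ht).2 ht1
  unfold expect
  rw [ENNReal.tsum_eq_iSup_sum]
  refine iSup_le fun s => ?_
  refine (ENNReal.inner_le_weight_mul_Lp_of_nonneg s h1 p fun a => φ a ^ t).trans ?_
  have e : ∀ a, (φ a ^ t) ^ t⁻¹ = φ a := fun a => by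
    rw [← ENNReal.rpow_mul, mul_inv_cancel₀ ht.ne', ENNReal.rpow_one]
  simp_rw [e, inv_inv]
  have hw : (∑ a ∈ s, p a) ^ (1 - t) ≤ 1 := by
    refine ENNReal.rpow_le_one ?_ (sub_nonneg.2 ht1)
    rw [← p.tsum_coe]
    exact ENNReal.sum_le_tsum s
  calc _ ≤ 1 * (∑' a, p a * φ a) ^ t :=
        mul_le_mul' hw (ENNReal.rpow_le_rpow (ENNReal.sum_le_tsum s) ht.le)
    _ = _ := one_mul _

theorem expect_powBelow_le (p : Law) {s s' : ℝ} (R : ℝ) (hs : 0 < s') (hs' : s' ≤ s) :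
    expect p (powBelow s' R) ≤ expect p (powBelow s R) ^ (s' / s) := by
  have h0 : 0 < s := hs.trans_le hs'
  refine le_trans (le_of_eq ?_) (expect_rpow_le p _ (div_pos hs h0) ((div_le_one h0).2 hs'))
  refine expect_congr _ fun a _ => ?_
  unfold powBelow
  split_ifs
  · rw [ENNReal.zero_rpow_of_pos (div_pos hs h0)]
  · rw [ENNReal.ofReal_rpow_of_nonneg (by positivity) (div_pos hs h0).le,
      ← Real.rpow_mul a.coe_nonneg, mul_div_cancel₀ _ h0.ne']

/-! ### Effect of one polarization step on the functionals -/

section StepBounds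

variable (t : Bool) (p : Law)

theorem expect_step_le_mul {Φ φ ψ : ℝ≥0 → ℝ≥0∞}
    (h : ∀ a b, Φ (combine t a b) ≤ φ a * ψ b + ψ a * φ b) :
    expect (step t p) Φ ≤ 2 * (expect p φ * expect p ψ) := by
  rw [expect_step]
  refine (expect_mono _ fun a => expect_mono _ fun b => h a b).trans (le_of_eq ?_)
  simp_rw [expect_add]
  rw [expect_mul_mul, expect_mul_mul, two_mul, mul_comm (expect p ψ)]

theorem expect_step_le_add {Φ φ : ℝ≥0 → ℝ≥0∞} (c : ℝ≥0∞)
    (h : ∀ a b, Φ (combine t a b) ≤ c * φ a + c * φ b) :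
    expect (step t p) Φ ≤ 2 * c * expect p φ := by
  rw [expect_step]
  refine (expect_mono _ fun a => expect_mono _ fun b => h a b).trans (le_of_eq ?_)
  simp_rw [expect_add, expect_const, expect_mul_left]
  ring

theorem expect_step_le_add' {Φ φ : ℝ≥0 → ℝ≥0∞}
    (h : ∀ a b, Φ (combine t a b) ≤ φ a + φ b) :
    expect (step t p) Φ ≤ 2 * expect p φ := by
  simpa using expect_step_le_add t p 1 (by simpa using h)

theorem expect_bias_false : expect (step false p) bias = expect p bias ^ 2 := by
  rw [expect_step]
  simp_rw [bias_combine_false]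
  rw [expect_mul_mul, sq]

theorem expect_bias_true : expect (step true p) bias ≤ 2 * expect p bias :=
  expect_step_le_add' true p bias_combine_true

theorem expect_excess_false :
    expect (step false p) excess ≤ 2 * expect p bias * expect p excess := by
  rw [mul_assoc]
  exact expect_step_le_mul false p excess_combine_false

theorem expect_excess_true : expect (step true p) excess ≤ 4 * expect p excess := by
  convert expect_step_le_add true p 2 excess_combine_true using 2
  norm_num

theorem expect_nonzero_true : expect (step true p) nonzero = expect p nonzero ^ 2 := by
  rw [expect_step]
  simp_rw [nonzero_combine_true]
  rw [expect_mul_mul, sq]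

theorem expect_nonzero_false : expect (step false p) nonzero ≤ 2 * expect p nonzero :=
  expect_step_le_add' false p nonzero_combine_false

theorem expect_cost_add :
    expect (step false p) cost + expect (step true p) cost = 2 * expect p cost := by
  rw [expect_step, expect_step, ← expect_add]
  simp_rw [← expect_add, cost_combine, expect_add, expect_const]
  rw [two_mul]

theorem expect_cost_le : expect (step t p) cost ≤ 2 * expect p cost :=
  expect_step_le_add' t p (cost_combine_le t)

theorem expect_cost_true :
    expect (step true p) cost ≤ 2 * expect p nonzero * expect p cost := by
  rw [mul_assoc]
  exact expect_step_le_mul true p cost_combine_true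

theorem expect_outside_false (R : ℝ) :
    expect (step false p) (outside R) ≤ expect p (outside R) ^ 2 := by
  rw [expect_step, sq, ← expect_mul_mul]
  exact expect_mono _ fun a => expect_mono _ fun b => outside_combine_false R a b

theorem expect_outside_true (R : ℝ) :
    expect (step true p) (outside (2 * R)) ≤ 2 * expect p (outside R) :=
  expect_step_le_add' true p (outside_combine_true R)

theorem expect_above_false {R : ℝ} (hR : 0 ≤ R) :
    expect (step false p) (above R) ≤ 2 * expect p (outside R) * expect p (above R) := by
  rw [mul_assoc]
  exact expect_step_le_mul false p (above_combine_false hR)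

theorem expect_above_true (R : ℝ) :
    expect (step true p) (above (2 * R)) ≤ 2 * expect p (above R) :=
  expect_step_le_add' true p (above_combine_true R)

theorem expect_costAbove_false {R : ℝ} (hR : 0 ≤ R) :
    expect (step false p) (costAbove R) ≤ 2 * expect p (outside R) * expect p (costAbove R) := by
  rw [mul_assoc]
  exact expect_step_le_mul false p (costAbove_combine_false hR)

theorem expect_costAbove_true (R : ℝ) :
    expect (step true p) (costAbove (2 * R)) ≤ 4 * expect p (costAbove R) := by
  convert expect_step_le_add true p 2 (costAbove_combine_true R) using 2
  norm_num

theorem expect_powBelow_false {s : ℝ} (R : ℝ) (hs : 0 < s) (hs1 : s ≤ 1) :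
    expect (step false p) (powBelow s R) ≤
      2 * expect p (powBelow s R) + 2 * ENNReal.ofReal (Real.exp (s * R)) * expect p (above R) := by
  rw [expect_step]
  refine (expect_mono _ fun a => expect_mono _ fun b =>
    powBelow_combine_false hs hs1 a b).trans (le_of_eq ?_)
  simp_rw [expect_add, expect_const, expect_mul_left, expect_add, expect_const]
  ring

/-- The level doubles, so keeping the exponent would double the product of exponent and level, and
with it the logarithm of the error factor. Lowering the exponent to `s'` slows this growth to the
factor `2 s'/s`, at the price, by Jensen, of the power `2 s'/s` instead of a square. -/
theorem expect_powBelow_true {s s' : ℝ} (R : ℝ) (hs : 0 < s') (hs' : s' ≤ s) :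
    expect (step true p) (powBelow s' (2 * R)) ≤
      expect p (powBelow s R) ^ (2 * (s' / s)) +
        2 * ENNReal.ofReal (Real.exp (s' * (2 * R))) * expect p (above R) := by
  rw [expect_step]
  refine (expect_mono _ fun a => expect_mono _ fun b =>
    powBelow_combine_true hs a b).trans ?_
  simp_rw [expect_add, expect_mul_left, expect_mul_right, expect_add, expect_const]
  have h := expect_powBelow_le p R hs hs'
  rw [mul_comm (2 : ℝ) (s' / s), ENNReal.rpow_mul, ENNReal.rpow_two, sq]
  refine add_le_add (mul_le_mul' h h) (le_of_eq ?_)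
  ring

theorem expect_cost_le_powBelow {s : ℝ} (R : ℝ) (hs : 0 < s) (hs1 : s ≤ 1) :
    expect p cost ≤ ENNReal.ofReal s⁻¹ * expect p (powBelow s R) + expect p (costAbove R) := by
  rw [← expect_mul_left, ← expect_add]
  exact expect_mono _ fun a => cost_le_powBelow_add R hs hs1 a

end StepBounds

/-! ### Deterministic recursions along balanced paths -/

/-- The law after `n` steps of the path `b`. -/
noncomputable def lawSeq (p : Law) (b : ℕ → Bool) (n : ℕ) : Law :=
  lawAt p (BDMC.firstSteps b n)

theorem lawSeq_zero (p : Law) (b : ℕ → Bool) : lawSeq p b 0 = p := rfl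

theorem lawSeq_succ (p : Law) (b : ℕ → Bool) (n : ℕ) :
    lawSeq p b (n + 1) = step (b n) (lawSeq p b n) := rfl

/-- The number of steps of type `t` among the first `n` steps of `b`. -/
def count (t : Bool) (b : ℕ → Bool) : ℕ → ℕ
  | 0 => 0
  | n + 1 => count t b n + if b n = t then 1 else 0

/-- The sequence that starts at `a`, loses `d` at each step, and is multiplied by `κ` at the
steps of type `t`. -/
noncomputable def growth (κ d : ℝ) (t : Bool) (b : ℕ → Bool) (a : ℝ) : ℕ → ℝ
  | 0 => a
  | n + 1 => (if b n = t then κ * growth κ d t b a n else growth κ d t b a n) - d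

/-- Divided by `κ ^ count`, the sequence loses at each step at most `d` over the current power. -/
theorem le_growth {κ d : ℝ} (hκ : 1 ≤ κ) (hd : 0 ≤ d) (t : Bool) (b : ℕ → Bool) (a : ℝ) (n : ℕ) :
    κ ^ count t b n * (a - d * ∑ i ∈ Finset.range n, (κ ^ count t b i)⁻¹) ≤
      growth κ d t b a n := by
  have hκ0 : 0 < κ := by linarith
  induction n with
  | zero => simp [growth, count]
  | succ n ih =>
    rw [Finset.sum_range_succ, growth, count]
    have hc : 1 ≤ κ ^ count t b n := one_le_pow₀ hκ
    split_ifs with h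
    · have e : κ ^ (count t b n + 1) * (a - d * (∑ i ∈ Finset.range n, (κ ^ count t b i)⁻¹ +
          (κ ^ count t b n)⁻¹)) = κ * (κ ^ count t b n *
          (a - d * ∑ i ∈ Finset.range n, (κ ^ count t b i)⁻¹)) - κ * d := by
        field_simp
        ring
      rw [e]
      have := mul_le_mul_of_nonneg_left ih hκ0.le
      nlinarith
    · have e : κ ^ (count t b n + 0) * (a - d * (∑ i ∈ Finset.range n, (κ ^ count t b i)⁻¹ +
          (κ ^ count t b n)⁻¹)) = κ ^ count t b n *
          (a - d * ∑ i ∈ Finset.range n, (κ ^ count t b i)⁻¹) - d := by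
        field_simp
        ring
      rw [e]
      linarith

theorem growth_le {κ d : ℝ} (hκ : 1 ≤ κ) (hd : 0 ≤ d) (t : Bool) (b : ℕ → Bool) (a : ℝ) (n : ℕ) :
    growth κ d t b a n ≤ κ ^ count t b n * a := by
  induction n with
  | zero => simp [growth, count]
  | succ n ih =>
    rw [growth, count]
    split_ifs with h
    · have := mul_le_mul_of_nonneg_left ih (by linarith : 0 ≤ κ)
      rw [pow_succ]
      linarith
    · simp only [add_zero]
      linarith

/-- Paths along which each type of step has frequency at least `μ`, up to the constant `c`. -/
def balanced (μ c : ℝ) : Set (ℕ → Bool) := {b | ∀ t n, μ * n - c ≤ count t b n}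

/-- The initial value that makes `growth` increase along balanced paths. -/
noncomputable def threshold (κ d μ c : ℝ) : ℝ := 1 + d * (κ ^ c / (1 - κ ^ (-μ)))

/-- Balance makes the powers grow geometrically, so the total loss is bounded uniformly in the path.
-/
theorem sum_inv_pow_count_le {κ μ c : ℝ} (hκ : 1 < κ) (hμ : 0 < μ) {b : ℕ → Bool}
    (hb : b ∈ balanced μ c) (t : Bool) (n : ℕ) :
    ∑ i ∈ Finset.range n, (κ ^ count t b i)⁻¹ ≤ κ ^ c / (1 - κ ^ (-μ)) := by
  have hκ0 : 0 < κ := by linarith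
  have hlt : κ ^ (-μ) < 1 := Real.rpow_lt_one_of_one_lt_of_neg hκ (by linarith)
  have hterm : ∀ i ∈ Finset.range n, (κ ^ count t b i)⁻¹ ≤ κ ^ c * (κ ^ (-μ)) ^ i := by
    intro i _
    rw [← Real.rpow_natCast, ← Real.rpow_neg hκ0.le, ← Real.rpow_natCast, ← Real.rpow_mul hκ0.le,
      ← Real.rpow_add hκ0]
    refine Real.rpow_le_rpow_of_exponent_le hκ.le ?_
    have := hb t i
    linarith
  refine (Finset.sum_le_sum hterm).trans ?_
  rw [← Finset.mul_sum, div_eq_mul_inv]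
  refine mul_le_mul_of_nonneg_left ?_ (by positivity)
  rw [← tsum_geometric_of_lt_one (by positivity) hlt]
  exact (summable_geometric_of_lt_one (by positivity) hlt).sum_le_tsum _
    (fun i _ => by positivity)

/-- Above the threshold the initial value exceeds the total discounted loss by at least 1. -/
theorem pow_count_le_growth {κ d μ c : ℝ} (hκ : 1 < κ) (hd : 0 ≤ d) (hμ : 0 < μ) {b : ℕ → Bool}
    (hb : b ∈ balanced μ c) (t : Bool) {a : ℝ} (ha : threshold κ d μ c ≤ a) (n : ℕ) :
    κ ^ count t b n ≤ growth κ d t b a n := by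
  refine le_trans ?_ (le_growth hκ.le hd t b a n)
  have h := mul_le_mul_of_nonneg_left (sum_inv_pow_count_le hκ hμ hb t n) hd
  have hpos : 0 ≤ κ ^ count t b n := by positivity
  unfold threshold at ha
  nlinarith

/-- A sequence that is squared at the steps of type `t` and at most doubled otherwise. -/
theorem le_two_rpow_neg_growth {t : Bool} {b : ℕ → Bool} {u : ℕ → ℝ≥0∞} {a : ℝ}
    (h0 : u 0 ≤ ENNReal.ofReal (2 ^ (-a)))
    (h1 : ∀ n, b n = t → u (n + 1) ≤ u n ^ 2) (h2 : ∀ n, b n ≠ t → u (n + 1) ≤ 2 * u n) (n : ℕ) :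
    u n ≤ ENNReal.ofReal (2 ^ (-growth 2 1 t b a n)) := by
  induction n with
  | zero => exact h0
  | succ n ih =>
    rw [growth]
    split_ifs with h
    · refine (h1 n h).trans ((pow_le_pow_left' ih 2).trans ?_)
      rw [← ENNReal.ofReal_pow (by positivity)]
      refine ENNReal.ofReal_le_ofReal ?_
      rw [← Real.rpow_natCast, ← Real.rpow_mul (by norm_num)]
      refine Real.rpow_le_rpow_of_exponent_le (by norm_num) ?_
      push_cast
      linarith
    · refine (h2 n h).trans ((mul_le_mul_right ih 2).trans ?_)
      rw [show (2 : ℝ≥0∞) = ENNReal.ofReal 2 by simp, ← ENNReal.ofReal_mul (by norm_num)]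
      refine ENNReal.ofReal_le_ofReal ?_
      rw [neg_sub, sub_eq_add_neg, Real.rpow_add (by norm_num), Real.rpow_one]

/-- A sequence driven by one as in `le_two_rpow_neg_growth`. -/
theorem le_mul_two_rpow {t : Bool} {b : ℕ → Bool} {u q : ℕ → ℝ≥0∞} {a : ℝ}
    (hu : ∀ n, u n ≤ ENNReal.ofReal (2 ^ (-growth 2 1 t b a n)))
    (h1 : ∀ n, b n = t → q (n + 1) ≤ 2 * u n * q n) (h2 : ∀ n, b n ≠ t → q (n + 1) ≤ 4 * q n)
    (n : ℕ) : q n ≤ ENNReal.ofReal (2 ^ (n + a - growth 2 1 t b a n)) * q 0 := by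
  induction n with
  | zero => simp [growth]
  | succ n ih =>
    rw [growth]
    split_ifs with h
    · refine (h1 n h).trans ((mul_le_mul' (mul_le_mul_right (hu n) 2) ih).trans ?_)
      rw [← mul_assoc]
      refine mul_le_mul_left ?_ _
      rw [show (2 : ℝ≥0∞) = ENNReal.ofReal 2 by simp, ← ENNReal.ofReal_mul (by norm_num),
        ← ENNReal.ofReal_mul (by positivity)]
      refine ENNReal.ofReal_le_ofReal ?_
      nth_rw 1 [← Real.rpow_one 2]
      rw [← Real.rpow_add (by norm_num), ← Real.rpow_add (by norm_num)]
      refine Real.rpow_le_rpow_of_exponent_le (by norm_num) ?_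
      push_cast
      linarith
    · refine (h2 n h).trans ((mul_le_mul_right ih 4).trans ?_)
      rw [← mul_assoc]
      refine mul_le_mul_left ?_ _
      rw [show (4 : ℝ≥0∞) = ENNReal.ofReal 4 by simp, ← ENNReal.ofReal_mul (by norm_num)]
      refine ENNReal.ofReal_le_ofReal ?_
      -- Of the two units in the exponent, one is the increase of `n` and the other the loss in
      -- `growth`.
      rw [show (4 : ℝ) = 2 ^ (2 : ℝ) by norm_num, ← Real.rpow_add (by norm_num)]
      refine Real.rpow_le_rpow_of_exponent_le (by norm_num) ?_
      push_cast
      linarith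

/-- The hypothesis on `β` says `2 ^ β < κ ^ μ`, so the right side has the larger exponential rate.
-/
theorem eventually_add_rpow_le {κ μ c β : ℝ} (hκ : 1 < κ) (hμ : 0 < μ)
    (hβ : β * Real.log 2 < μ * Real.log κ) (A B : ℝ) (m : ℕ) :
    ∀ᶠ n : ℕ in atTop, A + B * n + 2 ^ (β * (n + m : ℕ)) ≤ κ ^ (μ * n - c) := by
  have hκ0 : 0 < κ := by linarith
  set r : ℝ := κ ^ μ with hr
  set q : ℝ := 2 ^ β with hq
  have hr1 : 1 < r := Real.one_lt_rpow hκ hμ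
  have hr0 : 0 < r := by linarith
  have hq0 : 0 < q := by positivity
  have hqr : q < r := by
    rw [hq, hr, ← Real.log_lt_log_iff (by positivity) (by positivity),
      Real.log_rpow (by norm_num), Real.log_rpow hκ0]
    exact hβ
  have h1 : Tendsto (fun n : ℕ => A * ((n : ℝ) ^ 0 / r ^ n) + B * ((n : ℝ) ^ 1 / r ^ n) +
      q ^ m * (q / r) ^ n) atTop (𝓝 (A * 0 + B * 0 + q ^ m * 0)) :=
    (((tendsto_pow_const_div_const_pow_of_one_lt 0 hr1).const_mul A).add
      ((tendsto_pow_const_div_const_pow_of_one_lt 1 hr1).const_mul B)).add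
      ((tendsto_pow_atTop_nhds_zero_of_lt_one (by positivity)
        ((div_lt_one hr0).2 hqr)).const_mul _)
  have h2 : A * 0 + B * 0 + q ^ m * 0 < κ ^ (-c) := by
    simp only [mul_zero, add_zero]
    positivity
  filter_upwards [h1.eventually_lt_const h2] with n hn
  have e1 : κ ^ (μ * n - c) = κ ^ (-c) * r ^ n := by
    rw [hr, ← Real.rpow_natCast, ← Real.rpow_mul hκ0.le, ← Real.rpow_add hκ0]
    congr 1
    ring
  have e2 : (2 : ℝ) ^ (β * (n + m : ℕ)) = q ^ m * q ^ n := by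
    rw [Real.rpow_mul (by norm_num), Real.rpow_natCast, pow_add, mul_comm]
  rw [e1, e2]
  have := mul_le_mul_of_nonneg_right hn.le (by positivity : 0 ≤ r ^ n)
  refine le_trans (le_of_eq ?_) this
  rw [div_pow]
  field_simp

/-- The sequence `g` is at most `2 ^ (- 2 ^ (β (n + m)))` eventually, for every shift `m`. -/
def Fast (β : ℝ) (g : ℕ → ℝ≥0∞) : Prop :=
  ∀ m : ℕ, ∀ᶠ n : ℕ in atTop, g n ≤ ENNReal.ofReal (2 ^ (-(2 : ℝ) ^ (β * (n + m : ℕ))))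

theorem fast_add_of_le_mul_rpow {κ μ c β : ℝ} (hκ : 1 < κ) (hμ : 0 < μ)
    (hβ : β * Real.log 2 < μ * Real.log κ) {f₁ f₂ : ℕ → ℝ≥0∞} {g₁ g₂ : ℕ → ℝ} {C₁ C₂ : ℝ≥0∞}
    (hC₁ : C₁ ≠ ⊤) (hC₂ : C₂ ≠ ⊤) (hg₁ : ∀ n : ℕ, κ ^ (μ * n - c) ≤ g₁ n)
    (hg₂ : ∀ n : ℕ, κ ^ (μ * n - c) ≤ g₂ n) {A : ℝ}
    (h₁ : ∀ n : ℕ, f₁ n ≤ ENNReal.ofReal (2 ^ (n + A - g₁ n)) * C₁)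
    (h₂ : ∀ n : ℕ, f₂ n ≤ ENNReal.ofReal (2 ^ (n + A - g₂ n)) * C₂) :
    Fast β fun n => f₁ n + f₂ n := by
  intro m
  -- The constants are absorbed into `k` units of the exponent.
  obtain ⟨k, hk⟩ : ∃ k : ℕ, C₁.toReal + C₂.toReal ≤ 2 ^ k := by
    obtain ⟨k, hk⟩ := pow_unbounded_of_one_lt (C₁.toReal + C₂.toReal) one_lt_two
    exact ⟨k, hk.le⟩
  filter_upwards [eventually_add_rpow_le (c := c) hκ hμ hβ (A + k) 1 m] with n hn
  have key : ∀ (g : ℕ → ℝ) (C : ℝ≥0∞), C ≠ ⊤ → κ ^ (μ * n - c) ≤ g n →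
      ENNReal.ofReal (2 ^ (n + A - g n)) * C ≤
        ENNReal.ofReal (2 ^ (-(k : ℝ) - 2 ^ (β * (n + m : ℕ)))) * C := by
    intro g C hC hg
    refine mul_le_mul_left (ENNReal.ofReal_le_ofReal ?_) _
    refine Real.rpow_le_rpow_of_exponent_le (by norm_num) ?_
    linarith
  refine (add_le_add ((h₁ n).trans (key g₁ C₁ hC₁ (hg₁ n)))
    ((h₂ n).trans (key g₂ C₂ hC₂ (hg₂ n)))).trans ?_
  rw [← mul_add, ← ENNReal.ofReal_toReal (ENNReal.add_ne_top.2 ⟨hC₁, hC₂⟩),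
    ← ENNReal.ofReal_mul (by positivity), ENNReal.toReal_add hC₁ hC₂]
  refine ENNReal.ofReal_le_ofReal ?_
  refine (mul_le_mul_of_nonneg_left hk (by positivity)).trans (le_of_eq ?_)
  rw [← Real.rpow_natCast, ← Real.rpow_add (by norm_num)]
  congr 1
  ring

theorem Fast.mono {β : ℝ} {f g : ℕ → ℝ≥0∞} (hg : Fast β g) (h : ∀ n, f n ≤ g n) : Fast β f :=
  fun m => (hg m).mono fun n hn => (h n).trans hn

theorem rpow_le_growth {κ d μ c : ℝ} (hκ : 1 < κ) (hd : 0 ≤ d) (hμ : 0 < μ) {b : ℕ → Bool}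
    (hb : b ∈ balanced μ c) (t : Bool) {a : ℝ} (ha : threshold κ d μ c ≤ a) (n : ℕ) :
    κ ^ (μ * n - c) ≤ growth κ d t b a n := by
  refine le_trans ?_ (pow_count_le_growth hκ hd hμ hb t ha n)
  rw [← Real.rpow_natCast]
  exact Real.rpow_le_rpow_of_exponent_le hκ.le (hb t n)

theorem one_le_threshold {κ d μ c : ℝ} (hκ : 1 < κ) (hd : 0 ≤ d) (hμ : 0 < μ) :
    1 ≤ threshold κ d μ c := by
  have hlt : κ ^ (-μ) < 1 := Real.rpow_lt_one_of_one_lt_of_neg hκ (by linarith)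
  have : 0 ≤ d * (κ ^ c / (1 - κ ^ (-μ))) :=
    mul_nonneg hd (div_nonneg (Real.rpow_nonneg (by linarith) _) (by linarith))
  unfold threshold
  linarith

/-- A sequence driven by one that is squared at the steps of type `t` vanishes fast. -/
theorem fast_of_driven {μ c β : ℝ} (hμ : 0 < μ) (hβ : β < μ) {b : ℕ → Bool}
    (hb : b ∈ balanced μ c) {t : Bool} {u q : ℕ → ℝ≥0∞}
    (h0 : u 0 ≤ ENNReal.ofReal (2 ^ (-threshold 2 1 μ c)))
    (h1 : ∀ n, b n = t → u (n + 1) ≤ u n ^ 2) (h2 : ∀ n, b n ≠ t → u (n + 1) ≤ 2 * u n)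
    (hq0 : q 0 ≠ ⊤)
    (h3 : ∀ n, b n = t → q (n + 1) ≤ 2 * u n * q n) (h4 : ∀ n, b n ≠ t → q (n + 1) ≤ 4 * q n) :
    Fast β fun n => u n + q n := by
  have hl2 : 0 < Real.log 2 := Real.log_pos (by norm_num)
  have ha := one_le_threshold (c := c) one_lt_two zero_le_one hμ
  have hu := le_two_rpow_neg_growth h0 h1 h2
  refine fast_add_of_le_mul_rpow one_lt_two hμ (by nlinarith) ENNReal.one_ne_top hq0
    (rpow_le_growth one_lt_two zero_le_one hμ hb t le_rfl)
    (rpow_le_growth one_lt_two zero_le_one hμ hb t le_rfl)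
    (A := threshold 2 1 μ c) (fun n => ?_) (le_mul_two_rpow hu h3 h4)
  rw [mul_one]
  refine (hu n).trans (ENNReal.ofReal_le_ofReal
    (Real.rpow_le_rpow_of_exponent_le (by norm_num) ?_))
  have : (0 : ℝ) ≤ n := n.cast_nonneg
  linarith

/-! ### Fast convergence from small bias or small nonzero mass -/

theorem fast_bias_excess {μ c β : ℝ} (hμ : 0 < μ) (hβ : β < μ) {b : ℕ → Bool}
    (hb : b ∈ balanced μ c) {p : Law}
    (hT : expect p bias ≤ ENNReal.ofReal (2 ^ (-threshold 2 1 μ c)))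
    (hp : expect p excess ≠ ⊤) :
    Fast β fun n => expect (lawSeq p b n) bias + expect (lawSeq p b n) excess := by
  refine fast_of_driven hμ hβ hb (t := false) hT ?_ ?_ hp ?_ ?_ <;>
    intro n hn <;> rw [lawSeq_succ]
  · rw [hn, expect_bias_false]
  · rw [Bool.eq_true_of_not_eq_false hn]
    exact expect_bias_true _
  · rw [hn]
    exact expect_excess_false _
  · rw [Bool.eq_true_of_not_eq_false hn]
    exact expect_excess_true _

theorem fast_cost_of_nonzero {μ c β : ℝ} (hμ : 0 < μ) (hβ : β < μ) {b : ℕ → Bool}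
    (hb : b ∈ balanced μ c) {p : Law}
    (hT : expect p nonzero ≤ ENNReal.ofReal (2 ^ (-threshold 2 1 μ c)))
    (hp : expect p cost ≠ ⊤) :
    Fast β fun n => expect (lawSeq p b n) cost := by
  refine Fast.mono (fast_of_driven hμ hβ hb (t := true)
    (u := fun n => expect (lawSeq p b n) nonzero)
    (q := fun n => expect (lawSeq p b n) cost) hT ?_ ?_ hp ?_ ?_) fun n => le_add_self <;>
    intro n hn <;> rw [lawSeq_succ]
  · rw [hn, expect_nonzero_true]
  · rw [Bool.eq_false_of_not_eq_true hn]
    exact expect_nonzero_false _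
  · rw [hn]
    exact expect_cost_true _
  · refine (expect_cost_le _ _).trans (mul_le_mul_left ?_ _)
    norm_num

/-! ### Fast convergence from a concentrated window -/

/-- The term `θ x^n` can dominate `q y^n` only while `(y/x)^n` is at most a multiple of `θ`; for
such `n`, `x^n` is at most a power of `θ`. With `θ` the exponent times the level of a truncated
moment, this is why outliers need only be small in terms of a power of the window ratio. -/
theorem exists_polynomial_bound {x y A q : ℝ} (hx : 1 < x) (hxy : x < y) (hA : 0 < A)
    (hq : 0 < q) :
    ∃ K D : ℝ, 0 < K ∧ 1 ≤ D ∧ ∀ θ : ℝ, 1 ≤ θ → ∀ n : ℕ,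
      A * (n + 1) + A * θ * x ^ n ≤ q * y ^ n + K * θ ^ D := by
  have hx0 : 0 < x := by linarith
  have hy0 : 0 < y := by linarith
  obtain ⟨C, hC⟩ : ∃ C : ℝ, ∀ n : ℕ, ((n : ℝ) + 1) ≤ C * x ^ n := by
    have h : Tendsto (fun n : ℕ => (n : ℝ) ^ 1 / x ^ n + (n : ℝ) ^ 0 / x ^ n) atTop (𝓝 (0 + 0)) :=
      (tendsto_pow_const_div_const_pow_of_one_lt 1 hx).add
        (tendsto_pow_const_div_const_pow_of_one_lt 0 hx)
    obtain ⟨C, hC⟩ := h.bddAbove_range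
    refine ⟨C, fun n => ?_⟩
    have := hC ⟨n, rfl⟩
    simp only [pow_one, pow_zero] at this
    rwa [← add_div, div_le_iff₀ (by positivity)] at this
  have hC0 : 0 < C := by
    have := hC 0
    simp at this
    linarith
  have hyx : 1 < y / x := (one_lt_div hx0).2 hxy
  have hlx := Real.log_pos hx
  have hlyx := Real.log_pos hyx
  set E := Real.log x / Real.log (y / x) with hE
  have hE0 : 0 < E := div_pos hlx hlyx
  set C1 := A * (C + 1) with hC1
  have hC10 : 0 < C1 := by positivity
  refine ⟨C1 * (C1 / q) ^ E, E + 1, by positivity, by linarith, fun θ hθ n => ?_⟩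
  have hθ0 : 0 < θ := by linarith
  have hxn : 0 < x ^ n := by positivity
  have h1 : A * (n + 1) + A * θ * x ^ n ≤ C1 * θ * x ^ n := by
    have := mul_le_mul_of_nonneg_left (hC n) hA.le
    have h2 : A * (C * x ^ n) ≤ A * (C * x ^ n) * θ := le_mul_of_one_le_right (by positivity) hθ
    rw [hC1]
    nlinarith
  refine h1.trans ?_
  rcases le_or_gt (C1 * θ * x ^ n) (q * y ^ n) with h | h
  · have : 0 ≤ C1 * (C1 / q) ^ E * θ ^ (E + 1) := by positivity
    linarith
  · have h3 : (y / x) ^ n ≤ C1 / q * θ := by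
      rw [div_pow, div_le_iff₀ hxn, div_mul_eq_mul_div, div_mul_eq_mul_div, le_div_iff₀ hq]
      linarith
    have h4 : x ^ n ≤ (C1 / q * θ) ^ E := by
      have e : x ^ n = ((y / x) ^ n) ^ E := by
        rw [← Real.rpow_natCast (y / x), ← Real.rpow_mul (by positivity), Real.rpow_def_of_pos
          (by positivity), hE, ← Real.rpow_natCast x, Real.rpow_def_of_pos hx0]
        congr 1
        field_simp
      rw [e]
      exact Real.rpow_le_rpow (by positivity) h3 hE0.le
    have h5 : C1 * θ * x ^ n ≤ C1 * θ * (C1 / q * θ) ^ E :=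
      mul_le_mul_of_nonneg_left h4 (by positivity)
    rw [Real.mul_rpow (by positivity) hθ0.le] at h5
    rw [Real.rpow_add hθ0, Real.rpow_one]
    have : 0 ≤ q * y ^ n := by positivity
    nlinarith

theorem count_add_count (b : ℕ → Bool) (n : ℕ) : count true b n + count false b n = n := by
  induction n with
  | zero => rfl
  | succ n ih =>
    rw [count, count]
    cases b n <;> simp <;> omega

theorem exp_le_two_rpow {x : ℝ} (hx : 0 ≤ x) : Real.exp x ≤ 2 ^ (3 / 2 * x) := by
  rw [Real.rpow_def_of_pos (by norm_num), Real.exp_le_exp]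
  have := Real.log_two_gt_d9
  nlinarith

/-- The indicator of a log-likelihood ratio less than `R`. -/
noncomputable def below (R : ℝ) (a : ℝ≥0) : ℝ≥0∞ := if (a : ℝ) < Real.exp R then 1 else 0

theorem outside_le (R : ℝ) (a : ℝ≥0) : outside R a ≤ above R a + below (-R) a := by
  unfold outside above below
  split_ifs with h h1 h2 <;> simp_all

theorem above_antitone {R R' : ℝ} (h : R ≤ R') (a : ℝ≥0) : above R' a ≤ above R a := by
  unfold above
  split_ifs with h1 h2
  · exact le_rfl
  · exact absurd ((Real.exp_le_exp.2 h).trans_lt h1) h2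
  · exact zero_le
  · exact zero_le

theorem powBelow_le {s x y R : ℝ} (hs : 0 ≤ s) (a : ℝ≥0) :
    powBelow s R a ≤ ENNReal.ofReal (Real.exp (s * -x)) +
      ENNReal.ofReal (Real.exp (s * y)) * above (-x) a +
      ENNReal.ofReal (Real.exp (s * R)) * above y a := by
  have key : ∀ z : ℝ, (a : ℝ) ≤ Real.exp z →
      powBelow s R a ≤ ENNReal.ofReal (Real.exp (s * z)) := by
    intro z hz
    unfold powBelow
    split_ifs
    · exact zero_le
    · exact ENNReal.ofReal_le_ofReal (rpow_le_exp hs a.coe_nonneg hz)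
  by_cases h1 : Real.exp (-x) < a
  · by_cases h2 : Real.exp y < a
    · refine le_trans ?_ le_add_self
      rw [above, if_pos h2, mul_one]
      by_cases h3 : Real.exp R < a
      · rw [powBelow, if_pos h3]
        exact zero_le
      · exact key R (not_lt.1 h3)
    · refine le_trans (le_trans ?_ le_add_self) le_self_add
      rw [above, if_pos h1, mul_one]
      exact key y (not_lt.1 h2)
  · exact le_trans (le_trans (key (-x) (not_lt.1 h1)) le_self_add) le_self_add

/-- The recursion for the truncated moments along a balanced path. -/
theorem expect_powBelow_le_growth {κ μ c : ℝ} (hκ : 1 < κ) (hκ2 : κ < 2) (hμ : 0 < μ)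
    {b : ℕ → Bool} (hb : b ∈ balanced μ c) (p : Law) {s R : ℝ} (hs : 0 < s) (hs1 : s ≤ 1) {β₀ : ℝ}
    (hβ₀ : threshold κ 2 μ c ≤ β₀)
    (h0 : expect p (powBelow s R) ≤ ENNReal.ofReal (2 ^ (-β₀)))
    (herr : ∀ n : ℕ, 2 * ENNReal.ofReal (Real.exp (κ * (s * R * κ ^ count true b n))) *
      expect (lawSeq p b n) (above (R * 2 ^ count true b n)) ≤
        ENNReal.ofReal (2 ^ (-(κ * growth κ 2 true b β₀ n))))
    (hR : 0 ≤ R) (n : ℕ) :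
    expect (lawSeq p b n)
        (powBelow (s * (κ / 2) ^ count true b n) (R * 2 ^ count true b n)) ≤
      ENNReal.ofReal (2 ^ (-growth κ 2 true b β₀ n)) := by
  have hκ0 : 0 < κ := by linarith
  induction n with
  | zero => simpa [lawSeq_zero, count, growth] using h0
  | succ n ih =>
    have hpos : 0 ≤ growth κ 2 true b β₀ n :=
      (by positivity : (0 : ℝ) ≤ κ ^ count true b n).trans
        (pow_count_le_growth hκ (by norm_num) hμ hb true hβ₀ n)
    set S := s * (κ / 2) ^ count true b n with hS
    set T := R * 2 ^ count true b n with hT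
    set g := growth κ 2 true b β₀ n with hg
    have hS0 : 0 < S := by positivity
    have hS1 : S ≤ 1 := mul_le_one₀ hs1 (by positivity)
      (pow_le_one₀ (by positivity) (by linarith))
    have hT0 : 0 ≤ T := by positivity
    have hST : S * T = s * R * κ ^ count true b n := by
      rw [hS, hT, div_pow]
      field_simp
    rw [lawSeq_succ, growth, ← hg, count]
    by_cases hbn : b n = true
    · have e1 : s * (κ / 2) ^ (count true b n + if b n = true then 1 else 0) = S * (κ / 2) := by
        rw [if_pos hbn, pow_succ, ← mul_assoc]
      have e2 : R * 2 ^ (count true b n + if b n = true then 1 else 0) = 2 * T := by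
        rw [if_pos hbn, pow_succ, hT]
        ring
      rw [e1, e2, if_pos hbn, hbn]
      refine (expect_powBelow_true _ T (by positivity : 0 < S * (κ / 2))
        (mul_le_of_le_one_right hS0.le (by linarith))).trans ?_
      -- The scaling of the exponent by `κ/2` is chosen so that a plus step raises the moment to the
      -- power `κ` and multiplies exponent times level by the same `κ`.
      have e3 : 2 * (S * (κ / 2) / S) = κ := by
        field_simp
      have e4 : S * (κ / 2) * (2 * T) = κ * (s * R * κ ^ count true b n) := by
        rw [← hST]
        ring
      rw [e3, e4]
      refine (add_le_add (ENNReal.rpow_le_rpow ih hκ0.le) (herr n)).trans ?_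
      rw [ENNReal.ofReal_rpow_of_nonneg (by positivity) hκ0.le, ← Real.rpow_mul (by norm_num),
        ← ENNReal.ofReal_add (by positivity) (by positivity)]
      refine ENNReal.ofReal_le_ofReal ?_
      have e5 : (2 : ℝ) ^ (-(κ * g - 2)) = 4 * 2 ^ (-(κ * g)) := by
        rw [neg_sub, sub_eq_add_neg, Real.rpow_add (by norm_num)]
        norm_num
      rw [e5, show -g * κ = -(κ * g) by ring]
      have : (0 : ℝ) < 2 ^ (-(κ * g)) := by positivity
      linarith
    · have e1 : s * (κ / 2) ^ (count true b n + if b n = true then 1 else 0) = S := by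
        rw [if_neg hbn, add_zero]
      have e2 : R * 2 ^ (count true b n + if b n = true then 1 else 0) = T := by
        rw [if_neg hbn, add_zero]
      rw [e1, e2, if_neg hbn, Bool.eq_false_of_not_eq_true hbn]
      refine (expect_powBelow_false _ T hS0 hS1).trans ?_
      have h1 : 2 * ENNReal.ofReal (Real.exp (S * T)) * expect (lawSeq p b n) (above T) ≤
          ENNReal.ofReal (2 ^ (-(κ * g))) := by
        refine le_trans ?_ (herr n)
        refine mul_le_mul_left (mul_le_mul_right (ENNReal.ofReal_le_ofReal
          (Real.exp_le_exp.2 ?_)) _) _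
        rw [hST]
        exact le_mul_of_one_le_left (by positivity) hκ.le
      refine (add_le_add (mul_le_mul_right ih 2) h1).trans ?_
      rw [show (2 : ℝ≥0∞) = ENNReal.ofReal 2 by simp, ← ENNReal.ofReal_mul (by norm_num),
        ← ENNReal.ofReal_add (by positivity) (by positivity)]
      refine ENNReal.ofReal_le_ofReal ?_
      -- The loss 2 in `growth` pays a factor 4: minus needs 2 for the moment and 1 for the error,
      -- plus needs 1 and 1.
      have e5 : (2 : ℝ) ^ (-(g - 2)) = 4 * 2 ^ (-g) := by
        rw [neg_sub, sub_eq_add_neg, Real.rpow_add (by norm_num)]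
        norm_num
      have e6 : (2 : ℝ) ^ (-(κ * g)) ≤ 2 ^ (-g) :=
        Real.rpow_le_rpow_of_exponent_le (by norm_num) (by nlinarith)
      rw [e5]
      have : (0 : ℝ) < 2 ^ (-g) := by positivity
      linarith

/-- The mass and the loss above a window that grows at plus steps. -/
theorem expect_above_costAbove_le (p : Law) (b : ℕ → Bool) {R a : ℝ} (hR : 0 ≤ R)
    (hu0 : expect p (outside R) ≤ ENNReal.ofReal (2 ^ (-a))) (n : ℕ) :
    expect (lawSeq p b n) (above (R * 2 ^ count true b n)) ≤
        ENNReal.ofReal (2 ^ (n + a - growth 2 1 false b a n)) * expect p (above R) ∧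
      expect (lawSeq p b n) (costAbove (R * 2 ^ count true b n)) ≤
        ENNReal.ofReal (2 ^ (n + a - growth 2 1 false b a n)) * expect p (costAbove R) := by
  have hR2 : ∀ n, b n ≠ false → R * 2 ^ count true b (n + 1) = 2 * (R * 2 ^ count true b n) := by
    intro n hn
    rw [count, if_pos (Bool.eq_true_of_not_eq_false hn), pow_succ]
    ring
  have hR1 : ∀ n, b n = false → R * 2 ^ count true b (n + 1) = R * 2 ^ count true b n := by
    intro n hn
    rw [count, if_neg (by simp [hn]), add_zero]
  have hRn : ∀ n, 0 ≤ R * 2 ^ count true b n := fun n => by positivity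
  have hu : ∀ n, expect (lawSeq p b n) (outside (R * 2 ^ count true b n)) ≤
      ENNReal.ofReal (2 ^ (-growth 2 1 false b a n)) := by
    refine le_two_rpow_neg_growth (t := false) ?_ ?_ ?_
    · simpa [lawSeq_zero, count] using hu0
    · intro n hn
      rw [hR1 n hn, lawSeq_succ, hn]
      exact expect_outside_false _ _
    · intro n hn
      rw [hR2 n hn, lawSeq_succ, Bool.eq_true_of_not_eq_false hn]
      exact expect_outside_true _ _
  have hv := le_mul_two_rpow (t := false) hu
    (q := fun n => expect (lawSeq p b n) (above (R * 2 ^ count true b n)))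
    (fun n hn => by
      rw [hR1 n hn, lawSeq_succ, hn]
      exact expect_above_false _ (hRn n))
    (fun n hn => by
      rw [hR2 n hn, lawSeq_succ, Bool.eq_true_of_not_eq_false hn]
      refine (expect_above_true _ _).trans (mul_le_mul_left ?_ _)
      norm_num) n
  have hX := le_mul_two_rpow (t := false) hu
    (q := fun n => expect (lawSeq p b n) (costAbove (R * 2 ^ count true b n)))
    (fun n hn => by
      rw [hR1 n hn, lawSeq_succ, hn]
      exact expect_costAbove_false _ (hRn n))
    (fun n hn => by
      rw [hR2 n hn, lawSeq_succ, Bool.eq_true_of_not_eq_false hn]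
      exact expect_costAbove_true _ _) n
  have e0 : R * 2 ^ count true b 0 = R := by simp [count]
  simp only [e0, lawSeq_zero] at hv hX
  exact ⟨hv, hX⟩

/-- The loss splits into a truncated moment divided by its exponent and the loss above the level.
The exponent shrinks by at most 2 per step, so the division costs only a factor `2 ^ n`, up to a
constant. -/
theorem fast_of_powBelow_of_costAbove {κ μ c β : ℝ} (hκ : 1 < κ) (hκ2 : κ < 2) (hμ : 0 < μ)
    (hβ : β * Real.log 2 < μ * Real.log κ) {b : ℕ → Bool} (hb : b ∈ balanced μ c) (p : Law)
    {s R a : ℝ} (hs : 0 < s) (hs1 : s ≤ 1) (ha : 0 ≤ a) (hcost : expect p cost ≠ ⊤)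
    (haT : threshold 2 1 μ c ≤ a)
    (hB : ∀ n, expect (lawSeq p b n)
        (powBelow (s * (κ / 2) ^ count true b n) (R * 2 ^ count true b n)) ≤
      ENNReal.ofReal (2 ^ (-growth κ 2 true b (threshold κ 2 μ c) n)))
    (hX : ∀ n, expect (lawSeq p b n) (costAbove (R * 2 ^ count true b n)) ≤
        ENNReal.ofReal (2 ^ (n + a - growth 2 1 false b a n)) * expect p (costAbove R)) :
    Fast β fun n => expect (lawSeq p b n) cost := by
  have hκ0 : 0 < κ := by linarith
  set β₀ := threshold κ 2 μ c
  have hX0 : expect p (costAbove R) ≠ ⊤ := by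
    refine ne_top_of_le_ne_top hcost (expect_mono _ fun a => ?_)
    unfold costAbove
    split_ifs
    · exact le_rfl
    · exact zero_le
  have h1 : ∀ n : ℕ, κ ^ (μ * n - c) ≤ growth κ 2 true b β₀ n :=
    rpow_le_growth hκ zero_le_two hμ hb true le_rfl
  have h2 : ∀ n : ℕ, κ ^ (μ * n - c) ≤ growth 2 1 false b a n := by
    intro n
    refine le_trans ?_ (pow_count_le_growth one_lt_two zero_le_one hμ hb false haT n)
    refine le_trans ?_ (pow_le_pow_left₀ hκ0.le hκ2.le _)
    rw [← Real.rpow_natCast]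
    exact Real.rpow_le_rpow_of_exponent_le hκ.le (hb false n)
  have h3 : ∀ n : ℕ, ENNReal.ofReal (s * (κ / 2) ^ count true b n)⁻¹ * expect (lawSeq p b n)
      (powBelow (s * (κ / 2) ^ count true b n) (R * 2 ^ count true b n)) ≤
      ENNReal.ofReal (2 ^ (n + a - growth κ 2 true b β₀ n)) * ENNReal.ofReal s⁻¹ := by
    intro n
    refine (mul_le_mul_right (hB n) _).trans ?_
    rw [← ENNReal.ofReal_mul (by positivity), ← ENNReal.ofReal_mul (by positivity)]
    refine ENNReal.ofReal_le_ofReal ?_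
    have h1 : (s * (κ / 2) ^ count true b n)⁻¹ ≤ 2 ^ (n : ℝ) * s⁻¹ := by
      rw [mul_inv, mul_comm]
      refine mul_le_mul_of_nonneg_right ?_ (by positivity)
      rw [← inv_pow, inv_div, Real.rpow_natCast]
      have h2 : count true b n ≤ n := by
        have := count_add_count b n
        omega
      calc (2 / κ) ^ count true b n ≤ 2 ^ count true b n :=
            pow_le_pow_left₀ (by positivity) (div_le_self (by norm_num) hκ.le) _
        _ ≤ 2 ^ n := pow_le_pow_right₀ (by norm_num) h2
    have h2 : (2 : ℝ) ^ (n + a - growth κ 2 true b β₀ n) =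
        2 ^ (-growth κ 2 true b β₀ n) * 2 ^ (n : ℝ) * 2 ^ a := by
      rw [← Real.rpow_add (by norm_num), ← Real.rpow_add (by norm_num)]
      congr 1
      ring
    rw [h2]
    have h3 : (1 : ℝ) ≤ 2 ^ a := Real.one_le_rpow (by norm_num) ha
    have h4 := mul_le_mul_of_nonneg_right h1
      (by positivity : (0 : ℝ) ≤ 2 ^ (-growth κ 2 true b β₀ n))
    have h5 : 0 ≤ (2 : ℝ) ^ (-growth κ 2 true b β₀ n) * 2 ^ (n : ℝ) * s⁻¹ := by positivity
    have h6 := mul_le_mul_of_nonneg_left h3 h5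
    linarith
  have key := fast_add_of_le_mul_rpow hκ hμ hβ ENNReal.ofReal_ne_top hX0 h1 h2 h3 hX
  refine Fast.mono key fun n => expect_cost_le_powBelow _ _ (by positivity) ?_
  exact mul_le_one₀ hs1 (by positivity) (pow_le_one₀ (by positivity) (by linarith))

/-- The moment error has log-size of order `κ ^ ((1-μ) n)`, since balance allows at most `(1-μ) n +
c` plus steps; the tail exponent is of order `2 ^ (μ n)` and wins by the hypothesis `hKD`. -/
theorem error_exponent_le {κ μ c a A q lam : ℝ} (hκ : 1 < κ) (hμ : 0 < μ)
    {b : ℕ → Bool} (hb : b ∈ balanced μ c) (haT : threshold 2 1 μ c ≤ a) (ha : 0 ≤ a)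
    {β₀ : ℝ} (hβ₀ : 0 ≤ β₀) (hA : 1 + a + κ * κ ^ c * (3 / 2 + β₀) ≤ A) (hq : 1 ≤ q) (n : ℕ)
    (hKD : A * q * (κ ^ (1 - μ)) ^ n + A * (n + 1) ≤ lam + 2 ^ (-c) * (2 ^ μ) ^ n) :
    1 + 3 / 2 * (κ * (q * κ ^ count true b n)) + (n + a - growth 2 1 false b a n + -lam) ≤
      -(κ * growth κ 2 true b β₀ n) := by
  have hκ0 : 0 < κ := by linarith
  have hg1 := growth_le hκ.le zero_le_two true b β₀ n
  have hg2 := rpow_le_growth one_lt_two zero_le_one hμ hb false haT n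
  have hc : (count true b n : ℝ) ≤ (1 - μ) * n + c := by
    have h2 := hb false n
    have h3 : ((count true b n + count false b n : ℕ) : ℝ) = n := by rw [count_add_count]
    push_cast at h3
    linarith
  have hκc : κ ^ count true b n ≤ κ ^ c * (κ ^ (1 - μ)) ^ n := by
    rw [← Real.rpow_natCast κ, ← Real.rpow_natCast (κ ^ (1 - μ)), ← Real.rpow_mul hκ0.le,
      ← Real.rpow_add hκ0]
    exact Real.rpow_le_rpow_of_exponent_le hκ.le (by linarith)
  have h2 := hKD
  have e2 : (2 : ℝ) ^ (-c) * (2 ^ μ) ^ n = 2 ^ (μ * n - c) := by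
    rw [← Real.rpow_natCast (2 ^ μ), ← Real.rpow_mul (by norm_num),
      ← Real.rpow_add (by norm_num)]
    congr 1
    ring
  rw [e2] at h2
  set z := (κ ^ (1 - μ)) ^ n with hz
  have hz0 : 0 < z := by positivity
  have hn0 : (0 : ℝ) ≤ n := n.cast_nonneg
  have h4 : κ * (3 / 2 * q + β₀) * κ ^ count true b n ≤ A * q * z := by
    calc κ * (3 / 2 * q + β₀) * κ ^ count true b n
        ≤ κ * (3 / 2 * q + β₀) * (κ ^ c * z) := by gcongr
      _ ≤ κ * ((3 / 2 + β₀) * q) * (κ ^ c * z) := by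
        gcongr
        nlinarith
      _ = (κ * κ ^ c * (3 / 2 + β₀)) * q * z := by ring
      _ ≤ A * q * z := by
        gcongr
        linarith
  have h5 : 1 + a + n ≤ A * (n + 1) := by
    have : 1 + a ≤ A := by
      have : 0 ≤ κ * κ ^ c * (3 / 2 + β₀) := by positivity
      linarith
    nlinarith
  have h6 := mul_le_mul_of_nonneg_left hg1 hκ0.le
  nlinarith

/-- The law is concentrated on log-likelihood ratios in `[-L x, -x]`, up to mass `η`, and only
mass `2 ^ (-lam)` lies above `y`. -/
structure Concentrated (p : Law) (x L y η lam : ℝ) : Prop where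
  weak : expect p (above (-x)) ≤ ENNReal.ofReal η
  strong : expect p (below (-(L * x))) ≤ ENNReal.ofReal η
  wrong : expect p (above y) ≤ ENNReal.ofReal (2 ^ (-lam))

/-- The moment exponent `s = k/x` makes `a ^ s` at most `exp (-k)` on the window; with level `R = L
x` the product `s R = k L` involves only the ratio `L`, not the scale `x`. -/
theorem exists_fast_of_concentrated {κ μ c β : ℝ} (hκ : 1 < κ) (hκ2 : κ < 2) (hμ : 0 < μ)
    (hμ1 : μ < 1) (hκμ : κ ^ (1 - μ) < 2 ^ μ) (hβ : β * Real.log 2 < μ * Real.log κ) :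
    ∃ η k K D : ℝ, 0 < η ∧ 1 ≤ k ∧ 0 < K ∧ 1 ≤ D ∧ ∀ (p : Law) (x L y lam : ℝ),
      Concentrated p x L y η lam → 1 ≤ L → k ≤ x → y * k ≤ x → K * L ^ D ≤ lam →
      expect p cost ≠ ⊤ → ∀ b ∈ balanced μ c, Fast β fun n => expect (lawSeq p b n) cost := by
  have hκ0 : 0 < κ := by linarith
  set a := threshold 2 1 μ c with ha
  set β₀ := threshold κ 2 μ c with hβ₀
  have ha1 : 1 ≤ a := one_le_threshold one_lt_two zero_le_one hμ
  have hβ₀1 : 1 ≤ β₀ := one_le_threshold hκ zero_le_two hμ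
  set A : ℝ := 1 + a + κ * κ ^ c * (3 / 2 + β₀) with hA
  have hA0 : 0 < A := by positivity
  obtain ⟨K, D, hK, hD, hKD⟩ := exists_polynomial_bound (q := 2 ^ (-c))
    (Real.one_lt_rpow hκ (by linarith : 0 < 1 - μ)) hκμ hA0 (by positivity)
  -- Then `exp (-k) ≤ 2 ^ (-β₀) / 4`.
  set k : ℝ := β₀ + 2 with hk
  have hk1 : 1 ≤ k := by linarith
  -- The 12 is 3 times 4, as `exp (s y) ≤ exp 1 ≤ 3`; the second term bounds the initial mass
  -- outside the window.
  set η : ℝ := min (2 ^ (-β₀) / 12) (2 ^ (-a) / 4) with hη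
  have hη0 : 0 < η := lt_min (by positivity) (by positivity)
  -- `K k^D` covers the error terms at all times, where `s R = k L`; the other summands cover the
  -- bounds at time 0, as `1 ≤ L ≤ L^D`.
  refine ⟨η, k, K * k ^ D + 3 / 2 * k + β₀ + a + 2, D, hη0, hk1, by positivity, hD, ?_⟩
  intro p x L y lam hp hL hkx hyx hlam hcost b hb
  have hx0 : 0 < x := by linarith
  have hL0 : 0 < L := by linarith
  set s : ℝ := k / x with hs
  have hs0 : 0 < s := by positivity
  have hs1 : s ≤ 1 := (div_le_one hx0).2 hkx
  set R : ℝ := L * x with hR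
  have hR0 : 0 < R := by positivity
  have hyR : y ≤ R := by
    rcases le_or_gt y 0 with h | h
    · linarith
    · have h1 : y ≤ y * k := le_mul_of_one_le_right h.le hk1
      have h2 : x ≤ L * x := le_mul_of_one_le_left hx0.le hL
      linarith
  have hsR : s * R = k * L := by
    rw [hs, hR]
    field_simp
  have hLD : L ≤ L ^ D := by
    nth_rw 1 [← Real.rpow_one L]
    exact Real.rpow_le_rpow_of_exponent_le hL hD
  have hlam1 : K * (s * R) ^ D ≤ lam := by
    rw [hsR, Real.mul_rpow (by positivity) hL0.le, ← mul_assoc]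
    refine le_trans ?_ hlam
    have h0 : 0 ≤ L ^ D := by positivity
    refine mul_le_mul_of_nonneg_right ?_ h0
    linarith
  have hlam2 : 3 / 2 * (s * R) + β₀ + a + 2 ≤ lam := by
    refine le_trans ?_ hlam
    rw [hsR]
    have h1 : 1 ≤ L ^ D := hL.trans hLD
    have h2 : 0 ≤ K * k ^ D := by positivity
    nlinarith
  have hsR1 : 1 ≤ s * R := by
    rw [hsR]
    nlinarith
  have hv0 : expect p (above R) ≤ ENNReal.ofReal (2 ^ (-lam)) :=
    (expect_mono _ (above_antitone hyR)).trans hp.wrong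
  have hu0 : expect p (outside R) ≤ ENNReal.ofReal (2 ^ (-a)) := by
    refine (expect_mono _ (outside_le R)).trans ?_
    rw [expect_add]
    refine (add_le_add hv0 hp.strong).trans ?_
    rw [← ENNReal.ofReal_add (by positivity) hη0.le]
    refine ENNReal.ofReal_le_ofReal ?_
    have h1 : (2 : ℝ) ^ (-lam) ≤ 2 ^ (-a - 1) :=
      Real.rpow_le_rpow_of_exponent_le (by norm_num) (by linarith)
    rw [Real.rpow_sub_one (by norm_num)] at h1
    have h2 : η ≤ 2 ^ (-a) / 4 := min_le_right _ _
    have h3 : (0 : ℝ) < 2 ^ (-a) := by positivity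
    linarith
  have hvX := expect_above_costAbove_le p b hR0.le hu0
  have hB0 : expect p (powBelow s R) ≤ ENNReal.ofReal (2 ^ (-β₀)) := by
    refine (expect_mono _ (powBelow_le (x := x) (y := y) hs0.le)).trans ?_
    rw [expect_add, expect_add, expect_const, expect_mul_left, expect_mul_left]
    refine (add_le_add (add_le_add le_rfl (mul_le_mul_right hp.weak _))
      (mul_le_mul_right hp.wrong _)).trans ?_
    rw [← ENNReal.ofReal_mul (by positivity), ← ENNReal.ofReal_mul (by positivity),
      ← ENNReal.ofReal_add (by positivity) (by positivity),
      ← ENNReal.ofReal_add (by positivity) (by positivity)]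
    refine ENNReal.ofReal_le_ofReal ?_
    have h3 : (0 : ℝ) < 2 ^ (-β₀) := by positivity
    have h1 : Real.exp (s * -x) ≤ 2 ^ (-β₀) / 4 := by
      have e : s * -x = -k := by
        rw [hs]
        field_simp
      rw [e]
      have e2 : (2 : ℝ) ^ (-β₀) / 4 = 2 ^ (-k) := by
        rw [hk, neg_add, Real.rpow_add (by norm_num)]
        norm_num
        ring
      rw [e2, Real.rpow_def_of_pos (by norm_num), Real.exp_le_exp]
      have := Real.log_two_lt_d9
      nlinarith
    have h2 : Real.exp (s * y) * η ≤ 2 ^ (-β₀) / 4 := by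
      have e : s * y ≤ 1 := by
        rw [hs, div_mul_eq_mul_div, div_le_one hx0]
        linarith
      have e2 : Real.exp (s * y) ≤ 3 :=
        (Real.exp_le_exp.2 e).trans (by have := Real.exp_one_lt_d9; linarith)
      have e3 : η ≤ 2 ^ (-β₀) / 12 := min_le_left _ _
      nlinarith
    have h4 : Real.exp (s * R) * 2 ^ (-lam) ≤ 2 ^ (-β₀) / 4 := by
      refine (mul_le_mul_of_nonneg_right (exp_le_two_rpow (by positivity))
        (by positivity)).trans ?_
      rw [← Real.rpow_add (by norm_num)]
      have e2 : (2 : ℝ) ^ (-β₀) / 4 = 2 ^ (-β₀ - 2) := by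
        rw [sub_eq_add_neg, Real.rpow_add (by norm_num)]
        norm_num
        ring
      rw [e2]
      exact Real.rpow_le_rpow_of_exponent_le (by norm_num) (by linarith)
    linarith
  have herr : ∀ n : ℕ, 2 * ENNReal.ofReal (Real.exp (κ * (s * R * κ ^ count true b n))) *
      expect (lawSeq p b n) (above (R * 2 ^ count true b n)) ≤
        ENNReal.ofReal (2 ^ (-(κ * growth κ 2 true b β₀ n))) := by
    intro n
    refine (mul_le_mul_right ((hvX n).1.trans (mul_le_mul_right hv0 _)) _).trans ?_
    rw [show (2 : ℝ≥0∞) = ENNReal.ofReal 2 by simp, ← ENNReal.ofReal_mul (by norm_num),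
      ← ENNReal.ofReal_mul (by positivity), ← ENNReal.ofReal_mul (by positivity)]
    refine ENNReal.ofReal_le_ofReal ?_
    have hθ : 0 ≤ κ * (s * R * κ ^ count true b n) := by positivity
    refine (mul_le_mul_of_nonneg_right (mul_le_mul_of_nonneg_left (exp_le_two_rpow hθ)
      (by norm_num)) (by positivity)).trans ?_
    nth_rw 1 [← Real.rpow_one 2]
    rw [← Real.rpow_add (by norm_num), ← Real.rpow_add (by norm_num),
      ← Real.rpow_add (by norm_num)]
    refine Real.rpow_le_rpow_of_exponent_le (by norm_num) ?_
    refine error_exponent_le (A := A) (a := a) hκ hμ hb le_rfl (by linarith) (by linarith) hA.ge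
      hsR1 n ?_
    have := hKD (s * R) hsR1 n
    linarith
  exact fast_of_powBelow_of_costAbove hκ hκ2 hμ hβ hb p hs0 hs1 (by linarith) hcost le_rfl
    (expect_powBelow_le_growth hκ hκ2 hμ hb p hs0 hs1 le_rfl hB0 herr hR0.le) fun n => (hvX n).2

/-! ### The measure of fair paths and the Markov property -/

/-- The law of a fair bit. -/
noncomputable def fairBit : Measure Bool :=
  (2⁻¹ : ℝ≥0∞) • (Measure.dirac false + Measure.dirac true)

instance : IsProbabilityMeasure fairBit := ⟨by
  simp only [fairBit, Measure.smul_apply, Measure.add_apply, measure_univ, smul_eq_mul]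
  rw [one_add_one_eq_two]
  exact ENNReal.inv_mul_cancel two_ne_zero ENNReal.ofNat_ne_top⟩

/-- The law of a sequence of independent fair bits. -/
noncomputable def fairPath : Measure (ℕ → Bool) := Measure.infinitePi fun _ => fairBit

instance : IsProbabilityMeasure fairPath := by unfold fairPath; infer_instance

/-- The path with first step `x`, continued by `b`. -/
def cons (x : Bool) (b : ℕ → Bool) : ℕ → Bool
  | 0 => x
  | n + 1 => b n

theorem measurable_cons (x : Bool) : Measurable (cons x) := by
  refine measurable_pi_lambda _ fun n => ?_
  cases n with
  | zero => exact measurable_const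
  | succ n => exact measurable_pi_apply n

/-- Splitting off the first bit. Product measures are determined by their values on boxes, where the
factor at coordinate 0 separates and the others shift. -/
theorem fairPath_eq :
    fairPath = (2⁻¹ : ℝ≥0∞) • (fairPath.map (cons false) + fairPath.map (cons true)) := by
  refine (Measure.eq_infinitePi _ fun s t ht => ?_).symm
  have hms : MeasurableSet (Set.pi (s : Set ℕ) t) :=
    MeasurableSet.pi s.countable_toSet fun i _ => ht i
  have key : ∀ x : Bool, fairPath (cons x ⁻¹' Set.pi s t) =
      (if 0 ∈ s then Set.indicator (t 0) 1 x else 1) *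
        ∏ i ∈ s.erase 0, fairBit (t i) := by
    intro x
    set s' : Finset ℕ := (s.erase 0).image Nat.pred with hs'
    have hmem : ∀ i, i ∈ s' ↔ i + 1 ∈ s := by
      intro i
      simp only [hs', Finset.mem_image, Finset.mem_erase]
      constructor
      · rintro ⟨j, ⟨hj, hjs⟩, rfl⟩
        rwa [← Nat.succ_eq_add_one, Nat.succ_pred hj]
      · intro h
        exact ⟨i + 1, ⟨by omega, h⟩, rfl⟩
    have hprod : ∏ i ∈ s.erase 0, fairBit (t i) = ∏ i ∈ s', fairBit (t (i + 1)) := by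
      refine Finset.prod_bij' (fun i _ => i - 1) (fun i _ => i + 1) ?_ ?_ ?_ ?_ ?_
      · intro i hi
        rw [Finset.mem_erase] at hi
        rw [hmem, Nat.sub_add_cancel (by omega)]
        exact hi.2
      · intro i hi
        rw [hmem] at hi
        exact Finset.mem_erase.2 ⟨by omega, hi⟩
      · intro i hi
        rw [Finset.mem_erase] at hi
        omega
      · intro i _
        rfl
      · intro i hi
        rw [Finset.mem_erase] at hi
        rw [Nat.sub_add_cancel (by omega)]
    rw [hprod, ← Measure.infinitePi_pi (fun _ : ℕ => fairBit) (t := fun i => t (i + 1))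
      (fun i _ => ht _)]
    have hpre : ∀ b, b ∈ cons x ⁻¹' Set.pi s t ↔
        (0 ∈ s → x ∈ t 0) ∧ b ∈ Set.pi (s' : Set ℕ) fun i => t (i + 1) := by
      intro b
      simp only [Set.mem_preimage, Set.mem_pi, Finset.mem_coe, hmem]
      constructor
      · intro h
        exact ⟨fun h0 => h 0 h0, fun i hi => h (i + 1) hi⟩
      · rintro ⟨h0, h1⟩ i hi
        cases i with
        | zero => exact h0 hi
        | succ i => exact h1 i hi
    by_cases h0 : 0 ∈ s → x ∈ t 0
    · have e : cons x ⁻¹' Set.pi s t = Set.pi (s' : Set ℕ) fun i => t (i + 1) := by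
        ext b
        rw [hpre]
        exact and_iff_right h0
      have e1 : (if 0 ∈ s then Set.indicator (t 0) (1 : Bool → ℝ≥0∞) x else 1) = 1 := by
        split_ifs with hs
        · simp [h0 hs]
        · rfl
      rw [e, e1, one_mul]
      rfl
    · have e : cons x ⁻¹' Set.pi s t = ∅ := by
        ext b
        rw [hpre]
        simp [h0]
      push Not at h0
      rw [e, if_pos h0.1, Set.indicator_of_notMem h0.2, zero_mul, measure_empty]
  rw [Measure.smul_apply, Measure.add_apply, Measure.map_apply (measurable_cons _) hms,
    Measure.map_apply (measurable_cons _) hms, key, key, smul_eq_mul, ← add_mul, ← mul_assoc]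
  by_cases h0 : 0 ∈ s
  · rw [← Finset.mul_prod_erase s _ h0]
    congr 1
    rw [if_pos h0, if_pos h0, fairBit, Measure.smul_apply, Measure.add_apply, smul_eq_mul,
      Measure.dirac_apply' _ (ht 0), Measure.dirac_apply' _ (ht 0)]
  · rw [Finset.erase_eq_of_notMem h0, if_neg h0, if_neg h0, one_add_one_eq_two,
      ENNReal.inv_mul_cancel two_ne_zero ENNReal.ofNat_ne_top, one_mul]

theorem lintegral_fairPath_cons {f : (ℕ → Bool) → ℝ≥0∞} (hf : Measurable f) :
    ∫⁻ b, f b ∂fairPath =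
      2⁻¹ * (∫⁻ b, f (cons false b) ∂fairPath + ∫⁻ b, f (cons true b) ∂fairPath) := by
  conv_lhs => rw [fairPath_eq]
  rw [lintegral_smul_measure, lintegral_add_measure, lintegral_map hf (measurable_cons _),
    lintegral_map hf (measurable_cons _), smul_eq_mul]

theorem firstSteps_cons (x : Bool) (b : ℕ → Bool) (n : ℕ) :
    firstSteps (cons x b) (n + 1) = firstSteps b n ++ [x] := by
  induction n with
  | zero => rfl
  | succ n ih =>
    rw [firstSteps, ih, firstSteps]
    rfl

theorem measurable_firstSteps {α : Type*} [MeasurableSpace α] (H : List Bool → α) (n : ℕ) :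
    Measurable fun b => H (firstSteps b n) := by
  induction n generalizing H with
  | zero => exact (measurable_const : Measurable fun _ : ℕ → Bool => H [])
  | succ n ih =>
    have hs : MeasurableSet ((fun b : ℕ → Bool => b n) ⁻¹' {true}) :=
      measurable_pi_apply n (measurableSet_singleton true)
    have e : (fun b => H (firstSteps b (n + 1))) = fun b : ℕ → Bool =>
        if b n = true then H (true :: firstSteps b n) else H (false :: firstSteps b n) := by
      funext b
      rw [firstSteps]
      cases b n <;> rfl
    rw [e]
    exact Measurable.ite hs (ih fun l => H (true :: l))
      (ih fun l => H (false :: l))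

theorem measurableSet_firstSteps (S : List Bool → Prop) (n : ℕ) :
    MeasurableSet {b | S (firstSteps b n)} :=
  measurableSet_setOfPred.2 (measurable_firstSteps S n)

/-- The last step is fair given the previous ones. Self-similarity of the measure concerns the first
step, so the induction peels steps off at the start of the path. -/
theorem lintegral_firstSteps_succ (H : List Bool → ℝ≥0∞) (n : ℕ) :
    ∫⁻ b, H (firstSteps b (n + 1)) ∂fairPath =
      ∫⁻ b, 2⁻¹ * (H (false :: firstSteps b n) + H (true :: firstSteps b n)) ∂fairPath := by
  have hm : ∀ (H : List Bool → ℝ≥0∞) (n : ℕ), Measurable fun b => H (firstSteps b n) :=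
    fun H n => measurable_firstSteps H n
  have hsplit : ∀ (H : List Bool → ℝ≥0∞) (n : ℕ),
      ∫⁻ b, 2⁻¹ * (H (false :: firstSteps b n) + H (true :: firstSteps b n)) ∂fairPath =
        2⁻¹ * (∫⁻ b, H (false :: firstSteps b n) ∂fairPath +
          ∫⁻ b, H (true :: firstSteps b n) ∂fairPath) := by
    intro H n
    rw [lintegral_const_mul _ (hm (fun l => H (false :: l) + H (true :: l)) n),
      lintegral_add_left (hm (fun l => H (false :: l)) n)]
  rw [hsplit]
  induction n generalizing H with
  | zero =>
    rw [lintegral_fairPath_cons (hm H _)]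
    rfl
  | succ n ih =>
    rw [lintegral_fairPath_cons (hm H _), lintegral_fairPath_cons (hm (fun l => H (false :: l)) _),
      lintegral_fairPath_cons (hm (fun l => H (true :: l)) _)]
    have e : ∀ x, ∫⁻ b, H (firstSteps (cons x b) (n + 1 + 1)) ∂fairPath =
        2⁻¹ * (∫⁻ b, H (false :: firstSteps b n ++ [x]) ∂fairPath +
          ∫⁻ b, H (true :: firstSteps b n ++ [x]) ∂fairPath) := by
      intro x
      rw [← ih fun l => H (l ++ [x])]
      simp_rw [firstSteps_cons]
    rw [e, e]
    simp_rw [firstSteps_cons, List.cons_append]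
    ring

/-- The path whose first steps are the word `w` (the head of `w` last), continued by `b`. -/
def app : List Bool → (ℕ → Bool) → ℕ → Bool
  | [], b => b
  | x :: l, b => app l (cons x b)

theorem measurable_app (w : List Bool) : Measurable (app w) := by
  induction w with
  | nil => exact measurable_id
  | cons x l ih => exact ih.comp (measurable_cons x)

theorem firstSteps_app (w : List Bool) (b : ℕ → Bool) (n : ℕ) :
    firstSteps (app w b) (n + w.length) = firstSteps b n ++ w := by
  induction w generalizing b n with
  | nil => simp [app]
  | cons x l ih =>
    rw [app, List.length_cons, ← add_assoc, add_right_comm, ih, firstSteps_cons]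
    simp

theorem length_firstSteps (b : ℕ → Bool) (n : ℕ) : (firstSteps b n).length = n := by
  induction n with
  | zero => rfl
  | succ n ih => rw [firstSteps, List.length_cons, ih]

theorem lintegral_fairPath_app {f : (ℕ → Bool) → ℝ≥0∞} (hf : Measurable f) (n : ℕ) :
    ∫⁻ b, f b ∂fairPath = ∫⁻ b, ∫⁻ b', f (app (firstSteps b n) b') ∂fairPath ∂fairPath := by
  induction n with
  | zero => simp [firstSteps, app]
  | succ n ih =>
    rw [ih, lintegral_firstSteps_succ fun w => ∫⁻ b', f (app w b') ∂fairPath]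
    refine lintegral_congr fun b => ?_
    exact lintegral_fairPath_cons (hf.comp (measurable_app _))

/-! ### Lévy's zero-one law for paths -/

/-- The σ-algebras generated by the first steps. -/
def stepFiltration : Filtration ℕ (inferInstance : MeasurableSpace (ℕ → Bool)) where
  seq n := MeasurableSpace.comap (fun b => firstSteps b n) ⊤
  mono' := by
    refine monotone_nat_of_le_succ fun n => ?_
    rintro s ⟨T, -, rfl⟩
    refine ⟨List.tail ⁻¹' T, trivial, ?_⟩
    ext b
    simp [firstSteps]
  le' n := by
    rintro s ⟨T, -, rfl⟩
    exact measurableSet_firstSteps (· ∈ T) n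

theorem le_iSup_stepFiltration :
    (inferInstance : MeasurableSpace (ℕ → Bool)) ≤ ⨆ n, stepFiltration n := by
  refine iSup_le fun i => ?_
  refine le_trans ?_ (le_iSup _ (i + 1))
  rintro s ⟨T, -, rfl⟩
  refine ⟨{l | l.headI ∈ T}, trivial, ?_⟩
  ext b
  simp [firstSteps]

/-- By the Markov property the conditional probability of `E` is the mass of the continuations that
land in `E`. -/
theorem condExp_indicator_ae_eq {E : Set (ℕ → Bool)} (hE : MeasurableSet E) (n : ℕ) :
    (fun b => (fairPath (app (firstSteps b n) ⁻¹' E)).toReal) =ᵐ[fairPath]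
      fairPath[E.indicator fun _ => (1 : ℝ) | stepFiltration n] := by
  have hint : Integrable (fun b => (fairPath (app (firstSteps b n) ⁻¹' E)).toReal) fairPath := by
    refine Integrable.of_bound (measurable_firstSteps
      (fun w => (fairPath (app w ⁻¹' E)).toReal) n).aestronglyMeasurable 1 (ae_of_all _ fun b => ?_)
    rw [Real.norm_of_nonneg ENNReal.toReal_nonneg]
    exact measureReal_le_one
  refine ae_eq_condExp_of_forall_setIntegral_eq (stepFiltration.le n)
    ((integrable_const 1).indicator hE) (fun s _ _ => hint.integrableOn) ?_ ?_
  · rintro s ⟨T, -, rfl⟩ -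
    have hs : MeasurableSet ((fun b => firstSteps b n) ⁻¹' T) := measurableSet_firstSteps (· ∈ T) n
    rw [setIntegral_indicator hE, setIntegral_const, smul_eq_mul, mul_one,
      integral_toReal
      (measurable_firstSteps (fun w => fairPath (app w ⁻¹' E)) n).aemeasurable
      (ae_of_all _ fun b => measure_lt_top _ _), measureReal_def]
    congr 1
    rw [← lintegral_indicator_one (hs.inter hE), lintegral_fairPath_app
      (measurable_one.indicator (hs.inter hE)) n, ← lintegral_indicator hs]
    refine lintegral_congr fun b => ?_
    have e : ∀ b', firstSteps (app (firstSteps b n) b') n = firstSteps b n := by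
      intro b'
      have h := firstSteps_app (firstSteps b n) b' 0
      rwa [length_firstSteps, zero_add] at h
    by_cases hb : firstSteps b n ∈ T
    · rw [Set.indicator_of_mem (by exact hb), ← lintegral_indicator_one (measurable_app _ hE)]
      refine lintegral_congr fun b' => ?_
      classical
      simp [Set.indicator_apply, e, hb]
    · rw [Set.indicator_of_notMem (by exact hb)]
      simp [e, hb]
  · refine StronglyMeasurable.aestronglyMeasurable (Measurable.stronglyMeasurable ?_)
    intro U _
    exact ⟨{w | (fairPath (app w ⁻¹' E)).toReal ∈ U}, trivial, rfl⟩

/-- Lévy's zero-one law for paths: an event whose conditional probability is infinitely often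
bounded below occurs. -/
theorem ae_mem_of_frequently {E : Set (ℕ → Bool)} (hE : MeasurableSet E) {c : ℝ≥0∞} (hc : c ≠ 0)
    (S : List Bool → Prop) (h : ∀ w, S w → c ≤ fairPath (app w ⁻¹' E)) :
    ∀ᵐ b ∂fairPath, (∃ᶠ n in atTop, S (firstSteps b n)) → b ∈ E := by
  have hlim := Integrable.tendsto_ae_condExp (ℱ := stepFiltration) (μ := fairPath)
    ((integrable_const (1 : ℝ)).indicator hE) (by
      refine Measurable.stronglyMeasurable ?_
      exact (measurable_const.indicator hE).mono le_iSup_stepFiltration le_rfl)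
  filter_upwards [hlim, ae_all_iff.2 fun n => condExp_indicator_ae_eq hE n] with b hb hb' hS
  by_contra hbE
  rw [Set.indicator_of_notMem hbE] at hb
  -- If `c > 1`, then no word satisfies `S`, as probabilities are at most 1.
  by_cases hc1 : c ≤ 1
  · have hc0 : 0 < c.toReal := ENNReal.toReal_pos hc (ne_top_of_le_ne_top ENNReal.one_ne_top hc1)
    obtain ⟨n, hn, hn'⟩ := (hS.and_eventually (hb.eventually_lt_const hc0)).exists
    rw [← hb' n] at hn'
    exact absurd (ENNReal.toReal_mono (measure_ne_top _ _) (h _ hn)) (not_le.2 hn')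
  · obtain ⟨n, hn⟩ := hS.exists
    exact hc1 ((h _ hn).trans prob_le_one)

theorem lawSeq_app (p : Law) (w : List Bool) (b : ℕ → Bool) (n : ℕ) :
    lawSeq p (app w b) (n + w.length) = lawSeq (lawAt p w) b n := by
  rw [lawSeq, firstSteps_app, lawAt_append, lawSeq]

theorem measurableSet_lawSeq (p : Law) (Q : Law → Prop) (n : ℕ) :
    MeasurableSet {b | Q (lawSeq p b n)} :=
  measurableSet_firstSteps (fun w => Q (lawAt p w)) n

/-- If every law in a class reaches a second class with probability bounded below, then paths
that visit the first class infinitely often visit the second one infinitely often. -/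
theorem ae_frequently_of_frequently {Q R : Law → Prop} {c : ℝ≥0∞} (hc : c ≠ 0)
    (h : ∀ q, Q q → c ≤ fairPath {b | ∃ n, R (lawSeq q b n)}) (p : Law) :
    ∀ᵐ b ∂fairPath, (∃ᶠ n in atTop, Q (lawSeq p b n)) → ∃ᶠ n in atTop, R (lawSeq p b n) := by
  -- The length condition makes the visit happen after time `m`; intersecting over `m` gives
  -- infinitely many visits.
  have key : ∀ m : ℕ, ∀ᵐ b ∂fairPath, (∃ᶠ n in atTop, Q (lawAt p (firstSteps b n)) ∧
      m ≤ (firstSteps b n).length) → b ∈ {b | ∃ n ≥ m, R (lawSeq p b n)} := by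
    intro m
    refine ae_mem_of_frequently ?_ hc (fun w => Q (lawAt p w) ∧ m ≤ w.length) ?_
    · have e : {b | ∃ n ≥ m, R (lawSeq p b n)} = ⋃ n ≥ m, {b | R (lawSeq p b n)} := by
        ext b
        simp
      rw [e]
      exact MeasurableSet.iUnion fun n => MeasurableSet.iUnion fun _ => measurableSet_lawSeq p R n
    · rintro w ⟨hw, hm⟩
      refine (h _ hw).trans (measure_mono ?_)
      rintro b ⟨n, hn⟩
      exact ⟨n + w.length, by omega, by rwa [lawSeq_app]⟩
  filter_upwards [ae_all_iff.2 key] with b hb hQ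
  rw [frequently_atTop]
  intro m
  obtain ⟨n, hn, hR⟩ := hb m (by
    refine (hQ.and_eventually (eventually_ge_atTop m)).mono fun n hn => ?_
    rw [length_firstSteps]
    exact hn)
  exact ⟨n, hn, hR⟩

/-- `Fast` quantifies over all shifts `m`, so it is inherited from a continuation of the path: the
prefix length is added to the shift. -/
theorem ae_fast_of_frequently {Q : Law → Prop} {c : ℝ≥0∞} (hc : c ≠ 0) {β : ℝ}
    {φ : Law → ℝ≥0∞} (h : ∀ q, Q q → c ≤ fairPath {b | Fast β fun n => φ (lawSeq q b n)})
    (p : Law) :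
    ∀ᵐ b ∂fairPath, (∃ᶠ n in atTop, Q (lawSeq p b n)) → Fast β fun n => φ (lawSeq p b n) := by
  refine ae_mem_of_frequently (E := {b | Fast β fun n => φ (lawSeq p b n)}) ?_ hc
    (fun w => Q (lawAt p w)) ?_
  · have e : {b | Fast β fun n => φ (lawSeq p b n)} = ⋂ m : ℕ, ⋃ N : ℕ, ⋂ n ≥ N,
        {b | φ (lawSeq p b n) ≤ ENNReal.ofReal (2 ^ (-(2 : ℝ) ^ (β * (n + m : ℕ))))} := by
      ext b
      simp [Fast, eventually_atTop]
    rw [e]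
    refine MeasurableSet.iInter fun m => MeasurableSet.iUnion fun N => MeasurableSet.iInter fun n =>
      MeasurableSet.iInter fun _ => ?_
    exact measurableSet_lawSeq p (fun q => φ q ≤ _) n
  · intro w hw
    refine (h _ hw).trans (measure_mono ?_)
    intro b hb m
    have hb' := hb (w.length + m)
    rw [← map_add_atTop_eq_nat w.length, eventually_map]
    filter_upwards [hb'] with n hn
    rw [lawSeq_app, add_assoc]
    exact hn

/-! ### Independent fair bits and the law of large numbers -/

theorem map_eq_fairPath {Ω : Type*} [MeasurableSpace Ω] {P : Measure Ω} [IsProbabilityMeasure P]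
    {B : ℕ → Ω → Bool} (hB_meas : ∀ n, Measurable (B n)) (hB_indep : iIndepFun B P)
    (hB_unif : ∀ n, P {ω | B n ω = true} = 1 / 2) :
    P.map (fun ω n => B n ω) = fairPath := by
  rw [(iIndepFun_iff_map_fun_eq_infinitePi_map hB_meas).1 hB_indep, fairPath]
  congr 1
  funext n
  have h1 : P.map (B n) {true} = 2⁻¹ := by
    rw [Measure.map_apply (hB_meas n) (measurableSet_singleton _), ← one_div, ← hB_unif n]
    rfl
  have : IsProbabilityMeasure (P.map (B n)) :=
    Measure.isProbabilityMeasure_map (hB_meas n).aemeasurable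
  have h2 : P.map (B n) {false} = 2⁻¹ := by
    have e : ({false} : Set Bool) = {true}ᶜ := by
      ext x
      cases x <;> simp
    rw [e, prob_compl_eq_one_sub (measurableSet_singleton _), h1, ENNReal.one_sub_inv_two]
  refine Measure.ext_of_singleton fun x => ?_
  cases x
  · rw [h2]
    simp [fairBit]
  · rw [h1]
    simp [fairBit]

theorem count_eq_sum (t : Bool) (b : ℕ → Bool) (n : ℕ) :
    (count t b n : ℝ) = ∑ i ∈ Finset.range n, if b i = t then (1 : ℝ) else 0 := by
  induction n with
  | zero => simp [count]
  | succ n ih =>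
    rw [count, Finset.sum_range_succ, ← ih]
    push_cast
    rfl

theorem ae_tendsto_count (t : Bool) :
    ∀ᵐ b ∂fairPath, Tendsto (fun n : ℕ => (count t b n : ℝ) / n) atTop (𝓝 (1 / 2)) := by
  set f : Bool → ℝ := fun x => if x = t then 1 else 0 with hf
  have hfm : Measurable f := measurable_of_countable f
  have hint : ∀ i, IdentDistrib (fun b : ℕ → Bool => f (b i)) f fairPath fairBit := fun i =>
    { aemeasurable_fst := (hfm.comp (measurable_pi_apply i)).aemeasurable
      aemeasurable_snd := hfm.aemeasurable
      map_eq := by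
        rw [← (measurePreserving_eval_infinitePi (fun _ : ℕ => fairBit) i).map_eq,
          Measure.map_map hfm (measurable_pi_apply i)]
        rfl }
  have hmean : ∫ b : ℕ → Bool, f (b 0) ∂fairPath = 1 / 2 := by
    rw [(hint 0).integral_eq, fairBit, integral_smul_measure, integral_add_measure
      (integrable_dirac (by simp)) (integrable_dirac (by simp))]
    cases t <;> simp [hf]
  have h := strong_law_ae_real (μ := fairPath) (fun i b => f (b i)) ?_ ?_ ?_
  · rw [hmean] at h
    filter_upwards [h] with b hb
    refine hb.congr fun n => ?_
    rw [count_eq_sum]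
  · refine Integrable.of_bound (hfm.comp (measurable_pi_apply 0)).aestronglyMeasurable 1
      (ae_of_all _ fun b => ?_)
    simp only [hf]
    split_ifs <;> simp
  · intro i j hij
    exact (iIndepFun_infinitePi (P := fun _ : ℕ => fairBit) (X := fun _ => f)
      fun _ => hfm).indepFun hij
  · exact fun i => (hint i).trans (hint 0).symm

/-- By the strong law almost every path is balanced for some `c`; these sets increase with `c`, so a
single `c` serves with probability at least 1/2. -/
theorem exists_balanced {μ : ℝ} (hμ : μ < 1 / 2) :
    ∃ c : ℝ, 2⁻¹ ≤ fairPath (balanced μ c) := by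
  have hae : ∀ᵐ b ∂fairPath, b ∈ ⋃ c : ℕ, balanced μ c := by
    filter_upwards [ae_tendsto_count false, ae_tendsto_count true] with b h0 h1
    have key : ∀ t, ∃ c : ℝ, ∀ n : ℕ, μ * n - c ≤ count t b n := by
      intro t
      have ht : Tendsto (fun n : ℕ => (count t b n : ℝ) / n) atTop (𝓝 (1 / 2)) := by
        cases t
        · exact h0
        · exact h1
      obtain ⟨N, hN⟩ := eventually_atTop.1 (ht.eventually_const_lt hμ)
      -- The constant covers the times before the frequency settles above `μ`.
      refine ⟨|μ| * N, fun n => ?_⟩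
      have hc : (0 : ℝ) ≤ count t b n := Nat.cast_nonneg _
      rcases le_or_gt N n with h | h
      · rcases Nat.eq_zero_or_pos n with rfl | hn
        · have : 0 ≤ |μ| * N := by positivity
          simp only [Nat.cast_zero, mul_zero]
          linarith
        · have hn' : (0 : ℝ) < n := by exact_mod_cast hn
          have h2 := (lt_div_iff₀ hn').1 (hN n h)
          have : 0 ≤ |μ| * N := by positivity
          linarith
      · have h3 : μ * n ≤ |μ| * N :=
          mul_le_mul (le_abs_self μ) (by exact_mod_cast h.le) (by positivity) (abs_nonneg μ)
        linarith
    obtain ⟨c0, h0⟩ := key false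
    obtain ⟨c1, h1⟩ := key true
    obtain ⟨c, hc⟩ := exists_nat_ge (max c0 c1)
    refine Set.mem_iUnion.2 ⟨c, fun t n => ?_⟩
    have hc0 := (le_max_left c0 c1).trans hc
    have hc1 := (le_max_right c0 c1).trans hc
    cases t
    · linarith [h0 n]
    · linarith [h1 n]
  have hmono : Monotone fun c : ℕ => balanced μ c := by
    intro c d hcd b hb t n
    have := hb t n
    have h2 : (c : ℝ) ≤ d := by exact_mod_cast hcd
    linarith
  have hlim := tendsto_measure_iUnion_atTop (μ := fairPath) hmono
  have hone : fairPath (⋃ c : ℕ, balanced μ c) = 1 :=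
    (measure_congr (eventuallyEq_univ.2 hae)).trans measure_univ
  rw [hone] at hlim
  obtain ⟨c, hc⟩ := (hlim.eventually_const_lt (by simp : (2⁻¹ : ℝ≥0∞) < 1)).exists
  exact ⟨c, hc.le⟩

/-! ### Exponentially fast polarization of erasure channels -/

/-- The average of `H` over the words of length `n`. -/
noncomputable def avg : ℕ → (List Bool → ℝ) → ℝ
  | 0, H => H []
  | n + 1, H => avg n fun l => (H (false :: l) + H (true :: l)) / 2

theorem avg_mono {n : ℕ} {H H' : List Bool → ℝ} (h : ∀ l, l.length = n → H l ≤ H' l) :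
    avg n H ≤ avg n H' := by
  induction n generalizing H H' with
  | zero => exact h [] rfl
  | succ n ih =>
    refine ih fun l hl => ?_
    have h1 := h (false :: l) (by simp [hl])
    have h2 := h (true :: l) (by simp [hl])
    linarith

theorem avg_const (n : ℕ) (c : ℝ) : avg n (fun _ => c) = c := by
  induction n with
  | zero => rfl
  | succ n ih => simpa [avg] using ih

theorem avg_add (n : ℕ) (H H' : List Bool → ℝ) :
    avg n (fun l => H l + H' l) = avg n H + avg n H' := by
  induction n generalizing H H' with
  | zero => rfl
  | succ n ih =>
    rw [avg, avg, avg, ← ih]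
    congr 1
    funext l
    ring

theorem avg_mul_left (n : ℕ) (c : ℝ) (H : List Bool → ℝ) :
    avg n (fun l => c * H l) = c * avg n H := by
  induction n generalizing H with
  | zero => rfl
  | succ n ih =>
    rw [avg, avg, ← ih]
    congr 1
    funext l
    ring

theorem avg_nonneg {n : ℕ} {H : List Bool → ℝ} (h : ∀ l, 0 ≤ H l) : 0 ≤ avg n H :=
  (avg_const n 0).ge.trans (avg_mono fun l _ => h l)

theorem avg_append (m k : ℕ) (H : List Bool → ℝ) :
    avg (m + k) H = avg k fun w => avg m fun l => H (l ++ w) := by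
  induction m generalizing H with
  | zero => simp [avg]
  | succ m ih =>
    rw [show m + 1 + k = m + k + 1 by ring, avg, ih]
    rfl

theorem lintegral_firstSteps (n : ℕ) (H : List Bool → ℝ) (hH : ∀ l, 0 ≤ H l) :
    ∫⁻ b, ENNReal.ofReal (H (firstSteps b n)) ∂fairPath = ENNReal.ofReal (avg n H) := by
  induction n generalizing H with
  | zero => simp [avg, firstSteps]
  | succ n ih =>
    rw [lintegral_firstSteps_succ fun l => ENNReal.ofReal (H l), avg,
      ← ih _ fun l => by have := hH (false :: l); have := hH (true :: l); positivity]
    refine lintegral_congr fun b => ?_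
    rw [← ENNReal.ofReal_add (hH _) (hH _), div_eq_inv_mul, ENNReal.ofReal_mul (by norm_num),
      ENNReal.ofReal_inv_of_pos (by norm_num)]
    norm_num

theorem fairPath_real_firstSteps (n : ℕ) (S : List Bool → Prop) [DecidablePred S] :
    fairPath.real {b | S (firstSteps b n)} = avg n fun l => if S l then 1 else 0 := by
  have hn : ∀ l, (0 : ℝ) ≤ if S l then 1 else 0 := fun l => by split_ifs <;> norm_num
  rw [measureReal_def, ← lintegral_indicator_one (measurableSet_firstSteps S n),
    ← ENNReal.toReal_ofReal (avg_nonneg hn), ← lintegral_firstSteps n _ hn]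
  congr 1
  refine lintegral_congr fun b => ?_
  by_cases h : S (firstSteps b n) <;> simp [h]

theorem drop_firstSteps (b : ℕ → Bool) (m k : ℕ) :
    (firstSteps b (m + k)).drop m = firstSteps b k := by
  induction m with
  | zero => simp
  | succ m ih => rw [show m + 1 + k = m + k + 1 by ring, firstSteps, List.drop_succ_cons, ih]

/-- The erasure probability of the channel synthesized from an erasure channel. -/
noncomputable def erasure (e : ℝ) : List Bool → ℝ
  | [] => e
  | false :: l => 1 - (1 - erasure e l) ^ 2
  | true :: l => erasure e l ^ 2

theorem erasure_append (e : ℝ) (l w : List Bool) :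
    erasure e (l ++ w) = erasure (erasure e w) l := by
  induction l with
  | nil => rfl
  | cons t l ih => cases t <;> simp [erasure, ih]

theorem erasure_mem {e : ℝ} (he : e ∈ Set.Icc (0 : ℝ) 1) (l : List Bool) :
    erasure e l ∈ Set.Icc (0 : ℝ) 1 := by
  induction l with
  | nil => exact he
  | cons t l ih =>
    obtain ⟨h0, h1⟩ := ih
    cases t <;> simp only [erasure, Set.mem_Icc] <;> constructor <;> nlinarith

theorem avg_erasure (n : ℕ) (e : ℝ) : avg n (erasure e) = e := by
  induction n with
  | zero => rfl
  | succ n ih =>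
    rw [avg]
    nth_rw 3 [← ih]
    congr 1
    funext l
    simp only [erasure]
    ring

/-- A potential for the speed of polarization of erasure channels. -/
noncomputable def spread (f : ℝ) : ℝ := √(f * (1 - f))

/-- After division by `spread f` the sum is `√(f(1+f)) + √((1-f)(2-f))`, at most `√3 < 7/4`. -/
theorem spread_add_le {f : ℝ} (h0 : 0 ≤ f) (h1 : f ≤ 1) :
    spread (1 - (1 - f) ^ 2) + spread (f ^ 2) ≤ 7 / 4 * spread f := by
  -- AM-GM with weights satisfying `4 · (7/8) · (2/7) = 1`; summed over `f` and `1 - f` it gives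
  -- `7/8 + 6/7 ≤ 7/4`.
  have key : ∀ g : ℝ, 0 ≤ g → √(g * (1 + g)) ≤ 7 / 8 * g + 2 / 7 * (1 + g) := by
    intro g hg
    refine Real.sqrt_le_iff.2 ⟨by positivity, ?_⟩
    nlinarith [sq_nonneg (7 / 8 * g - 2 / 7 * (1 + g))]
  have h2 : 0 ≤ f * (1 - f) := mul_nonneg h0 (by linarith)
  have e1 : spread (1 - (1 - f) ^ 2) = √(f * (1 - f)) * √((1 - f) * (1 + (1 - f))) := by
    rw [spread, ← Real.sqrt_mul h2]
    congr 1
    ring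
  have e2 : spread (f ^ 2) = √(f * (1 - f)) * √(f * (1 + f)) := by
    rw [spread, ← Real.sqrt_mul h2]
    congr 1
    ring
  rw [e1, e2, ← mul_add, spread, mul_comm]
  refine mul_le_mul_of_nonneg_right ?_ (Real.sqrt_nonneg _)
  linarith [key f h0, key (1 - f) (by linarith)]

theorem spread_le (f : ℝ) : spread f ≤ 1 / 2 :=
  Real.sqrt_le_iff.2 ⟨by norm_num, by nlinarith [sq_nonneg (f - 1 / 2)]⟩

theorem avg_spread_le (n : ℕ) {e : ℝ} (he : e ∈ Set.Icc (0 : ℝ) 1) :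
    avg n (fun l => spread (erasure e l)) ≤ (7 / 8) ^ n / 2 := by
  induction n with
  | zero => simpa [avg] using spread_le _
  | succ n ih =>
    rw [avg, pow_succ]
    have : avg n (fun l => (spread (erasure e (false :: l)) + spread (erasure e (true :: l))) / 2) ≤
        avg n fun l => 7 / 8 * spread (erasure e l) := by
      refine avg_mono fun l _ => ?_
      obtain ⟨h0, h1⟩ := erasure_mem he l
      have := spread_add_le h0 h1
      simp only [erasure]
      linarith
    rw [avg_mul_left] at this
    linarith

theorem le_spread_div {f η : ℝ} (h1 : f ≤ 1) (hη : 0 < η) (h : η ≤ f) :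
    1 - f ≤ spread f / η := by
  rw [le_div_iff₀ hη]
  refine Real.le_sqrt_of_sq_le ?_
  have h2 : 0 ≤ 1 - f := by linarith
  have h3 : η ^ 2 ≤ f := by nlinarith
  nlinarith [mul_nonneg h2 hη.le, mul_nonneg h2 h2]

theorem le_spread_div' {f η : ℝ} (h0 : 0 ≤ f) (hη : 0 < η) (h : η ≤ 1 - f) :
    f ≤ spread f / η := by
  have := le_spread_div (f := 1 - f) (by linarith) hη h
  rw [sub_sub_cancel] at this
  refine this.trans_eq ?_
  rw [spread, spread, sub_sub_cancel, mul_comm]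

section Resolution

variable {e : ℝ} (he : e ∈ Set.Icc (0 : ℝ) 1)
include he

/-- The indicator of `1/2 ≤ f` differs from `f` by at most `√(f(1-f))`, and the erasure probability
is a martingale. -/
theorem fairPath_half_le_erasure (n : ℕ) :
    e - (7 / 8) ^ n / 2 ≤ fairPath.real {b | 1 / 2 ≤ erasure e (firstSteps b n)} := by
  rw [fairPath_real_firstSteps n fun l => 1 / 2 ≤ erasure e l]
  have h1 : avg n (erasure e) ≤ avg n (fun l => (if 1 / 2 ≤ erasure e l then 1 else 0) +
      spread (erasure e l)) := by
    refine avg_mono fun l _ => ?_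
    obtain ⟨h0, h1⟩ := erasure_mem he l
    split_ifs with h
    · have : 0 ≤ spread (erasure e l) := Real.sqrt_nonneg _
      linarith
    · rw [zero_add]
      exact Real.le_sqrt_of_sq_le (by nlinarith)
  rw [avg_erasure, avg_add] at h1
  linarith [avg_spread_le n he]

theorem fairPath_half_le_erasure_le (n : ℕ) :
    fairPath.real {b | 1 / 2 ≤ erasure e (firstSteps b n)} ≤ e + (7 / 8) ^ n / 2 := by
  rw [fairPath_real_firstSteps n fun l => 1 / 2 ≤ erasure e l]
  have h1 : avg n (fun l => if 1 / 2 ≤ erasure e l then (1 : ℝ) else 0) ≤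
      avg n fun l => erasure e l + spread (erasure e l) := by
    refine avg_mono fun l _ => ?_
    obtain ⟨h0, h1⟩ := erasure_mem he l
    split_ifs with h
    · have : 1 - erasure e l ≤ spread (erasure e l) := Real.le_sqrt_of_sq_le (by nlinarith)
      linarith
    · have : 0 ≤ spread (erasure e l) := Real.sqrt_nonneg _
      linarith
  rw [avg_add] at h1
  have h2 := avg_erasure n e
  linarith [avg_spread_le n he]

/-- Given the word at time `k`, the martingale property and Markov's inequality bound the
probability of falling below 1/2 by `2(1-f)`, and `1 - f ≤ spread f / η` when `f > η`. -/
theorem fairPath_erasure_lt_half_le {η : ℝ} (hη : 0 < η) {k n : ℕ} (hkn : k ≤ n) :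
    fairPath.real {b | erasure e (firstSteps b n) < 1 / 2 ∧ η < erasure e (firstSteps b k)} ≤
      (7 / 8) ^ k / η := by
  obtain ⟨m, rfl⟩ := Nat.exists_eq_add_of_le' hkn
  simp_rw [← drop_firstSteps _ m k]
  rw [fairPath_real_firstSteps (m + k) fun l => erasure e l < 1 / 2 ∧ η < erasure e (l.drop m),
    avg_append]
  have h1 : avg k (fun w => avg m fun l =>
      if erasure e (l ++ w) < 1 / 2 ∧ η < erasure e ((l ++ w).drop m) then (1 : ℝ) else 0) ≤
      avg k fun w => 2 / η * spread (erasure e w) := by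
    refine avg_mono fun w _ => ?_
    obtain ⟨h0, h1⟩ := erasure_mem he w
    have hs : 0 ≤ spread (erasure e w) := Real.sqrt_nonneg _
    by_cases hw : η < erasure e w
    · have h2 : avg m (fun l =>
          if erasure e (l ++ w) < 1 / 2 ∧ η < erasure e ((l ++ w).drop m) then (1 : ℝ) else 0) ≤
          avg m fun l => 2 + (-2) * erasure (erasure e w) l := by
        refine avg_mono fun l _ => ?_
        obtain ⟨h3, h4⟩ := erasure_mem (erasure_mem he w) l
        rw [erasure_append]
        split_ifs with h
        · linarith [h.1]
        · linarith
      rw [avg_add, avg_const, avg_mul_left, avg_erasure] at h2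
      have h3 := le_spread_div h1 hη hw.le
      rw [div_mul_eq_mul_div, mul_div_assoc]
      linarith
    · refine le_trans (b := avg m fun _ => 0) (avg_mono fun l hl => ?_) ?_
      · rw [if_neg]
        rintro ⟨-, h⟩
        rw [← hl, List.drop_left] at h
        exact hw h
      · rw [avg_const]
        positivity
  refine h1.trans ?_
  rw [avg_mul_left]
  refine (mul_le_mul_of_nonneg_left (avg_spread_le k he) (by positivity)).trans_eq ?_
  ring

theorem fairPath_half_le_erasure_of_lt_le {η : ℝ} (hη : 0 < η) {k n : ℕ} (hkn : k ≤ n) :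
    fairPath.real {b | 1 / 2 ≤ erasure e (firstSteps b n) ∧
      erasure e (firstSteps b k) < 1 - η} ≤ (7 / 8) ^ k / η := by
  obtain ⟨m, rfl⟩ := Nat.exists_eq_add_of_le' hkn
  simp_rw [← drop_firstSteps _ m k]
  rw [fairPath_real_firstSteps (m + k) fun l =>
    1 / 2 ≤ erasure e l ∧ erasure e (l.drop m) < 1 - η, avg_append]
  have h1 : avg k (fun w => avg m fun l =>
      if 1 / 2 ≤ erasure e (l ++ w) ∧ erasure e ((l ++ w).drop m) < 1 - η then (1 : ℝ) else 0) ≤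
      avg k fun w => 2 / η * spread (erasure e w) := by
    refine avg_mono fun w _ => ?_
    obtain ⟨h0, h1⟩ := erasure_mem he w
    have hs : 0 ≤ spread (erasure e w) := Real.sqrt_nonneg _
    by_cases hw : erasure e w < 1 - η
    · have h2 : avg m (fun l =>
          if 1 / 2 ≤ erasure e (l ++ w) ∧ erasure e ((l ++ w).drop m) < 1 - η
            then (1 : ℝ) else 0) ≤ avg m fun l => 2 * erasure (erasure e w) l := by
        refine avg_mono fun l _ => ?_
        obtain ⟨h3, h4⟩ := erasure_mem (erasure_mem he w) l
        rw [erasure_append]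
        split_ifs with h
        · linarith [h.1]
        · linarith
      rw [avg_mul_left, avg_erasure] at h2
      have h3 := le_spread_div' h0 hη (by linarith)
      rw [div_mul_eq_mul_div, mul_div_assoc]
      linarith
    · refine le_trans (b := avg m fun _ => 0) (avg_mono fun l hl => ?_) ?_
      · rw [if_neg]
        rintro ⟨-, h⟩
        rw [← hl, List.drop_left] at h
        exact hw h
      · rw [avg_const]
        positivity
  refine h1.trans ?_
  rw [avg_mul_left]
  refine (mul_le_mul_of_nonneg_left (avg_spread_le k he) (by positivity)).trans_eq ?_
  ring

end Resolution

/-- Among a chain of erasure probabilities, with large probability two consecutive ones are sent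
to opposite extremes, at a prescribed time. -/
theorem le_fairPath_exists_transition {e : ℕ → ℝ} (he : ∀ j, e j ∈ Set.Icc (0 : ℝ) 1)
    (k : ℕ → ℕ) {η : ℝ} (hη : 0 < η) {M N : ℕ} (hN : ∀ j < M, k j ≤ N) :
    e M - e 0 - (7 / 8) ^ N - ∑ j ∈ Finset.range M, 2 * (7 / 8) ^ k j / η ≤
      fairPath.real {b | ∃ j < M, erasure (e j) (firstSteps b (k j)) ≤ η ∧
        1 - η ≤ erasure (e (j + 1)) (firstSteps b (k j))} := by
  set G := {b | ∃ j < M, erasure (e j) (firstSteps b (k j)) ≤ η ∧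
        1 - η ≤ erasure (e (j + 1)) (firstSteps b (k j))} with hG
  set U : ℕ → Set (ℕ → Bool) := fun j =>
    {b | erasure (e j) (firstSteps b N) < 1 / 2 ∧ η < erasure (e j) (firstSteps b (k j))} ∪
    {b | 1 / 2 ≤ erasure (e (j + 1)) (firstSteps b N) ∧
      erasure (e (j + 1)) (firstSteps b (k j)) < 1 - η} with hU
  have hUle : ∀ j ∈ Finset.range M, fairPath.real (U j) ≤ 2 * (7 / 8) ^ k j / η := by
    intro j hj
    have hjN := hN j (Finset.mem_range.1 hj)
    refine (measureReal_union_le _ _).trans ?_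
    have h1 := fairPath_erasure_lt_half_le (he j) hη hjN
    have h2 := fairPath_half_le_erasure_of_lt_le (he (j + 1)) hη hjN
    have e1 : 2 * (7 / 8 : ℝ) ^ k j / η = (7 / 8) ^ k j / η + (7 / 8) ^ k j / η := by ring
    rw [e1]
    exact add_le_add h1 h2
  -- At the common time `N`, classify each erasure probability by comparison with 1/2. If the first
  -- is low and the last is high, some neighbours switch; unless one of them was still unresolved at
  -- time `k j`, this is a transition.
  have hcover : {b | 1 / 2 ≤ erasure (e M) (firstSteps b N)} ⊆
      ({b | 1 / 2 ≤ erasure (e 0) (firstSteps b N)} ∪ G) ∪ ⋃ j ∈ Finset.range M, U j := by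
    intro b hb
    by_contra hcon
    simp only [Set.mem_union, not_or, Set.mem_iUnion, not_exists] at hcon
    obtain ⟨⟨h0, hGb⟩, hUb⟩ := hcon
    have hall : ∀ j ≤ M, ¬ 1 / 2 ≤ erasure (e j) (firstSteps b N) := by
      intro j
      induction j with
      | zero => exact fun _ => h0
      | succ j ih =>
        intro hj hlt
        have hjM : j < M := by omega
        have h1 := ih hjM.le
        have h2 := hUb j (Finset.mem_range.2 hjM)
        simp only [hU, Set.mem_union, Set.mem_ofPred_eq, not_or, not_and, not_lt] at h2
        exact hGb ⟨j, hjM, h2.1 (not_le.1 h1), h2.2 hlt⟩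
    exact hall M le_rfl hb
  have h1 := measureReal_mono (μ := fairPath) hcover (measure_ne_top _ _)
  have h2 := h1.trans ((measureReal_union_le _ _).trans
    (add_le_add (measureReal_union_le _ _) (measureReal_biUnion_finset_le _ _)))
  have h3 := Finset.sum_le_sum hUle
  have h4 := fairPath_half_le_erasure (he M) N
  have h5 := fairPath_half_le_erasure_le (he 0) N
  linarith

/-! ### Comparison of a law with erasure channels -/

/-- The probability of a set of likelihood ratios. -/
noncomputable def prob (p : Law) (S : Set ℝ≥0) : ℝ := (expect p (S.indicator 1)).toReal

section Prob

variable (p : Law)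

theorem expect_indicator_le_one (S : Set ℝ≥0) : expect p (S.indicator 1) ≤ 1 := by
  refine (expect_mono p fun a => ?_).trans_eq (expect_const p 1)
  exact Set.indicator_le_self S 1 a

theorem expect_indicator_ne_top (S : Set ℝ≥0) : expect p (S.indicator 1) ≠ ⊤ :=
  ne_top_of_le_ne_top ENNReal.one_ne_top (expect_indicator_le_one p S)

theorem ofReal_prob (S : Set ℝ≥0) : ENNReal.ofReal (prob p S) = expect p (S.indicator 1) :=
  ENNReal.ofReal_toReal (expect_indicator_ne_top p S)

theorem prob_mem (S : Set ℝ≥0) : prob p S ∈ Set.Icc (0 : ℝ) 1 :=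
  ⟨ENNReal.toReal_nonneg, ENNReal.toReal_mono ENNReal.one_ne_top (expect_indicator_le_one p S)⟩

theorem prob_mono {S S' : Set ℝ≥0} (h : S ⊆ S') : prob p S ≤ prob p S' :=
  ENNReal.toReal_mono (expect_indicator_ne_top p S') (expect_mono p fun a =>
    Set.indicator_le_indicator_of_subset h (fun _ => zero_le) a)

theorem expect_indicator_add_compl (S : Set ℝ≥0) :
    expect p (S.indicator 1) + expect p (Sᶜ.indicator 1) = 1 := by
  rw [← expect_add]
  refine (congrArg (expect p) (funext fun a => ?_)).trans (expect_const p 1)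
  exact congrFun (Set.indicator_self_add_compl S (1 : ℝ≥0 → ℝ≥0∞)) a

theorem prob_compl (S : Set ℝ≥0) : prob p Sᶜ = 1 - prob p S := by
  have h := congrArg ENNReal.toReal (expect_indicator_add_compl p S)
  rw [ENNReal.toReal_add (expect_indicator_ne_top p S) (expect_indicator_ne_top p Sᶜ),
    ENNReal.toReal_one] at h
  unfold prob
  linarith

theorem prob_union_le (S S' : Set ℝ≥0) : prob p (S ∪ S') ≤ prob p S + prob p S' := by
  unfold prob
  rw [← ENNReal.toReal_add (expect_indicator_ne_top p S) (expect_indicator_ne_top p S'),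
    ← expect_add]
  refine ENNReal.toReal_mono ?_ (expect_mono p fun a => ?_)
  · rw [expect_add]
    exact ENNReal.add_ne_top.2 ⟨expect_indicator_ne_top p S, expect_indicator_ne_top p S'⟩
  · by_cases h : a ∈ S <;> by_cases h' : a ∈ S' <;> simp [h, h']

/-- The square recursion of an erasure probability, perturbed by an exceptional set `R`. -/
theorem prob_step_le_of_and {t : Bool} {U S R : Set ℝ≥0}
    (h : ∀ a b, combine t a b ∈ U → (a ∈ S ∧ b ∈ S) ∨ a ∈ R ∨ b ∈ R) :
    prob (step t p) U ≤ prob p S ^ 2 + 2 * prob p R := by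
  have key : expect (step t p) (U.indicator 1) ≤
      expect p (S.indicator 1) ^ 2 + 2 * expect p (R.indicator 1) := by
    rw [expect_step]
    have h' : ∀ a b, U.indicator (1 : ℝ≥0 → ℝ≥0∞) (combine t a b) ≤
        S.indicator 1 a * S.indicator 1 b + (R.indicator 1 a + R.indicator 1 b) := by
      intro a b
      by_cases hU : combine t a b ∈ U
      · rw [Set.indicator_of_mem hU]
        rcases h a b hU with ⟨ha, hb⟩ | ha | hb
        · simp [ha, hb]
        · simp [ha, add_comm (1 : ℝ≥0∞), ← add_assoc]
        · simp [hb, ← add_assoc]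
      · rw [Set.indicator_of_notMem hU]
        exact zero_le
    refine (expect_mono _ fun a => expect_mono _ fun b => h' a b).trans (le_of_eq ?_)
    simp_rw [expect_add, expect_const, expect_mul_mul]
    ring
  have := ENNReal.toReal_mono (ENNReal.add_ne_top.2 ⟨ENNReal.pow_ne_top
    (expect_indicator_ne_top p S), ENNReal.mul_ne_top ENNReal.ofNat_ne_top
    (expect_indicator_ne_top p R)⟩) key
  rw [ENNReal.toReal_add (ENNReal.pow_ne_top (expect_indicator_ne_top p S))
    (ENNReal.mul_ne_top ENNReal.ofNat_ne_top (expect_indicator_ne_top p R)), ENNReal.toReal_pow,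
    ENNReal.toReal_mul] at this
  simpa [prob] using this

theorem prob_step_le_of_or {t : Bool} {U S : Set ℝ≥0}
    (h : ∀ a b, combine t a b ∈ U → a ∈ S ∨ b ∈ S) :
    prob (step t p) U ≤ 1 - (1 - prob p S) ^ 2 := by
  have key : expect (step t p) (U.indicator 1) ≤
      expect p (S.indicator 1) + expect p (Sᶜ.indicator 1) * expect p (S.indicator 1) := by
    rw [expect_step]
    have h' : ∀ a b, U.indicator (1 : ℝ≥0 → ℝ≥0∞) (combine t a b) ≤
        S.indicator 1 a + Sᶜ.indicator 1 a * S.indicator 1 b := by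
      intro a b
      by_cases hU : combine t a b ∈ U
      · rw [Set.indicator_of_mem hU]
        by_cases ha : a ∈ S
        · simp [ha]
        · simp [ha, (h a b hU).resolve_left ha]
      · rw [Set.indicator_of_notMem hU]
        exact zero_le
    refine (expect_mono _ fun a => expect_mono _ fun b => h' a b).trans (le_of_eq ?_)
    simp_rw [expect_add, expect_const, expect_mul_mul]
  have hm := ENNReal.mul_ne_top (expect_indicator_ne_top p Sᶜ) (expect_indicator_ne_top p S)
  have := ENNReal.toReal_mono (ENNReal.add_ne_top.2 ⟨expect_indicator_ne_top p S, hm⟩) key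
  rw [ENNReal.toReal_add (expect_indicator_ne_top p S) hm, ENNReal.toReal_mul] at this
  change prob (step t p) U ≤ prob p S + prob p Sᶜ * prob p S at this
  rw [prob_compl] at this
  linarith

end Prob

/-- The likelihood ratios greater than `exp R`. -/
def Hi (R : ℝ) : Set ℝ≥0 := {a | Real.exp R < a}

/-- The likelihood ratios less than `exp R`. -/
def Lo (R : ℝ) : Set ℝ≥0 := {a | (a : ℝ) < Real.exp R}

theorem Hi_anti {R R' : ℝ} (h : R ≤ R') : Hi R' ⊆ Hi R := fun _ ha =>
  (Real.exp_le_exp.2 h).trans_lt ha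

theorem expect_above (p : Law) (R : ℝ) : expect p (above R) = ENNReal.ofReal (prob p (Hi R)) := by
  rw [ofReal_prob]
  rfl

theorem expect_below (p : Law) (R : ℝ) : expect p (below R) = ENNReal.ofReal (prob p (Lo R)) := by
  rw [ofReal_prob]
  rfl

theorem sq_le_sq_add {f g d : ℝ} (hf : f ∈ Set.Icc (0 : ℝ) 1) (hg : g ∈ Set.Icc (0 : ℝ) 1)
    (hd : 0 ≤ d) (h : g ≤ f + d) : g ^ 2 ≤ f ^ 2 + 2 * d := by
  obtain ⟨h1, h2⟩ := hf
  obtain ⟨h3, h4⟩ := hg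
  nlinarith [mul_nonneg (sub_nonneg.2 h) (add_nonneg h1 h3), mul_nonneg hd (sub_nonneg.2 h2),
    mul_nonneg hd (sub_nonneg.2 h4)]

/-- The output is at most `a + b`; the factor 2 is absorbed by `exp Y`. -/
theorem mem_Hi_or_of_combine_false {R Y : ℝ} (hY : 1 ≤ Y) {a b : ℝ≥0}
    (h : combine false a b ∈ Hi (R + 2 * Y)) : a ∈ Hi (R + Y) ∨ b ∈ Hi (R + Y) := by
  by_contra! hcon
  simp only [Hi, Set.mem_ofPred_eq, not_lt] at hcon h
  refine h.not_ge ?_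
  rw [coe_combine_false]
  have h1 : ((a : ℝ) + b) / (1 + a * b) ≤ a + b :=
    div_le_self (by positivity) (by have : (0 : ℝ) ≤ a * b := by positivity
                                    linarith)
  have h2 : Real.exp (R + 2 * Y) = Real.exp (R + Y) * Real.exp Y := by
    rw [← Real.exp_add]
    congr 1
    ring
  have h3 : 2 ≤ Real.exp Y := by linarith [Real.add_one_le_exp Y]
  have h4 := Real.exp_pos (R + Y)
  rw [h2]
  nlinarith [hcon.1, hcon.2]

/-- A law whose ratios rarely exceed `exp y` behaves at level `exp (-x)` like an erasure
channel. -/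
theorem prob_lawAt_le (p : Law) {x y : ℝ} (hy : 1 ≤ y) (hyx : y ≤ x) (w : List Bool) :
    prob (lawAt p w) (Hi (2 ^ w.length * y)) ≤ 4 ^ w.length * prob p (Hi y) ∧
    prob (lawAt p w) (Hi (-x + 2 ^ w.length * y)) ≤
      erasure (prob p (Hi (-x))) w + 4 ^ w.length * prob p (Hi y) ∧
    prob (lawAt p w) (Lo (-(2 ^ w.length * x))) ≤
      1 - erasure (prob p (Hi (-x))) w + 4 ^ w.length * prob p (Hi y) := by
  set ε := prob p (Hi y)
  set f := prob p (Hi (-x))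
  induction w with
  | nil =>
    have hε : 0 ≤ ε := (prob_mem p _).1
    simp only [List.length_nil, pow_zero, one_mul, lawAt, erasure]
    refine ⟨le_rfl, ?_, ?_⟩
    · have : prob p (Hi (-x + y)) ≤ f := prob_mono p (Hi_anti (by linarith))
      linarith
    · have h1 : prob p (Lo (-x)) ≤ prob p (Hi (-x))ᶜ :=
        prob_mono p fun a ha ha' => lt_asymm (show (a : ℝ) < Real.exp (-x) from ha) ha'
      rw [prob_compl] at h1
      linarith
  | cons t l ih =>
    obtain ⟨ih1, ih2, ih3⟩ := ih
    set q := lawAt p l with hq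
    set n := l.length
    set Y : ℝ := 2 ^ n * y with hY
    set X : ℝ := 2 ^ n * x with hX
    set d : ℝ := 4 ^ n * ε with hd
    have hp2 : (1 : ℝ) ≤ 2 ^ n := one_le_pow₀ (by norm_num)
    have hY1 : 1 ≤ Y := by nlinarith
    have hYX : Y ≤ X := mul_le_mul_of_nonneg_left hyx (by positivity)
    have hf := erasure_mem (prob_mem p (Hi (-x))) l
    have hd0 : 0 ≤ d := mul_nonneg (by positivity) (prob_mem p _).1
    have e1 : 2 ^ (n + 1) * y = 2 * Y := by rw [pow_succ, hY]; ring
    have e2 : 2 ^ (n + 1) * x = 2 * X := by rw [pow_succ, hX]; ring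
    have e3 : 4 ^ (n + 1) * ε = 4 * d := by rw [pow_succ, hd]; ring
    have hcompl : ∀ g : ℝ, g ∈ Set.Icc (0 : ℝ) 1 → 1 - g ∈ Set.Icc (0 : ℝ) 1 := fun g hg =>
      ⟨by linarith [hg.2], by linarith [hg.1]⟩
    rw [List.length_cons, lawAt, ← hq, e1, e2, e3]
    refine ⟨?_, ?_, ?_⟩
    · have h1 : prob (step t q) (Hi (2 * Y)) ≤ prob q ∅ ^ 2 + 2 * prob q (Hi Y) := by
        refine prob_step_le_of_and q fun a b h => Or.inr ?_
        cases t
        · have hlt := Hi_anti (by linarith : Y ≤ 2 * Y)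
          rcases of_exp_lt_combine_false (by linarith) h with ⟨-, -, h⟩ | ⟨-, -, h⟩
          · exact Or.inr (hlt h)
          · exact Or.inl (hlt h)
        · exact lt_or_lt_of_exp_lt_mul h
      have h2 : prob q ∅ = 0 := by simp [prob, expect_const]
      rw [h2] at h1
      linarith
    · cases t
      · have h1 : prob (step false q) (Hi (-x + 2 * Y)) ≤ 1 - (1 - prob q (Hi (-x + Y))) ^ 2 :=
          prob_step_le_of_or q fun a b h => mem_Hi_or_of_combine_false hY1 h
        have h2 := sq_le_sq_add (hcompl _ (prob_mem q (Hi (-x + Y)))) (hcompl _ hf) hd0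
          (by linarith)
        simp only [erasure]
        linarith
      · have h1 : prob (step true q) (Hi (-x + 2 * Y)) ≤
            prob q (Hi (-x + Y)) ^ 2 + 2 * prob q (Hi Y) := by
          refine prob_step_le_of_and q fun a b h => ?_
          by_contra! hcon
          obtain ⟨h1, h2, h3⟩ := hcon
          simp only [Hi, Set.mem_ofPred_eq, not_lt] at h h1 h2 h3
          have e4 : Real.exp (-x + 2 * Y) = Real.exp (-x + Y) * Real.exp Y := by
            rw [← Real.exp_add]
            congr 1
            ring
          rw [e4, coe_combine_true] at h
          refine h.not_ge ?_
          rcases le_or_gt (a : ℝ) (Real.exp (-x + Y)) with h4 | h4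
          · exact mul_le_mul h4 h3 b.coe_nonneg (Real.exp_pos _).le
          · rw [mul_comm (a : ℝ)]
            exact mul_le_mul (h1 h4) h2 a.coe_nonneg (Real.exp_pos _).le
        -- Squaring turns the error `d` into `2 d` and the outliers add `2 d`; hence the factor 4
        -- per step.
        have h2 := sq_le_sq_add hf (prob_mem q (Hi (-x + Y))) hd0 ih2
        simp only [erasure]
        linarith
    · cases t
      · have h1 : prob (step false q) (Lo (-(2 * X))) ≤
            prob q (Lo (-X)) ^ 2 + 2 * prob q (Hi Y) := by
          refine prob_step_le_of_and q fun a b h => ?_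
          by_contra! hcon
          obtain ⟨h1, h2, h3⟩ := hcon
          simp only [Hi, Lo, Set.mem_ofPred_eq, not_lt] at h h1 h2 h3
          have h5 : Real.exp Y ≤ Real.exp X := Real.exp_le_exp.2 hYX
          have h6 : Real.exp (-(2 * X)) ≤ Real.exp (-X) := Real.exp_le_exp.2 (by linarith)
          refine h.not_ge (h6.trans ?_)
          rcases lt_or_ge (a : ℝ) (Real.exp (-X)) with h4 | h4
          · rw [combine_comm]
            exact exp_neg_le_combine_false (h3.trans h5) (h1 h4)
          · exact exp_neg_le_combine_false (h2.trans h5) h4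
        have h2 := sq_le_sq_add (hcompl _ hf) (prob_mem q (Lo (-X))) hd0 (by linarith)
        simp only [erasure]
        linarith
      · have h1 : prob (step true q) (Lo (-(2 * X))) ≤ 1 - (1 - prob q (Lo (-X))) ^ 2 := by
          refine prob_step_le_of_or q fun a b h => ?_
          by_contra! hcon
          simp only [Lo, Set.mem_ofPred_eq, not_lt] at h hcon
          refine h.not_ge ?_
          rw [coe_combine_true, show -(2 * X) = 2 * -X by ring, exp_two_mul]
          exact mul_le_mul hcon.1 hcon.2 (Real.exp_pos _).le a.coe_nonneg
        have h2 := sq_le_sq_add (hcompl _ (prob_mem q (Lo (-X)))) hf hd0 (by linarith)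
        simp only [erasure]
        linarith

/-- A transition of erasure probabilities between two levels yields concentration. -/
theorem concentrated_of_transition (p : Law) {x x' y η lam : ℝ} (hy : 1 ≤ y) {w : List Bool} {k : ℕ}
    (hw : w.length = k) (hyx : 2 ^ (k + 1) * y ≤ x) (hx : x ≤ x')
    (h1 : erasure (prob p (Hi (-x))) w ≤ η) (h2 : 1 - η ≤ erasure (prob p (Hi (-x'))) w)
    (h3 : 4 ^ k * prob p (Hi y) ≤ η) (h4 : 4 ^ k * prob p (Hi y) ≤ 2 ^ (-lam)) :
    Concentrated (lawAt p w) (x / 2) (2 ^ (k + 1) * (x' / x)) (2 ^ k * y) (2 * η) lam := by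
  have hk : (1 : ℝ) ≤ 2 ^ k := one_le_pow₀ (by norm_num)
  rw [pow_succ] at hyx
  have hyx' : y ≤ x := by nlinarith
  have hx0 : 0 < x := by linarith
  obtain ⟨h5, h6, -⟩ := prob_lawAt_le p hy hyx' w
  obtain ⟨-, -, h7⟩ := prob_lawAt_le p hy (hyx'.trans hx) w
  rw [hw] at h5 h6 h7
  refine ⟨?_, ?_, ?_⟩
  · rw [expect_above]
    refine ENNReal.ofReal_le_ofReal ?_
    have : prob (lawAt p w) (Hi (-(x / 2))) ≤ prob (lawAt p w) (Hi (-x + 2 ^ k * y)) :=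
      prob_mono _ (Hi_anti (by linarith))
    linarith
  · rw [expect_below]
    refine ENNReal.ofReal_le_ofReal ?_
    have e : 2 ^ (k + 1) * (x' / x) * (x / 2) = 2 ^ k * x' := by
      rw [pow_succ]
      field_simp
    rw [e]
    linarith
  · rw [expect_above]
    exact ENNReal.ofReal_le_ofReal (h5.trans h4)

theorem expect_cost_lawAt_ne_top {p : Law} (hp : expect p cost ≠ ⊤) (w : List Bool) :
    expect (lawAt p w) cost ≠ ⊤ := by
  induction w with
  | nil => exact hp
  | cons t l ih =>
    exact ne_top_of_le_ne_top (ENNReal.mul_ne_top ENNReal.ofNat_ne_top ih) (expect_cost_le t _)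

/-! ### From spread-out laws to sharply concentrated ones -/

theorem le_fairPath_of_transition {R : Law → Prop} (q : Law) {e : ℕ → ℝ}
    (he : ∀ j, e j ∈ Set.Icc (0 : ℝ) 1) (k : ℕ → ℕ) {η : ℝ} (hη : 0 < η) {M N : ℕ}
    (hN : ∀ j < M, k j ≤ N) (hR : ∀ j < M, ∀ w : List Bool, w.length = k j →
      erasure (e j) w ≤ η → 1 - η ≤ erasure (e (j + 1)) w → R (lawAt q w)) :
    ENNReal.ofReal (e M - e 0 - (7 / 8) ^ N - ∑ j ∈ Finset.range M, 2 * (7 / 8) ^ k j / η) ≤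
      fairPath {b | ∃ n, R (lawSeq q b n)} := by
  refine (ENNReal.ofReal_le_ofReal (le_fairPath_exists_transition he k hη hN)).trans ?_
  rw [measureReal_def, ENNReal.ofReal_toReal (measure_ne_top _ _)]
  refine measure_mono ?_
  rintro b ⟨j, hj, h1, h2⟩
  exact ⟨k j, hR j hj _ (length_firstSteps b _) h1 h2⟩

theorem eventually_mul_pow_le (A : ℝ) (m : ℕ) {r : ℝ} (hr : 1 < r) :
    ∀ᶠ j : ℕ in atTop, A * (j : ℝ) ^ m ≤ r ^ j := by
  have h := (tendsto_pow_const_div_const_pow_of_one_lt m hr).const_mul A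
  rw [mul_zero] at h
  filter_upwards [h.eventually_lt_const one_pos] with j hj
  rw [← mul_div_assoc, div_lt_one (by positivity)] at hj
  exact hj.le

theorem prob_Hi_of_concentrated {p : Law} {x L y η lam : ℝ} (h : Concentrated p x L y η lam)
    (hη : 0 ≤ η) : prob p (Hi (-x)) ≤ η ∧ prob p (Lo (-(L * x))) ≤ η ∧
      prob p (Hi y) ≤ 2 ^ (-lam) := by
  obtain ⟨h1, h2, h3⟩ := h
  rw [expect_above, ENNReal.ofReal_le_ofReal_iff hη] at h1
  rw [expect_below, ENNReal.ofReal_le_ofReal_iff hη] at h2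
  rw [expect_above, ENNReal.ofReal_le_ofReal_iff (by positivity)] at h3
  exact ⟨h1, h2, h3⟩

theorem one_sub_prob_Hi_le (p : Law) {R R' : ℝ} (h : R' < R) :
    1 - prob p (Hi R') ≤ prob p (Lo R) := by
  rw [← prob_compl]
  refine prob_mono p fun a ha => ?_
  exact (not_lt.1 (show ¬ Real.exp R' < a from ha)).trans_lt (Real.exp_lt_exp.2 h)

/-- Concentration in a window whose ratio is small in terms of the mass of the outliers. -/
def Sharp (η k K D : ℝ) (q : Law) : Prop :=
  expect q cost ≠ ⊤ ∧ ∃ x L y lam : ℝ, Concentrated q x L y η lam ∧ 1 ≤ L ∧ k ≤ x ∧ y * k ≤ x ∧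
    K * L ^ D ≤ lam

/-- Concentration in a window whose ratio is polynomial in terms of the logarithm of the mass of
the outliers. -/
def Coarse (J : ℕ) (Z : ℝ) (q : Law) : Prop :=
  expect q cost ≠ ⊤ ∧ ∃ j : ℕ, J ≤ j ∧ ∃ x L y : ℝ, Concentrated q x L y (1 / 8) (j / 2) ∧
    1 ≤ y ∧ Z * y ≤ x ∧ L ≤ (j : ℝ) ^ 12

/-- The window of ratio at most `j^12` is subdivided with ratio `r = j^(1/(2D))`. The number of
levels and the number `n` of steps do not depend on `j`, while the new ratio has `D`-th power of
order `√j`, much less than the outlier exponent `j/2 - 2n`. -/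
theorem exists_sharp_of_coarse {η k K D : ℝ} (hη : 0 < η) (hk : 1 ≤ k) (hK : 0 < K) (hD : 1 ≤ D) :
    ∃ (J : ℕ) (Z : ℝ), ∀ q, Coarse J Z q →
      2⁻¹ ≤ fairPath {b | ∃ n, Sharp η k K D (lawSeq q b n)} := by
  -- Then `r ^ M ≥ j^13 ≥ 2 L`, so the chain of levels spans the window.
  obtain ⟨M, hM⟩ := exists_nat_ge (2 * D * 13)
  obtain ⟨n, hn⟩ : ∃ n : ℕ, (1 + M * 2 / (η / 2)) * (7 / 8 : ℝ) ^ n < 1 / 4 := by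
    have h := (tendsto_pow_atTop_nhds_zero_of_lt_one (by norm_num : (0 : ℝ) ≤ 7 / 8)
      (by norm_num)).const_mul (1 + M * 2 / (η / 2))
    rw [mul_zero] at h
    exact (h.eventually_lt_const (by norm_num)).exists
  set A : ℝ := K * (2 ^ (n + 1)) ^ D with hA
  have hA0 : 0 < A := by positivity
  have hsqrt : Tendsto (fun j : ℕ => √(j : ℝ)) atTop atTop :=
    Real.tendsto_sqrt_atTop.comp tendsto_natCast_atTop_atTop
  have hsmall : ∀ᶠ j : ℕ in atTop, 4 ^ n * (2 : ℝ) ^ (-((j : ℝ) / 2)) < η / 2 := by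
    have h1 : Tendsto (fun j : ℕ => (4 : ℝ) ^ n * ((2 : ℝ) ^ (-(1 / 2) : ℝ)) ^ j) atTop
        (𝓝 (4 ^ n * 0)) := (tendsto_pow_atTop_nhds_zero_of_lt_one (by positivity)
          (Real.rpow_lt_one_of_one_lt_of_neg (by norm_num) (by norm_num))).const_mul _
    rw [mul_zero] at h1
    filter_upwards [h1.eventually_lt_const (half_pos hη)] with j hj
    have e : (2 : ℝ) ^ (-((j : ℝ) / 2)) = ((2 : ℝ) ^ (-(1 / 2) : ℝ)) ^ j := by
      rw [← Real.rpow_natCast, ← Real.rpow_mul (by norm_num)]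
      congr 1
      ring
    rwa [e]
  -- The two bounds on `√j` give `A √j ≤ j/2 - 2n`, the last condition of `Sharp`.
  obtain ⟨J, hJ⟩ := eventually_atTop.1 (((hsqrt.eventually_ge_atTop (2 * A + 2)).and
    (hsqrt.eventually_ge_atTop (2 * n))).and (hsmall.and (eventually_ge_atTop 2)))
  refine ⟨J, 2 ^ (n + 1) * k, ?_⟩
  rintro q ⟨hq, j, hj, x, L, y, hc, hy, hyx, hL⟩
  obtain ⟨⟨h1, h2⟩, h3, h4⟩ := hJ j hj
  obtain ⟨hw1, hw2, hw3⟩ := prob_Hi_of_concentrated hc (by norm_num)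
  have hj2 : (2 : ℝ) ≤ j := by exact_mod_cast h4
  have hj0 : (0 : ℝ) < j := by linarith
  have hp2 : (1 : ℝ) ≤ 2 ^ n := one_le_pow₀ (by norm_num)
  set r : ℝ := (j : ℝ) ^ (1 / (2 * D)) with hr
  have hr1 : 1 ≤ r := Real.one_le_rpow (by linarith) (by positivity)
  have hrD : r ^ D = √j := by
    rw [hr, ← Real.rpow_mul hj0.le, Real.sqrt_eq_rpow]
    congr 1
    field_simp
  have hrM : 2 * L ≤ r ^ M := by
    have e1 : r ^ M = (j : ℝ) ^ (1 / (2 * D) * M) := by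
      rw [hr, Real.rpow_mul_natCast hj0.le]
    have e2 : (13 : ℝ) ≤ 1 / (2 * D) * M := by
      rw [one_div_mul_eq_div, le_div_iff₀ (by positivity)]
      linarith
    have e3 : (j : ℝ) ^ 13 ≤ r ^ M := by
      rw [e1, ← Real.rpow_natCast]
      exact Real.rpow_le_rpow_of_exponent_le (by linarith) (by exact_mod_cast e2)
    have e4 : (j : ℝ) ^ 13 = j * j ^ 12 := by ring
    have e5 : (0 : ℝ) ≤ j ^ 12 := by positivity
    nlinarith
  have hx0 : 0 < x := lt_of_lt_of_le (by positivity) hyx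
  have hX : ∀ i : ℕ, x ≤ x * r ^ i := fun i => le_mul_of_one_le_right hx0.le (one_le_pow₀ hr1)
  have hεη := (mul_le_mul_of_nonneg_left hw3 (by positivity : (0 : ℝ) ≤ 4 ^ n)).trans h3.le
  have hεlam : 4 ^ n * prob q (Hi y) ≤ 2 ^ (-((j : ℝ) / 2 - 2 * n)) := by
    refine (mul_le_mul_of_nonneg_left hw3 (by positivity)).trans_eq ?_
    rw [neg_sub, sub_eq_add_neg, Real.rpow_add (by norm_num), Real.rpow_mul (by norm_num),
      Real.rpow_natCast]
    norm_num
  have key := le_fairPath_of_transition (R := Sharp η k K D) q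
    (e := fun i => prob q (Hi (-(x * r ^ i)))) (fun i => prob_mem q _) (fun _ => n)
    (half_pos hη) (M := M) (N := n) (fun _ _ => le_rfl) ?_
  · refine le_trans ?_ key
    have e0 : prob q (Hi (-(x * r ^ 0))) ≤ 1 / 8 := by simpa using hw1
    have eM : 7 / 8 ≤ prob q (Hi (-(x * r ^ M))) := by
      have hlt : -(x * r ^ M) < -(L * x) := by
        have h5 : 1 ≤ r ^ M := one_le_pow₀ hr1
        have h6 : L < r ^ M := by linarith
        nlinarith
      have := one_sub_prob_Hi_le q hlt
      linarith
    have e1 : (2⁻¹ : ℝ≥0∞) = ENNReal.ofReal (1 / 2) := by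
      rw [one_div, ENNReal.ofReal_inv_of_pos (by norm_num)]
      norm_num
    rw [e1]
    refine ENNReal.ofReal_le_ofReal ?_
    rw [Finset.sum_const, Finset.card_range, nsmul_eq_mul]
    have e2 : (1 + M * 2 / (η / 2)) * (7 / 8 : ℝ) ^ n =
      (7 / 8) ^ n + M * (2 * (7 / 8) ^ n / (η / 2)) := by ring
    linarith
  · intro i _ w hw hlow hhigh
    have h5 : 2 ^ (n + 1) * y ≤ 2 ^ (n + 1) * k * y := by
      have : (2 : ℝ) ^ (n + 1) ≤ 2 ^ (n + 1) * k := le_mul_of_one_le_right (by positivity) hk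
      nlinarith
    have h6 : 2 ^ (n + 1) * y ≤ x * r ^ i := by linarith [hX i]
    have h7 : x * r ^ i ≤ x * r ^ (i + 1) :=
      mul_le_mul_of_nonneg_left (pow_le_pow_right₀ hr1 (Nat.le_succ i)) hx0.le
    have hc' := concentrated_of_transition q hy hw h6 h7 hlow hhigh hεη hεlam
    have hXi : 0 < x * r ^ i := by positivity
    have e : x * r ^ (i + 1) / (x * r ^ i) = r := by
      rw [pow_succ]
      field_simp
    rw [e, mul_div_cancel₀ _ (two_ne_zero)] at hc'
    refine ⟨expect_cost_lawAt_ne_top hq w, _, _, _, _, hc', ?_, ?_, ?_, ?_⟩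
    · exact one_le_mul_of_one_le_of_one_le (one_le_pow₀ (by norm_num)) hr1
    · have h8 := hX i
      have h9 : k ≤ 2 ^ n * k * y := by
        have : 1 ≤ 2 ^ n * y := one_le_mul_of_one_le_of_one_le hp2 hy
        calc k ≤ k * (2 ^ n * y) := le_mul_of_one_le_right (by linarith) this
          _ = _ := by ring
      have h10 : 2 ^ (n + 1) * k * y = 2 * (2 ^ n * k * y) := by rw [pow_succ]; ring
      linarith
    · have h8 := hX i
      rw [pow_succ] at hyx
      linarith
    · rw [Real.mul_rpow (by positivity) (by positivity), ← mul_assoc, ← hA, hrD]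
      have h8 : √(j : ℝ) * √j = j := Real.mul_self_sqrt hj0.le
      nlinarith

/-- Markov's inequality: the loss exceeds `y` where the ratio exceeds `exp y`. -/
theorem prob_Hi_le_of_expect_cost_le {p : Law} {C y : ℝ} (hC : 0 ≤ C) (hy : 0 < y)
    (h : expect p cost ≤ ENNReal.ofReal C) : prob p (Hi y) ≤ C / y := by
  rw [le_div_iff₀ hy]
  have key : ENNReal.ofReal y * expect p ((Hi y).indicator 1) ≤ expect p cost := by
    rw [← expect_mul_left]
    refine expect_mono p fun a => ?_
    by_cases ha : a ∈ Hi y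
    · rw [Set.indicator_of_mem ha, Pi.one_apply, mul_one]
      refine ENNReal.ofReal_le_ofReal ?_
      rw [Real.le_log_iff_exp_le (by positivity)]
      have : Real.exp y < a := ha
      linarith
    · rw [Set.indicator_of_notMem ha, mul_zero]
      exact zero_le
  rw [← ofReal_prob, ← ENNReal.ofReal_mul hy.le] at key
  have := (ENNReal.ofReal_le_ofReal_iff hC).1 (key.trans h)
  linarith

/-- More than `c` of the mass sits on finitely many positive ratios, all of which a low enough
threshold captures. -/
theorem exists_lt_prob_Hi {p : Law} {c : ℝ} (hc : 0 ≤ c) (h : c < prob p {0}ᶜ) {X : ℕ → ℝ}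
    (hX : Tendsto X atTop atTop) : ∃ i, c < prob p (Hi (-X i)) := by
  have h1 : ENNReal.ofReal c < expect p (({0} : Set ℝ≥0)ᶜ.indicator 1) := by
    rw [← ofReal_prob]
    exact (ENNReal.ofReal_lt_ofReal_iff_of_nonneg hc).2 h
  rw [expect, ENNReal.tsum_eq_iSup_sum, lt_iSup_iff] at h1
  obtain ⟨F, hF⟩ := h1
  have hlim : Tendsto (fun i => Real.exp (-X i)) atTop (𝓝 0) :=
    Real.tendsto_exp_atBot.comp (tendsto_neg_atTop_atBot.comp hX)
  have hall : ∀ᶠ i in atTop, ∀ a ∈ F, a ≠ 0 → a ∈ Hi (-X i) := by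
    rw [eventually_all_finset]
    intro a _
    by_cases ha : a = 0
    · simp [ha]
    · filter_upwards [hlim.eventually_lt_const (NNReal.coe_pos.2 (pos_iff_ne_zero.2 ha))]
        with i hi _
      exact hi
  obtain ⟨i, hi⟩ := hall.exists
  refine ⟨i, ?_⟩
  refine (ENNReal.ofReal_lt_ofReal_iff_of_nonneg hc).1 ?_
  rw [ofReal_prob]
  refine hF.trans_le (le_trans (Finset.sum_le_sum fun a ha => ?_) (ENNReal.sum_le_tsum F))
  refine mul_le_mul_right ?_ _
  by_cases ha0 : a = 0
  · simp [ha0]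
  · rw [Set.indicator_of_mem (hi a ha ha0)]
    exact Set.indicator_le_self _ _ _

theorem sum_inv_sq_le (j : ℕ) (hj : 2 ≤ j) (M : ℕ) :
    ∑ i ∈ Finset.range M, 1 / ((j + i : ℕ) : ℝ) ^ 2 ≤
      1 / ((j : ℝ) - 1) - 1 / (((j + M : ℕ) : ℝ) - 1) := by
  induction M with
  | zero => simp
  | succ M ih =>
    rw [Finset.sum_range_succ]
    have hx : (2 : ℝ) ≤ (j + M : ℕ) := by exact_mod_cast hj.trans (Nat.le_add_right j M)
    have e : ((j + (M + 1) : ℕ) : ℝ) = (j + M : ℕ) + 1 := by push_cast; ring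
    rw [e]
    set z : ℝ := ((j + M : ℕ) : ℝ)
    have : 1 / z ^ 2 ≤ 1 / (z - 1) - 1 / (z + 1 - 1) := by
      rw [add_sub_cancel_right, div_sub_div _ _ (by linarith) (by linarith),
        div_le_div_iff₀ (by positivity) (by nlinarith)]
      nlinarith
    linarith

/-- The number of steps used to resolve a law at scale `2 ^ j`. -/
def resolutionTime (j : ℕ) : ℕ := 11 * Nat.clog 2 j

theorem two_pow_resolutionTime_le {j : ℕ} (hj : 2 ≤ j) :
    (2 : ℝ) ^ resolutionTime j ≤ (2 * j) ^ 11 := by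
  rw [resolutionTime, mul_comm, pow_mul]
  refine pow_le_pow_left₀ (by positivity) ?_ _
  have h1 := Nat.pow_pred_clog_lt_self (b := 2) one_lt_two (x := j) (by omega)
  have h2 : 0 < Nat.clog 2 j := Nat.clog_pos one_lt_two hj
  have h3 : 2 ^ Nat.clog 2 j ≤ 2 * j := by
    obtain ⟨c, hc⟩ := Nat.exists_eq_succ_of_ne_zero h2.ne'
    rw [hc, Nat.pred_succ] at h1
    rw [hc, pow_succ]
    omega
  exact_mod_cast h3

theorem pow_resolutionTime_le {j : ℕ} (hj : 2 ≤ j) :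
    (7 / 8 : ℝ) ^ resolutionTime j ≤ 1 / (j : ℝ) ^ 2 := by
  rw [resolutionTime, pow_mul]
  have hj0 : (0 : ℝ) < j := by exact_mod_cast (by omega : 0 < j)
  have h1 : (j : ℝ) ≤ 2 ^ Nat.clog 2 j := by exact_mod_cast Nat.le_pow_clog one_lt_two j
  -- The 11 in `resolutionTime` is the least exponent with `(7/8)^11 ≤ 1/4`.
  calc ((7 / 8 : ℝ) ^ 11) ^ Nat.clog 2 j ≤ (1 / 4) ^ Nat.clog 2 j :=
        pow_le_pow_left₀ (by norm_num) (by norm_num) _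
    _ = 1 / (2 ^ Nat.clog 2 j) ^ 2 := by
      rw [← pow_mul, mul_comm, pow_mul, one_div_pow]
      norm_num
    _ ≤ 1 / (j : ℝ) ^ 2 := by
      refine one_div_le_one_div_of_le (by positivity) ?_
      exact pow_le_pow_left₀ hj0.le h1 2

/-- A bounded loss with few zero ratios and few ratios above `exp (-2 ^ j)`. -/
def Spread (C : ℝ) (j : ℕ) (q : Law) : Prop :=
  expect q cost ≤ ENNReal.ofReal C ∧ prob q {0} ≤ 1 / 4 ∧ prob q (Hi (-(2 ^ j))) ≤ 1 / 8

/-- Thresholds `2^j` are resolved in time logarithmic in `j`: long enough for errors `O(1/j²)`,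
summable over an unbounded number of levels, and short enough that the window ratio stays polynomial
in `j`. -/
theorem exists_coarse_of_spread {C : ℝ} (hC : 0 ≤ C) (J : ℕ) (Z : ℝ) :
    ∃ j₀ : ℕ, ∀ q, Spread C j₀ q →
      ENNReal.ofReal (1 / 4) ≤ fairPath {b | ∃ n, Coarse J Z (lawSeq q b n)} := by
  set Z' : ℝ := max Z 1 with hZ'
  have hZ1 : 1 ≤ Z' := le_max_right _ _
  have hs2 : (1 : ℝ) < 2 ^ (1 / 2 : ℝ) := Real.one_lt_rpow (by norm_num) (by norm_num)
  -- The window ratio is `2^(k+2) ≤ 2^13 j^11`, at most `j^12` once `j ≥ 8192 = 2^13`. The other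
  -- conditions give `y ≥ 1` and outlier mass at most `2^(-j/2)`.
  obtain ⟨j₀, hj₀⟩ := eventually_atTop.1 (((eventually_mul_pow_le (2 * Z' * 2 ^ 11) 11
    one_lt_two).and (eventually_mul_pow_le (2 * Z' * C * 2 ^ 33) 33 hs2)).and
    ((eventually_ge_atTop J).and (eventually_ge_atTop 8192)))
  refine ⟨j₀, ?_⟩
  rintro q ⟨hcost, h0, hHi⟩
  have hX : Tendsto (fun i : ℕ => (2 : ℝ) ^ (j₀ + i)) atTop atTop :=
    (tendsto_pow_atTop_atTop_of_one_lt one_lt_two).comp 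
      (tendsto_atTop_mono (fun i => Nat.le_add_left i j₀) tendsto_id)
  -- The nonzero ratios have mass at least 3/4. The final count is `1/2 - 1/8 - 1/16 - 1/16 = 1/4`.
  obtain ⟨M, hM⟩ := exists_lt_prob_Hi (p := q) (c := 1 / 2) (by norm_num)
    (by rw [prob_compl]; linarith) hX
  obtain ⟨n₀, hn₀⟩ := exists_pow_lt_of_lt_one (by norm_num : (0 : ℝ) < 1 / 16)
    (by norm_num : (7 / 8 : ℝ) < 1)
  have key := le_fairPath_of_transition (R := Coarse J Z) q
    (e := fun i => prob q (Hi (-(2 ^ (j₀ + i))))) (fun i => prob_mem q _)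
    (fun i => resolutionTime (j₀ + i)) (η := 1 / 16) (by norm_num) (M := M)
    (N := n₀ + ∑ i ∈ Finset.range M, resolutionTime (j₀ + i))
    (fun i hi => (Finset.single_le_sum (f := fun i => resolutionTime (j₀ + i))
      (fun _ _ => Nat.zero_le _) (Finset.mem_range.2 hi)).trans (Nat.le_add_left _ _)) ?_
  · refine le_trans (ENNReal.ofReal_le_ofReal ?_) key
    have hj1 : 8192 ≤ j₀ := (hj₀ j₀ le_rfl).2.2
    have h1 : (7 / 8 : ℝ) ^ (n₀ + ∑ i ∈ Finset.range M, resolutionTime (j₀ + i)) ≤ 1 / 16 :=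
      (pow_le_pow_of_le_one (by norm_num) (by norm_num) (Nat.le_add_right _ _)).trans hn₀.le
    have h2 : ∑ i ∈ Finset.range M, 2 * (7 / 8 : ℝ) ^ resolutionTime (j₀ + i) / (1 / 16) ≤
        1 / 16 := by
      have h3 : ∀ i ∈ Finset.range M, 2 * (7 / 8 : ℝ) ^ resolutionTime (j₀ + i) / (1 / 16) ≤
          32 * (1 / ((j₀ + i : ℕ) : ℝ) ^ 2) := by
        intro i _
        have := pow_resolutionTime_le (j := j₀ + i) (by omega)
        linarith
      refine (Finset.sum_le_sum h3).trans ?_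
      rw [← Finset.mul_sum]
      have h4 := sum_inv_sq_le j₀ (by omega) M
      have h5 : (8192 : ℝ) ≤ j₀ := by exact_mod_cast hj1
      have h6 : (0 : ℝ) ≤ 1 / (((j₀ + M : ℕ) : ℝ) - 1) := by
        refine one_div_nonneg.2 ?_
        push_cast
        have : (0 : ℝ) ≤ M := M.cast_nonneg
        linarith
      have h7 : 1 / ((j₀ : ℝ) - 1) ≤ 1 / 512 :=
        one_div_le_one_div_of_le (by norm_num) (by linarith)
      linarith
    have h8 : prob q (Hi (-(2 ^ (j₀ + 0)))) ≤ 1 / 8 := hHi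
    linarith
  · intro i _ w hw hlow hhigh
    obtain ⟨⟨h1, h2⟩, h3, h4⟩ := hj₀ (j₀ + i) (Nat.le_add_right _ _)
    set j := j₀ + i with hj
    set k := resolutionTime j with hk
    have hj8 : (8192 : ℝ) ≤ j := by exact_mod_cast h4
    have hk2 := two_pow_resolutionTime_le (j := j) (by omega)
    rw [← hk, mul_pow] at hk2
    have hkpos : (0 : ℝ) < 2 ^ k := by positivity
    -- The largest level still a factor `Z'` below the window after `k` steps; bounded loss leaves
    -- mass at most `C / y` above it.
    set y : ℝ := 2 ^ j / (Z' * 2 ^ (k + 1)) with hy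
    have hyeq : Z' * 2 ^ (k + 1) * y = 2 ^ j := by
      rw [hy]
      field_simp
    have hy1 : 1 ≤ y := by
      rw [hy, one_le_div (by positivity), pow_succ]
      refine le_trans ?_ h1
      nlinarith
    have hprob : 4 ^ k * prob q (Hi y) ≤ 2 ^ (-((j : ℝ) / 2)) := by
      have h5 := prob_Hi_le_of_expect_cost_le hC (by linarith : 0 < y) hcost
      refine (mul_le_mul_of_nonneg_left h5 (by positivity)).trans ?_
      have e1 : (2 : ℝ) ^ ((j : ℝ) / 2) = (2 ^ (1 / 2 : ℝ)) ^ j := by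
        rw [← Real.rpow_natCast, ← Real.rpow_mul (by norm_num)]
        congr 1
        ring
      have e2 : (2 : ℝ) ^ j = 2 ^ ((j : ℝ) / 2) * 2 ^ ((j : ℝ) / 2) := by
        rw [← Real.rpow_add (by norm_num), add_halves, Real.rpow_natCast]
      rw [Real.rpow_neg (by norm_num), mul_div_assoc', div_le_iff₀ (by linarith)]
      have e3 : ((2 : ℝ) ^ ((j : ℝ) / 2))⁻¹ * y = 2 ^ ((j : ℝ) / 2) / (Z' * 2 ^ (k + 1)) := by
        rw [hy, e2]
        field_simp
      rw [e3, le_div_iff₀ (by positivity), e1]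
      refine le_trans ?_ h2
      have e4 : (4 : ℝ) ^ k * C * (Z' * 2 ^ (k + 1)) = 2 * Z' * C * (2 ^ k) ^ 3 := by
        rw [show (4 : ℝ) = 2 ^ 2 by norm_num, ← pow_mul, ← pow_mul, pow_succ]
        ring
      rw [e4]
      have e5 : ((2 : ℝ) ^ k) ^ 3 ≤ 2 ^ 33 * j ^ 33 := by
        refine (pow_le_pow_left₀ hkpos.le hk2 3).trans_eq ?_
        rw [mul_pow, ← pow_mul, ← pow_mul]
      calc 2 * Z' * C * ((2 : ℝ) ^ k) ^ 3 ≤ 2 * Z' * C * (2 ^ 33 * j ^ 33) := by gcongr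
        _ = _ := by ring
    have hη : (2 : ℝ) ^ (-((j : ℝ) / 2)) ≤ 1 / 16 := by
      have : (2 : ℝ) ^ (-((j : ℝ) / 2)) ≤ 2 ^ (-(4 : ℝ)) :=
        Real.rpow_le_rpow_of_exponent_le (by norm_num) (by linarith)
      refine this.trans_eq ?_
      rw [Real.rpow_neg (by norm_num)]
      norm_num
    have h5 : 2 ^ (k + 1) * y ≤ 2 ^ j := by
      rw [← hyeq, mul_assoc]
      exact le_mul_of_one_le_left (by positivity) hZ1
    have hc := concentrated_of_transition q hy1 hw h5
      (pow_le_pow_right₀ one_le_two (Nat.le_succ j)) hlow hhigh (hprob.trans hη) hprob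
    refine ⟨expect_cost_lawAt_ne_top (ne_top_of_le_ne_top ENNReal.ofReal_ne_top hcost) w, j, h3,
      _, _, _, by norm_num at hc ⊢; exact hc, ?_, ?_, ?_⟩
    · exact one_le_mul_of_one_le_of_one_le (one_le_pow₀ one_le_two) hy1
    · have h6 : Z ≤ Z' := le_max_left _ _
      have h7 : Z' * (2 ^ k * y) = 2 ^ j / 2 := by
        rw [← hyeq, pow_succ]
        ring
      rw [← h7]
      exact mul_le_mul_of_nonneg_right h6 (by positivity)
    · rw [pow_succ (2 : ℝ) j, mul_div_cancel_left₀ _ (by positivity), pow_succ]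
      have h6 : (0 : ℝ) < j ^ 11 := by positivity
      have h7 : (j : ℝ) ^ 12 = j * j ^ 11 := by ring
      rw [h7]
      nlinarith

/-! ### Almost sure fast convergence to one of the two ends -/

theorem pow_le_fairPath_replicate (t : Bool) (n : ℕ) :
    (2⁻¹ : ℝ≥0∞) ^ n ≤ fairPath {b | firstSteps b n = List.replicate n t} := by
  have h1 : fairPath (Set.pi (Finset.range n) fun _ => {t}) = 2⁻¹ ^ n := by
    rw [fairPath, Measure.infinitePi_pi _ fun _ _ => measurableSet_singleton t]
    have : fairBit {t} = 2⁻¹ := by cases t <;> simp [fairBit]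
    rw [this, Finset.prod_const, Finset.card_range]
  rw [← h1]
  refine measure_mono fun b hb => ?_
  have hb' : ∀ i < n, b i = t := fun i hi => hb i (Finset.mem_coe.2 (Finset.mem_range.2 hi))
  clear hb h1
  induction n with
  | zero => rfl
  | succ n ih =>
    have h2 : firstSteps b n = List.replicate n t := ih fun i hi => hb' i (by omega)
    change b n :: firstSteps b n = _
    rw [h2, hb' n (Nat.lt_succ_self n), List.replicate_succ]

/-- A functional that is squared by the steps of one type becomes small with probability bounded
below. -/
theorem exists_le_fairPath_of_squared {φ : ℝ≥0 → ℝ≥0∞} {t : Bool}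
    (hφ : ∀ q, expect (step t q) φ = expect q φ ^ 2) {r : ℝ} (hr : 0 ≤ r) (hr1 : r < 1) {ε : ℝ}
    (hε : 0 < ε) {R : Law → Prop} (hR : ∀ q w, R q → R (lawAt q w)) :
    ∃ c : ℝ≥0∞, c ≠ 0 ∧ ∀ q, (R q ∧ expect q φ ≤ ENNReal.ofReal r) →
      c ≤ fairPath {b | ∃ n, R (lawSeq q b n) ∧ expect (lawSeq q b n) φ ≤ ENNReal.ofReal ε} := by
  obtain ⟨n, hn⟩ := exists_pow_lt_of_lt_one hε hr1
  refine ⟨2⁻¹ ^ n, pow_ne_zero _ (by simp), ?_⟩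
  rintro q ⟨hq, hqr⟩
  refine (pow_le_fairPath_replicate t n).trans (measure_mono fun b hb => ⟨n, hR q _ hq, ?_⟩)
  have key : ∀ m, expect (lawAt q (List.replicate m t)) φ ≤ ENNReal.ofReal (r ^ 2 ^ m) := by
    intro m
    induction m with
    | zero => simpa [lawAt] using hqr
    | succ m ih =>
      rw [List.replicate_succ, lawAt, hφ, pow_succ 2 m, pow_mul, ENNReal.ofReal_pow (by positivity)]
      exact pow_le_pow_left' ih 2
  rw [lawSeq, show firstSteps b n = List.replicate n t from hb]
  refine (key n).trans (ENNReal.ofReal_le_ofReal ?_)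
  exact (pow_le_pow_of_le_one hr hr1.le Nat.lt_two_pow_self.le).trans hn.le

theorem expect_excess_le_cost (p : Law) : expect p excess ≤ expect p cost := by
  refine expect_mono p fun a => ENNReal.ofReal_le_ofReal (Real.log_le_log (by positivity) ?_)
  have := a.coe_nonneg
  linarith

/-- A parameter choice behind the exponent `1 / 2`. -/
theorem exists_exponents {β : ℝ} (hβ : 0 < β) (hβ2 : β < 1 / 2) :
    ∃ μ κ : ℝ, 0 < μ ∧ μ < 1 / 2 ∧ β < μ ∧ 1 < κ ∧ κ < 2 ∧ κ ^ (1 - μ) < 2 ^ μ ∧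
      β * Real.log 2 < μ * Real.log κ := by
  set d := 1 / 2 - β with hd
  set μ := 1 / 2 - d / 4 with hμ
  have hd0 : 0 < d := by linarith
  have hd1 : d < 1 / 2 := by linarith
  have hμ0 : 0 < μ := by linarith
  -- As `μ → 1/2` the sides tend to `2β < 1` and to 1. Any `t` in between gives `κ = 2 ^ t`: the
  -- lower bound yields the rate, the upper one `κ ^ (1-μ) < 2 ^ μ`.
  have hlt : β / μ < μ / (1 - μ) := by
    rw [div_lt_div_iff₀ hμ0 (by linarith)]
    have : β = 1 / 2 - d := by linarith
    rw [this, hμ]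
    nlinarith
  obtain ⟨t, ht1, ht2⟩ := exists_between hlt
  have ht0 : 0 < t := (div_pos hβ hμ0).trans ht1
  rw [div_lt_iff₀ hμ0] at ht1
  rw [lt_div_iff₀ (by linarith)] at ht2
  have hl2 : 0 < Real.log 2 := Real.log_pos one_lt_two
  refine ⟨μ, 2 ^ t, hμ0, by linarith, by linarith, Real.one_lt_rpow one_lt_two ht0, ?_, ?_, ?_⟩
  · nth_rw 2 [← Real.rpow_one 2]
    exact Real.rpow_lt_rpow_of_exponent_lt one_lt_two (by nlinarith)
  · rw [← Real.rpow_mul zero_le_two]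
    exact Real.rpow_lt_rpow_of_exponent_lt one_lt_two ht2
  · rw [Real.log_rpow two_pos]
    nlinarith

section Fast

variable {β : ℝ} (hβ : 0 < β) (hβ2 : β < 1 / 2) (p : Law)
include hβ hβ2

/-- A run of minus steps brings the bias below the threshold with probability bounded below, and a
balanced continuation then converges fast; the zero-one law is applied to each stage. -/
theorem ae_fast_of_frequently_bias {r : ℝ} (hr : 0 ≤ r) (hr1 : r < 1)
    (hp : expect p cost ≠ ⊤) :
    ∀ᵐ b ∂fairPath, (∃ᶠ n in atTop, expect (lawSeq p b n) bias ≤ ENNReal.ofReal r) →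
      Fast β fun n => expect (lawSeq p b n) bias + expect (lawSeq p b n) excess := by
  obtain ⟨μ, κ, hμ0, hμ2, hβμ, -⟩ := exists_exponents hβ hβ2
  obtain ⟨c, hc⟩ := exists_balanced hμ2
  obtain ⟨c', hc', h1⟩ := exists_le_fairPath_of_squared (φ := bias) (t := false)
    expect_bias_false hr hr1 (ε := 2 ^ (-threshold 2 1 μ c)) (by positivity)
    (R := fun q => expect q cost ≠ ⊤) fun q w hq => expect_cost_lawAt_ne_top hq w
  filter_upwards [ae_frequently_of_frequently (Q := fun q => expect q cost ≠ ⊤ ∧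
      expect q bias ≤ ENNReal.ofReal r) (R := fun q => expect q cost ≠ ⊤ ∧
      expect q bias ≤ ENNReal.ofReal (2 ^ (-threshold 2 1 μ c))) hc' h1 p,
    ae_fast_of_frequently (c := 2⁻¹) (by simp) (β := β)
      (φ := fun q => expect q bias + expect q excess)
      (Q := fun q => expect q cost ≠ ⊤ ∧
        expect q bias ≤ ENNReal.ofReal (2 ^ (-threshold 2 1 μ c))) (fun q hq =>
        hc.trans (measure_mono fun b hb => fast_bias_excess hμ0 hβμ hb hq.2
          (ne_top_of_le_ne_top hq.1 (expect_excess_le_cost q)))) p] with b hb1 hb2 hb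
  exact hb2 (hb1 (hb.mono fun n hn => ⟨expect_cost_lawAt_ne_top hp _, hn⟩))

theorem ae_fast_of_frequently_nonzero {r : ℝ} (hr : 0 ≤ r) (hr1 : r < 1)
    (hp : expect p cost ≠ ⊤) :
    ∀ᵐ b ∂fairPath, (∃ᶠ n in atTop, expect (lawSeq p b n) nonzero ≤ ENNReal.ofReal r) →
      Fast β fun n => expect (lawSeq p b n) cost := by
  obtain ⟨μ, κ, hμ0, hμ2, hβμ, -⟩ := exists_exponents hβ hβ2
  obtain ⟨c, hc⟩ := exists_balanced hμ2
  obtain ⟨c', hc', h1⟩ := exists_le_fairPath_of_squared (φ := nonzero) (t := true)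
    expect_nonzero_true hr hr1 (ε := 2 ^ (-threshold 2 1 μ c)) (by positivity)
    (R := fun q => expect q cost ≠ ⊤) fun q w hq => expect_cost_lawAt_ne_top hq w
  filter_upwards [ae_frequently_of_frequently (Q := fun q => expect q cost ≠ ⊤ ∧
      expect q nonzero ≤ ENNReal.ofReal r) (R := fun q => expect q cost ≠ ⊤ ∧
      expect q nonzero ≤ ENNReal.ofReal (2 ^ (-threshold 2 1 μ c))) hc' h1 p,
    ae_fast_of_frequently (c := 2⁻¹) (by simp) (β := β) (φ := fun q => expect q cost)
      (Q := fun q => expect q cost ≠ ⊤ ∧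
        expect q nonzero ≤ ENNReal.ofReal (2 ^ (-threshold 2 1 μ c))) (fun q hq =>
        hc.trans (measure_mono fun b hb => fast_cost_of_nonzero hμ0 hβμ hb hq.2 hq.1)) p]
    with b hb1 hb2 hb
  exact hb2 (hb1 (hb.mono fun n hn => ⟨expect_cost_lawAt_ne_top hp _, hn⟩))

/-- Chains `Spread`, `Coarse`, `Sharp` and `Fast` through the zero-one law; the constants are fixed
in the reverse order, which determines `j`. -/
theorem exists_ae_fast_of_frequently_spread {C : ℝ} (hC : 0 ≤ C) :
    ∃ j : ℕ, ∀ᵐ b ∂fairPath, (∃ᶠ n in atTop, Spread C j (lawSeq p b n)) →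
      Fast β fun n => expect (lawSeq p b n) cost := by
  obtain ⟨μ, κ, hμ0, hμ2, hβμ, hκ, hκ2, hκμ, hβκ⟩ := exists_exponents hβ hβ2
  obtain ⟨c, hc⟩ := exists_balanced hμ2
  obtain ⟨η, k, K, D, hη, hk, hK, hD, h1⟩ := exists_fast_of_concentrated (c := c) hκ hκ2 hμ0
    (by linarith) hκμ hβκ
  obtain ⟨J, Z, h2⟩ := exists_sharp_of_coarse hη hk hK hD
  obtain ⟨j, h3⟩ := exists_coarse_of_spread hC J Z
  refine ⟨j, ?_⟩
  filter_upwards [ae_frequently_of_frequently (by simp) h3 p,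
    ae_frequently_of_frequently (by simp) h2 p,
    ae_fast_of_frequently (c := 2⁻¹) (by simp) (β := β) (φ := fun q => expect q cost)
      (Q := Sharp η k K D) (fun q hq => hc.trans (measure_mono fun b hb => by
        obtain ⟨hq0, x, L, y, lam, hconc, hL, hkx, hyx, hlam⟩ := hq
        exact h1 q x L y lam hconc hL hkx hyx hlam hq0 b hb)) p] with b hb1 hb2 hb3 hb
  exact hb3 (hb2 (hb1 hb))

end Fast

theorem bias_add_le_one {X y : ℝ} {a : ℝ≥0} (hX : 0 ≤ X) (h1 : Real.exp (-X) ≤ a)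
    (h2 : (a : ℝ) ≤ Real.exp y) :
    bias a + ENNReal.ofReal (2 * Real.exp (-X) / (1 + Real.exp y)) ≤ 1 := by
  unfold bias
  rw [← ENNReal.ofReal_add (by positivity) (by positivity), ← ENNReal.ofReal_one]
  refine ENNReal.ofReal_le_ofReal ?_
  have ha : (0 : ℝ) < 1 + a := by positivity
  have h3 : Real.exp (-X) ≤ 1 := Real.exp_le_one_iff.2 (by linarith)
  have h4 : 2 * Real.exp (-X) / (1 + Real.exp y) ≤ 2 * Real.exp (-X) / (1 + a) :=
    div_le_div_of_nonneg_left (by positivity) ha (by linarith)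
  refine (add_le_add_right h4 _).trans ?_
  rw [← add_div, div_le_one ha]
  have : |1 - (a : ℝ)| ≤ 1 + a - 2 * Real.exp (-X) := abs_le.2 ⟨by linarith, by linarith⟩
  linarith

/-- Bias near 1 forces most of the mass out of `[exp (-X), exp y]`, and the bounded loss keeps it
from lying above `exp y`. -/
theorem exists_spread_of_bias {C : ℝ} (hC : 0 ≤ C) (j : ℕ) :
    ∃ r : ℝ, 0 ≤ r ∧ r < 1 ∧ ∀ q : Law, expect q cost ≤ ENNReal.ofReal C →
      ENNReal.ofReal (3 / 4) < expect q nonzero → ENNReal.ofReal r < expect q bias →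
      Spread C j q := by
  -- Then `C / y ≤ 1/16`; the window between the levels contributes the other 1/16.
  set y : ℝ := 16 * C + 1 with hy
  set X : ℝ := 2 ^ j with hX
  have hX0 : 0 ≤ X := by positivity
  set θ : ℝ := 2 * Real.exp (-X) / (1 + Real.exp y) with hθ
  have hθ0 : 0 < θ := by positivity
  have hθ2 : θ ≤ 1 := by
    have h1 : Real.exp (-X) ≤ 1 := Real.exp_le_one_iff.2 (by linarith)
    have h2 : 1 ≤ Real.exp y := Real.one_le_exp (by positivity)
    rw [hθ, div_le_one (by positivity)]
    linarith
  refine ⟨1 - θ / 16, by linarith, by linarith, fun q hq h0 hT => ⟨hq, ?_, ?_⟩⟩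
  · have h1 : expect q nonzero = ENNReal.ofReal (prob q {0}ᶜ) := by
      rw [ofReal_prob]
      congr 1
      funext a
      by_cases ha : a = 0 <;> simp [nonzero, ha]
    rw [h1, prob_compl] at h0
    have := (ENNReal.ofReal_lt_ofReal_iff_of_nonneg (by norm_num)).1 h0
    linarith
  · set S : Set ℝ≥0 := Hi (-X) ∩ (Hi y)ᶜ with hS
    have h1 : prob q (Hi (-X)) ≤ prob q S + prob q (Hi y) := by
      refine (prob_mono q fun a ha => ?_).trans (prob_union_le q S (Hi y))
      by_cases h : a ∈ Hi y
      · exact Or.inr h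
      · exact Or.inl ⟨ha, h⟩
    have h2 : prob q (Hi y) ≤ 1 / 16 := by
      refine (prob_Hi_le_of_expect_cost_le hC (by positivity) hq).trans ?_
      rw [div_le_iff₀ (by positivity)]
      linarith
    have h3 : expect q bias + ENNReal.ofReal θ * expect q (S.indicator 1) ≤ 1 := by
      rw [← expect_mul_left, ← expect_add]
      refine (expect_mono q fun a => ?_).trans_eq (expect_const q 1)
      by_cases ha : a ∈ S
      · rw [Set.indicator_of_mem ha, Pi.one_apply, mul_one]
        exact bias_add_le_one hX0 (le_of_lt ha.1) (not_lt.1 ha.2)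
      · rw [Set.indicator_of_notMem ha, mul_zero, add_zero]
        exact bias_le_one a
    have h4 := (add_le_add_left hT.le _).trans h3
    rw [← ofReal_prob, ← ENNReal.ofReal_mul hθ0.le, ← ENNReal.ofReal_add (by linarith)
      (mul_nonneg hθ0.le (prob_mem q S).1), ← ENNReal.ofReal_one,
      ENNReal.ofReal_le_ofReal_iff zero_le_one] at h4
    have h5 : prob q S ≤ 1 / 16 := by
      by_contra! h6
      nlinarith
    linarith

theorem lintegral_cost (p : Law) (n : ℕ) :
    ∫⁻ b, expect (lawSeq p b n) cost ∂fairPath = expect p cost := by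
  induction n with
  | zero => simp [lawSeq_zero]
  | succ n ih =>
    have h := lintegral_firstSteps_succ (fun l => expect (lawAt p l) cost) n
    refine h.trans (Eq.trans ?_ ih)
    refine lintegral_congr fun b => ?_
    rw [lawAt, lawAt, expect_cost_add, ← mul_assoc,
      ENNReal.inv_mul_cancel two_ne_zero ENNReal.ofNat_ne_top, one_mul]
    rfl

theorem lintegral_liminf_cost_le (p : Law) :
    ∫⁻ b, liminf (fun n => expect (lawSeq p b n) cost) atTop ∂fairPath ≤ expect p cost := by
  refine (lintegral_liminf_le (f := fun n b => expect (lawSeq p b n) cost) fun n =>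
    measurable_firstSteps (fun l => expect (lawAt p l) cost) n).trans ?_
  simp_rw [lintegral_cost]
  simp

theorem ae_fast_or_fast {β : ℝ} (hβ : 0 < β) (hβ2 : β < 1 / 2) {p : Law}
    (hp : expect p cost ≠ ⊤) :
    ∀ᵐ b ∂fairPath,
      (Fast β fun n => expect (lawSeq p b n) bias + expect (lawSeq p b n) excess) ∨
      Fast β fun n => expect (lawSeq p b n) cost := by
  -- The finite limit inferior of the loss depends on the path, so the constants are prepared for
  -- every integer bound `C`.
  choose j hj using fun C : ℕ => exists_ae_fast_of_frequently_spread hβ hβ2 p (C := C) C.cast_nonneg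
  choose r hr0 hr1 hr using fun C : ℕ => exists_spread_of_bias (C := C) C.cast_nonneg (j C)
  have hfin : ∀ᵐ b ∂fairPath, liminf (fun n => expect (lawSeq p b n) cost) atTop < ⊤ := by
    refine ae_lt_top (Measurable.liminf fun n =>
      measurable_firstSteps (fun l => expect (lawAt p l) cost) n) ?_
    exact ne_top_of_le_ne_top hp (lintegral_liminf_cost_le p)
  filter_upwards [ae_all_iff.2 hj, ae_all_iff.2 fun C =>
    ae_fast_of_frequently_bias hβ hβ2 p (hr0 C) (hr1 C) hp,
    ae_fast_of_frequently_nonzero hβ hβ2 p (r := 3 / 4) (by norm_num) (by norm_num) hp, hfin]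
    with b h1 h2 h3 h4
  by_cases hnz : ∃ᶠ n in atTop, expect (lawSeq p b n) nonzero ≤ ENNReal.ofReal (3 / 4)
  · exact Or.inr (h3 hnz)
  obtain ⟨C, hC⟩ := ENNReal.exists_nat_gt h4.ne
  by_cases hT : ∃ᶠ n in atTop, expect (lawSeq p b n) bias ≤ ENNReal.ofReal (r C)
  · exact Or.inl (h2 C hT)
  have hfreq := frequently_lt_of_liminf_lt (by isBoundedDefault) hC
  rw [not_frequently] at hnz hT
  refine Or.inr (h1 C ((hfreq.and_eventually (hnz.and hT)).mono ?_))
  rintro n ⟨ha, hb, hc⟩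
  refine hr C _ ?_ (not_le.1 hb) (not_le.1 hc)
  rw [ENNReal.ofReal_natCast]
  exact ha.le

theorem Fast.tendsto_zero {β : ℝ} (hβ : 0 < β) {g : ℕ → ℝ≥0∞} (hg : Fast β g) :
    Tendsto g atTop (𝓝 0) := by
  refine tendsto_of_tendsto_of_tendsto_of_le_of_le' tendsto_const_nhds ?_
    (Eventually.of_forall fun _ => zero_le) (hg 0)
  rw [← ENNReal.ofReal_zero]
  refine (ENNReal.continuous_ofReal.tendsto 0).comp ?_
  have h1 : Tendsto (fun n : ℕ => (2 : ℝ) ^ (β * (n + 0 : ℕ))) atTop atTop := by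
    have h2 : (fun n : ℕ => (2 : ℝ) ^ (β * (n + 0 : ℕ))) = fun n => ((2 : ℝ) ^ β) ^ n := by
      funext n
      rw [Real.rpow_mul (by norm_num), Real.rpow_natCast, add_zero]
    rw [h2]
    exact tendsto_pow_atTop_atTop_of_one_lt (Real.one_lt_rpow one_lt_two hβ)
  have h3 := (tendsto_rpow_atBot_of_base_gt_one 2 one_lt_two).comp (tendsto_neg_atTop_atBot.comp h1)
  exact h3

/-! ### The limit, its speed and its distribution -/

/-- The speed `2 ^ (-N ^ β)` with `N = 2 ^ n`. -/
noncomputable def speed (β : ℝ) (n : ℕ) : ℝ := (2 : ℝ) ^ (-(((2 : ℝ) ^ n) ^ β))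

theorem speed_pos (β : ℝ) (n : ℕ) : 0 < speed β n := by unfold speed; positivity

theorem speed_anti {β β' : ℝ} (h : β ≤ β') (n : ℕ) : speed β' n ≤ speed β n := by
  refine Real.rpow_le_rpow_of_exponent_le one_le_two (neg_le_neg ?_)
  exact Real.rpow_le_rpow_of_exponent_le (one_le_pow₀ one_le_two) h

theorem Fast.eventually_le_speed {β : ℝ} {g : ℕ → ℝ≥0∞} (hg : Fast β g) :
    ∀ᶠ n in atTop, g n ≤ ENNReal.ofReal (speed β n) := by
  refine (hg 0).mono fun n hn => hn.trans_eq ?_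
  rw [speed, ← Real.rpow_natCast, ← Real.rpow_mul zero_le_two, mul_comm β, add_zero]

/-- The mutual information in bits as a function of the expected loss. -/
noncomputable def info (G : ℝ≥0∞) : ℝ := 1 - G.toReal / Real.log 2

/-- Paths along which the expected loss vanishes. -/
def goodPaths (p : Law) : Set (ℕ → Bool) :=
  {b | Tendsto (fun n => expect (lawSeq p b n) cost) atTop (𝓝 0)}

theorem measurableSet_goodPaths (p : Law) : MeasurableSet (goodPaths p) :=
  measurableSet_tendsto _ fun n => measurable_firstSteps (fun l => expect (lawAt p l) cost) n

open Classical in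
/-- The limit of the mutual information along a path. -/
noncomputable def limitInfo (p : Law) (b : ℕ → Bool) : ℝ := if b ∈ goodPaths p then 1 else 0

theorem measurable_limitInfo (p : Law) : Measurable (limitInfo p) := by
  classical
  exact Measurable.ite (measurableSet_goodPaths p) measurable_const measurable_const

theorem limitInfo_eq_zero_or_one (p : Law) (b : ℕ → Bool) :
    limitInfo p b = 0 ∨ limitInfo p b = 1 := by
  unfold limitInfo
  split_ifs
  · exact Or.inr rfl
  · exact Or.inl rfl

theorem abs_info_le_of_fast_cost {G : ℝ≥0∞} {δ : ℝ} (hδ : 0 ≤ δ) (h : G ≤ ENNReal.ofReal δ) :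
    |info G - 1| ≤ δ / Real.log 2 := by
  have hl : 0 < Real.log 2 := Real.log_pos one_lt_two
  have h1 := ENNReal.toReal_mono ENNReal.ofReal_ne_top h
  rw [ENNReal.toReal_ofReal hδ] at h1
  unfold info
  rw [sub_sub_cancel_left, abs_neg, abs_of_nonneg (by positivity)]
  exact div_le_div_of_nonneg_right h1 hl.le

theorem abs_info_le_of_bias_add_excess (q : Law) {δ : ℝ} (hδ : 0 ≤ δ)
    (h : expect q bias + expect q excess ≤ ENNReal.ofReal δ) :
    |info (expect q cost)| ≤ δ / Real.log 2 := by
  have hl : 0 < Real.log 2 := Real.log_pos one_lt_two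
  have h1 : expect q cost ≤ ENNReal.ofReal (Real.log 2 + δ) := by
    rw [ENNReal.ofReal_add hl.le hδ]
    refine (expect_mono q cost_le_log_two_add).trans ?_
    rw [expect_add, expect_const]
    exact add_le_add_right (le_add_self.trans h) _
  have h2 : ENNReal.ofReal (Real.log 2) ≤ expect q cost + ENNReal.ofReal δ := by
    rw [← expect_const q (ENNReal.ofReal (Real.log 2))]
    refine (expect_mono q log_two_le_cost_add).trans ?_
    rw [expect_add]
    exact add_le_add_right (le_self_add.trans h) _
  have hne : expect q cost ≠ ⊤ := ne_top_of_le_ne_top ENNReal.ofReal_ne_top h1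
  have h3 := ENNReal.toReal_mono ENNReal.ofReal_ne_top h1
  rw [ENNReal.toReal_ofReal (by positivity)] at h3
  have h4 := ENNReal.toReal_mono (ENNReal.add_ne_top.2 ⟨hne, ENNReal.ofReal_ne_top⟩) h2
  rw [ENNReal.toReal_ofReal hl.le, ENNReal.toReal_add hne ENNReal.ofReal_ne_top,
    ENNReal.toReal_ofReal hδ] at h4
  unfold info
  rw [one_sub_div hl.ne', abs_div, abs_of_pos hl]
  refine div_le_div_of_nonneg_right (abs_le.2 ⟨by linarith, by linarith⟩) hl.le

theorem tendsto_cost_of_bias_add_excess {p : Law} {b : ℕ → Bool}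
    (h : Tendsto (fun n => expect (lawSeq p b n) bias + expect (lawSeq p b n) excess) atTop (𝓝 0)) :
    Tendsto (fun n => expect (lawSeq p b n) cost) atTop (𝓝 (ENNReal.ofReal (Real.log 2))) := by
  set g := fun n => expect (lawSeq p b n) bias + expect (lawSeq p b n) excess with hg
  set l := ENNReal.ofReal (Real.log 2) with hl
  have h1 : Tendsto (fun n => l - g n) atTop (𝓝 (l - 0)) :=
    ENNReal.Tendsto.sub tendsto_const_nhds h (Or.inl ENNReal.ofReal_ne_top)
  have h2 : Tendsto (fun n => l + g n) atTop (𝓝 (l + 0)) := tendsto_const_nhds.add h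
  rw [tsub_zero] at h1
  rw [add_zero] at h2
  refine tendsto_of_tendsto_of_tendsto_of_le_of_le h1 h2 (fun n => ?_) fun n => ?_
  · rw [tsub_le_iff_right]
    have h3 := expect_mono (lawSeq p b n) log_two_le_cost_add
    rw [expect_const, expect_add] at h3
    exact h3.trans (add_le_add_right le_self_add _)
  · have h3 := expect_mono (lawSeq p b n) cost_le_log_two_add
    rw [expect_add, expect_const] at h3
    exact h3.trans (add_le_add_right le_add_self _)

theorem ae_tendsto_or_tendsto {p : Law} (hp : expect p cost ≠ ⊤) :
    ∀ᵐ b ∂fairPath, b ∈ goodPaths p ∨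
      Tendsto (fun n => expect (lawSeq p b n) cost) atTop (𝓝 (ENNReal.ofReal (Real.log 2))) := by
  filter_upwards [ae_fast_or_fast (β := 1 / 4) (by norm_num) (by norm_num) hp] with b hb
  rcases hb with hb | hb
  · exact Or.inr (tendsto_cost_of_bias_add_excess (hb.tendsto_zero (by norm_num)))
  · exact Or.inl (hb.tendsto_zero (by norm_num))

theorem ae_speed {β : ℝ} (hβ : β < 1 / 2) {p : Law} (hp : expect p cost ≠ ⊤) :
    ∀ᵐ b ∂fairPath, ∀ᶠ n in atTop,
      |info (expect (lawSeq p b n) cost) - limitInfo p b| ≤ (Real.log 2)⁻¹ * speed β n := by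
  -- For nonpositive or small `β` a larger positive exponent is used; its speed is faster.
  have h1 : 0 < max β (1 / 4) := lt_of_lt_of_le (by norm_num) (le_max_right _ _)
  have h2 : max β (1 / 4) < 1 / 2 := max_lt hβ (by norm_num)
  have hl : 0 < Real.log 2 := Real.log_pos one_lt_two
  filter_upwards [ae_fast_or_fast h1 h2 hp] with b hb
  have key : ∀ n, speed (max β (1 / 4)) n / Real.log 2 ≤ (Real.log 2)⁻¹ * speed β n := by
    intro n
    rw [div_eq_inv_mul]
    exact mul_le_mul_of_nonneg_left (speed_anti (le_max_left _ _) n) (inv_pos.2 hl).le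
  rcases hb with hb | hb
  · have hne : b ∉ goodPaths p := by
      intro hmem
      have := tendsto_nhds_unique hmem (tendsto_cost_of_bias_add_excess (hb.tendsto_zero h1))
      exact absurd this (ENNReal.ofReal_pos.2 hl).ne
    filter_upwards [hb.eventually_le_speed] with n hn
    rw [limitInfo, if_neg hne, sub_zero]
    exact (abs_info_le_of_bias_add_excess _ (speed_pos _ _).le hn).trans (key n)
  · have hmem : b ∈ goodPaths p := hb.tendsto_zero h1
    filter_upwards [hb.eventually_le_speed] with n hn
    rw [limitInfo, if_pos hmem]
    exact (abs_info_le_of_fast_cost (speed_pos _ _).le hn).trans (key n)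

theorem ae_tendsto_info {p : Law} (hp : expect p cost ≠ ⊤) :
    ∀ᵐ b ∂fairPath, Tendsto (fun n => info (expect (lawSeq p b n) cost)) atTop
      (𝓝 (limitInfo p b)) := by
  have hl : 0 < Real.log 2 := Real.log_pos one_lt_two
  have hcont : ∀ {c : ℝ≥0∞} {f : ℕ → ℝ≥0∞}, c ≠ ⊤ → Tendsto f atTop (𝓝 c) →
      Tendsto (fun n => info (f n)) atTop (𝓝 (info c)) := fun hc hf =>
    (((ENNReal.tendsto_toReal hc).comp hf).div_const _).const_sub 1
  filter_upwards [ae_tendsto_or_tendsto hp] with b hb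
  by_cases hmem : b ∈ goodPaths p
  · rw [limitInfo, if_pos hmem]
    simpa [info] using hcont ENNReal.zero_ne_top hmem
  · rw [limitInfo, if_neg hmem]
    have := hcont ENNReal.ofReal_ne_top (hb.resolve_left hmem)
    rwa [info, ENNReal.toReal_ofReal hl.le, div_self hl.ne', sub_self] at this

/-- Off the good paths the loss tends to `log 2`, so Fatou bounds `log 2` times their complement by
the initial loss. The additive form avoids truncated subtraction. -/
theorem one_sub_le_fairPath_goodPaths {p : Law} (hp : expect p cost ≠ ⊤) :
    1 ≤ fairPath (goodPaths p) + expect p cost / ENNReal.ofReal (Real.log 2) := by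
  have hl : 0 < Real.log 2 := Real.log_pos one_lt_two
  have h1 : ENNReal.ofReal (Real.log 2) * fairPath (goodPaths p)ᶜ ≤ expect p cost := by
    rw [← lintegral_indicator_const (measurableSet_goodPaths p).compl]
    refine (lintegral_mono_ae ?_).trans (lintegral_liminf_cost_le p)
    filter_upwards [ae_tendsto_or_tendsto hp] with b hb
    by_cases hmem : b ∈ goodPaths p
    · rw [Set.indicator_of_notMem (by simpa using hmem)]
      exact zero_le
    · rw [Set.indicator_of_mem (by simpa using hmem), (hb.resolve_left hmem).liminf_eq]
  have h2 : fairPath (goodPaths p)ᶜ ≤ expect p cost / ENNReal.ofReal (Real.log 2) := by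
    rw [ENNReal.le_div_iff_mul_le (Or.inl (ENNReal.ofReal_pos.2 hl).ne')
      (Or.inl ENNReal.ofReal_ne_top), mul_comm]
    exact h1
  rw [← prob_add_prob_compl (μ := fairPath) (measurableSet_goodPaths p)]
  exact add_le_add_right h2 _

theorem expect_cost_ne_top {Y : Type*} {W V : BDMC Y} (h : ⊥ < BDMC.mutualInfo W V) :
    expect (law W V) cost ≠ ⊤ := by
  intro htop
  rw [mutualInfo_eq (dominated_of_bot_lt h), htop,
    ENNReal.top_div_of_ne_top ENNReal.ofReal_ne_top] at h
  simp at h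

theorem infoProcess_eq {Y : Type*} {W V : BDMC Y} (h : ⊥ < BDMC.mutualInfo W V) (b : ℕ → Bool)
    (n : ℕ) :
    BDMC.infoProcess W V b n = ((info (expect (lawSeq (law W V) b n) cost) : ℝ) : EReal) := by
  have hd := dominated_of_bot_lt h
  have hl : 0 < Real.log 2 := Real.log_pos one_lt_two
  have hne : expect (lawSeq (law W V) b n) cost ≠ ⊤ :=
    expect_cost_lawAt_ne_top (expect_cost_ne_top h) _
  rw [BDMC.infoProcess, mutualInfo_eq (dominated_synth hd _), law_synth hd]
  change (1 : EReal) - ((expect (lawSeq (law W V) b n) cost / _ : ℝ≥0∞) : EReal) = _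
  have hne' : expect (lawSeq (law W V) b n) cost / ENNReal.ofReal (Real.log 2) ≠ ⊤ :=
    ENNReal.div_ne_top hne (ENNReal.ofReal_pos.2 hl).ne'
  rw [← EReal.coe_ennreal_toReal hne', ENNReal.toReal_div, ENNReal.toReal_ofReal hl.le, info,
    EReal.coe_sub, EReal.coe_one]

end Polar

theorem theorem1 {Y : Type*} (W V : BDMC Y) (hWV : ⊥ < BDMC.mutualInfo W V)
    {Ω : Type*} [MeasurableSpace Ω] (P : Measure Ω) [IsProbabilityMeasure P]
    (B : ℕ → Ω → Bool) (hB_meas : ∀ n, Measurable (B n)) (hB_indep : iIndepFun B P)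
    (hB_unif : ∀ n, P {ω | B n ω = true} = 1 / 2) :
    ∃ I_inf : Ω → ℝ, Measurable I_inf ∧
      (∀ᵐ ω ∂P, Tendsto (fun n => BDMC.infoProcess W V (fun k => B k ω) n) atTop
        (𝓝 ((I_inf ω : ℝ) : EReal))) ∧
      (∀ᵐ ω ∂P, I_inf ω = 0 ∨ I_inf ω = 1) ∧
      BDMC.mutualInfo W V ≤ ((P {ω | I_inf ω = 1} : ℝ≥0∞) : EReal) ∧
      (∀ β : ℝ, β < 1 / 2 → ∀ᵐ ω ∂P, ∃ C : ℝ, ∀ᶠ n : ℕ in atTop,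
        ((I_inf ω - C * (2 : ℝ) ^ (-(((2 : ℝ) ^ n) ^ β)) : ℝ) : EReal)
            ≤ BDMC.infoProcess W V (fun k => B k ω) n ∧
          BDMC.infoProcess W V (fun k => B k ω) n
            ≤ ((I_inf ω + C * (2 : ℝ) ^ (-(((2 : ℝ) ^ n) ^ β)) : ℝ) : EReal)) := by
  have hp := Polar.expect_cost_ne_top hWV
  set p := Polar.law W V with hpdef
  have hmap := Polar.map_eq_fairPath hB_meas hB_indep hB_unif
  have hBm : Measurable fun ω n => B n ω := measurable_pi_lambda _ hB_meas
  -- Almost sure statements about fair paths transfer to the given bits through their joint law.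
  have hae : ∀ {Q : (ℕ → Bool) → Prop}, (∀ᵐ b ∂Polar.fairPath, Q b) →
      ∀ᵐ ω ∂P, Q fun n => B n ω := by
    intro Q hQ
    rw [← hmap] at hQ
    exact ae_of_ae_map hBm.aemeasurable hQ
  have hgood := Polar.measurableSet_goodPaths p
  refine ⟨fun ω => Polar.limitInfo p fun n => B n ω, ?_, ?_, ?_, ?_, ?_⟩
  · exact (Polar.measurable_limitInfo p).comp hBm
  · filter_upwards [hae (Polar.ae_tendsto_info hp)] with ω hω
    simp_rw [Polar.infoProcess_eq hWV]
    exact (continuous_coe_real_ereal.tendsto _).comp hω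
  · exact ae_of_all _ fun ω => Polar.limitInfo_eq_zero_or_one p _
  · have e : {ω | Polar.limitInfo p (fun n => B n ω) = 1} =
        (fun ω n => B n ω) ⁻¹' Polar.goodPaths p := by
      ext ω
      simp [Polar.limitInfo]
    have h1 := Polar.one_sub_le_fairPath_goodPaths hp
    rw [e, ← Measure.map_apply hBm hgood, hmap,
      Polar.mutualInfo_eq (Polar.dominated_of_bot_lt hWV)]
    refine EReal.sub_le_of_le_add ?_
    exact_mod_cast h1
  · intro β hβ
    filter_upwards [hae (Polar.ae_speed hβ hp)] with ω hω
    refine ⟨(Real.log 2)⁻¹, hω.mono fun n hn => ?_⟩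
    rw [Polar.infoProcess_eq hWV, EReal.coe_le_coe_iff, EReal.coe_le_coe_iff]
    obtain ⟨h1, h2⟩ := abs_le.1 hn
    unfold Polar.speed at h1 h2
    constructor
    · linarith
    · linarith
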